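/- **Theorem 3.4 (super-convergence for post-processed controls I).** *Continuous problem.* Let $n\in\{2,3\}$, let $\Omega\subset\mathbb R^n$ be a bounded domain (open, connected, non-empty), and let $A:\Omega\to M_n(\mathbb R)$ be measurable, bounded, uniformly elliptic, and symmetric a.e. Let $\alpha>0$, $f,\overline y_d,\overline u_d\in L^2(\Omega)$, and let $a\le b$ be bounds, possibly infinite, with $a\neq+\infty$, $b\neq-\infty$. Write $\|\cdot\|$, $(\cdot,\cdot)$ for the norm and inner product of $L^2(\Omega)$ (or $L^2(\Omega)^n$), $a(z,w)=\int_\Omega A\nabla z\cdot\nabla w$, and $\mathcal U_{ad}=\{u\in L^2(\Omega): a\le u\le b\text{ a.e.}\}$. Let $(\overline y,\overline p,\overline u)\in H^1_0(\Omega)\times H^1_0(\Omega)\times\mathcal U_{ad}$ satisfy $$a(\overline y,w)=(f+\overline u,w),\quad a(w,\overline p)=(\overline y-\overline y_d,w)\quad\forall w\in H^1_0(\Omega),\qquad (\overline p+\alpha(\overline u-\overline u_d),v-\overline u)\ge0\quad\forall v\in\mathcal U_{ad}.$$ *Mesh.* Let $\mathcal T$ be a mesh of $\Omega$: a finite family of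 non-empty, pairwise disjoint open polygonal/polyhedral cells $K\subset\Omega$ (interiors of finite unions of convex polytopes), whose closures cover $\Omega$, each $K$ being star-shaped with respect to its centroid $\overline x_K$. Let $h=\max_K\operatorname{diam}(K)$, $\rho_K=\max\{r>0:B(\overline x_K,r)\subset K\}$, and let $\eta$ be such that $\operatorname{diam}(K)/\rho_K\le\eta$ for all $K\in\mathcal T$. Let $\mathcal U_h$ be the space of functions that are constant on each cell, let $(\mathcal P_{\mathcal T}v)_{|K}=\frac1{|K|}\int_Kv$ for $K\in\mathcal T$, and let $P_{[a,b]}(s)=\min(b,\max(a,s))$. *Gradient discretisation.* Let $\mathcal D=(X_{\mathcal D,0},\Pi_{\mathcal D},\nabla_{\mathcal D})$, where $X_{\mathcal D,0}$ is a finite-dimensional real vector space, $\Pi_{\mathcal D}:X_{\mathcal D,0}\to L^2(\Omega)$ and $\nabla_{\mathcal D}:X_{\mathcal D,0}\to L^2(\Omega)^n$ are linear, and $\|\nabla_{\mathcal D}\cdot\|$ is a norm on $X_{\mathcal D,0}$. Put $C_{\mathcal D}=\max_{v\ne0}\|\Pi_{\mathcal D}v\|/\|\nabla_{\mathcal D}v\|$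 and $a_{\mathcal D}(v,w)=\int_\Omega A\nabla_{\mathcal D}v\cdot\nabla_{\mathcal D}w$, and let $M$ be an upper bound of $C_{\mathcal D}$. Let $(\overline y_{\mathcal D},\overline p_{\mathcal D},\overline u_h)\in X_{\mathcal D,0}\times X_{\mathcal D,0}\times(\mathcal U_{ad}\cap\mathcal U_h)$ satisfy, for all $w\in X_{\mathcal D,0}$ and all $v_h\in\mathcal U_{ad}\cap\mathcal U_h$, $$a_{\mathcal D}(\overline y_{\mathcal D},w)=(f+\overline u_h,\Pi_{\mathcal D}w),\quad a_{\mathcal D}(w,\overline p_{\mathcal D})=(\Pi_{\mathcal D}\overline y_{\mathcal D}-\overline y_d,\Pi_{\mathcal D}w),\quad(\Pi_{\mathcal D}\overline p_{\mathcal D}+\alpha(\overline u_h-\overline u_d),v_h-\overline u_h)\ge0.$$ *Assumptions, with a constant $c$.* - (A1) To each $w\in H^2(\Omega)$ is associated $w_{\mathcal T}\in L^2(\Omega)$ such that: (i) if $w\in H^2(\Omega)\cap H^1_0(\Omega)$ is the weak solution of $-\operatorname{div}(A\nabla w)=g$ with $g\in H^1(\Omega)$, and $w_{\mathcal D}\in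 X_{\mathcal D,0}$ satisfies $a_{\mathcal D}(w_{\mathcal D},v)=(g,\Pi_{\mathcal D}v)$ for all $v\in X_{\mathcal D,0}$, then $\|\Pi_{\mathcal D}w_{\mathcal D}-w_{\mathcal T}\|\le c\,h^2\|g\|_{H^1(\Omega)}$; (ii) for all $w\in H^2(\Omega)$ and $v\in X_{\mathcal D,0}$, $|(w-w_{\mathcal T},\Pi_{\mathcal D}v)|\le c\,h^2\|w\|_{H^2(\Omega)}\|\Pi_{\mathcal D}v\|$ and $\|\mathcal P_{\mathcal T}(w-w_{\mathcal T})\|\le c\,h^2\|w\|_{H^2(\Omega)}$. - (A2) $\|\Pi_{\mathcal D}v-\mathcal P_{\mathcal T}(\Pi_{\mathcal D}v)\|\le c\,h\|\nabla_{\mathcal D}v\|$ for all $v\in X_{\mathcal D,0}$. - (A3) $\|\Pi_{\mathcal D}v\|_{L^{2^*}(\Omega)}\le c\,\|\nabla_{\mathcal D}v\|$ for all $v\in X_{\mathcal D,0}$, where $2^*\in[2,\infty)$ is given if $n=2$, and $2^*=\frac{2n}{n-2}=6$ if $n=3$. - (A4) Let $\mathcal T_1$ be the set of cells $K\in\mathcal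 T$ on which none of the following holds: $\overline u=a$ a.e., $\overline u=b$ a.e., $a<\overline u<b$ a.e. Let $\Omega_{1,\mathcal T}$ be the interior of $\bigcup_{K\in\mathcal T_1}\overline K$. Then $|\Omega_{1,\mathcal T}|\le c\,h$, and $\overline u\in W^{1,\infty}(K)$ for each $K\in\mathcal T_1$. Put $\|\overline u\|_{W^{1,\infty}(\mathcal T_1)}=\max_{K\in\mathcal T_1}\|\overline u\|_{W^{1,\infty}(K)}$ ($=0$ if $\mathcal T_1=\emptyset$). Assume moreover that $\overline u_d,\overline y,\overline p\in H^2(\Omega)$ and $\overline y_d,f\in H^1(\Omega)$. Let $$\widetilde u=P_{[a,b]}\big(\mathcal P_{\mathcal T}\overline u_d-\alpha^{-1}\overline p_{\mathcal T}\big),\qquad\widetilde u_h=P_{[a,b]}\big(\mathcal P_{\mathcal T}\overline u_d-\alpha^{-1}\Pi_{\mathcal D}\overline p_{\mathcal D}\big).$$ *Conclusion.* There are a constant $C_\alpha$ depending only on $\alpha$ and a constant $C$ depending only on $\Omega$, $A$, $M$, $\eta$ and $c$ such that $$\|\widetilde u-\widetilde u_h\|\le C\Big(C_\alpha\,h^{2-\frac1{2^*}}\|\overline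 u\|_{W^{1,\infty}(\mathcal T_1)}+C_\alpha\,h^2\,\mathcal F\Big),$$ $$\mathcal F=\operatorname{minmod}(a,b)+\|\overline y_d\|_{H^1(\Omega)}+\|\overline u_d\|_{H^2(\Omega)}+\|f\|_{H^1(\Omega)}+\|\overline y\|_{H^2(\Omega)}+\|\overline p\|_{H^2(\Omega)},$$ where $\operatorname{minmod}(a,b)=0$ if $ab\le0$ (with $0\cdot(\pm\infty)=0$) and $\operatorname{minmod}(a,b)=\min(|a|,|b|)$ otherwise. In particular $C$ and $C_\alpha$ do not depend on the mesh, the gradient discretisation, the data, the bounds $a,b$ or the exponent $2^*$; the exponent $2-\frac1{2^*}$ is $2-\epsilon$ with $\epsilon=\frac1{2^*}\in(0,\frac12]$ if $n=2$ (arbitrarily small when $2^*$ is large), and $\frac{11}6$ if $n=3$. -/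

import Mathlib

open MeasureTheory Set
open scoped ENNReal ContDiff Matrix

noncomputable section

namespace GDM

/-- The Euclidean space `ℝⁿ`. -/
abbrev Rn (n : ℕ) : Type := EuclideanSpace ℝ (Fin n)

/-- `L²(Ω)`, with its Hilbert norm and inner product. -/
abbrev L2 {n : ℕ} (Ω : Set (Rn n)) := Lp ℝ 2 (volume.restrict Ω)

/-- `L²(Ω)ⁿ`. -/
abbrev L2V {n : ℕ} (Ω : Set (Rn n)) := Lp (Rn n) 2 (volume.restrict Ω)

/-! Sobolev spaces, through weak derivatives -/

/-- `φ ∈ C_c^∞(U)`. -/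
structure IsTestFunction {n : ℕ} (U : Set (Rn n)) (φ : Rn n → ℝ) : Prop where
  smooth : ContDiff ℝ ∞ φ
  compact : HasCompactSupport φ
  support_subset : tsupport φ ⊆ U

/-- `G` is the weak gradient of `u` on the open set `U`:
`∫_U u ∂_e φ = - ∫_U (G · e) φ` for every test function `φ` and every direction `e`. -/
structure HasWeakGrad {n : ℕ} (U : Set (Rn n)) (u : Rn n → ℝ) (G : Rn n → Rn n) : Prop where
  locInt : LocallyIntegrableOn u U volume
  locInt_grad : LocallyIntegrableOn G U volume
  integral_eq : ∀ φ : Rn n → ℝ, IsTestFunction U φ → ∀ e : Rn n,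
    ∫ x in U, u x * fderiv ℝ φ x e = - ∫ x in U, inner ℝ (G x) e * φ x

open Classical in
/-- The weak gradient (unique almost everywhere on `U`); it is only used where it exists. -/
def weakGrad {n : ℕ} (U : Set (Rn n)) (u : Rn n → ℝ) : Rn n → Rn n :=
  if h : ∃ G, HasWeakGrad U u G then h.choose else 0

/-- `u ∈ H¹(U)`. -/
def MemH1 {n : ℕ} (U : Set (Rn n)) (u : Rn n → ℝ) : Prop :=
  MemLp u 2 (volume.restrict U) ∧
    ∃ G, HasWeakGrad U u G ∧ MemLp G 2 (volume.restrict U)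

/-- The norm of `H¹(U)`. -/
def h1Norm {n : ℕ} (U : Set (Rn n)) (u : Rn n → ℝ) : ℝ :=
  Real.sqrt ((eLpNorm u 2 (volume.restrict U)).toReal ^ 2 +
    (eLpNorm (weakGrad U u) 2 (volume.restrict U)).toReal ^ 2)

/-- `u ∈ H²(U)`: `u`, and its first and second order weak derivatives, belong to `L²(U)`. -/
def MemH2 {n : ℕ} (U : Set (Rn n)) (u : Rn n → ℝ) : Prop :=
  MemLp u 2 (volume.restrict U) ∧
    ∃ G, HasWeakGrad U u G ∧ ∀ i : Fin n, MemH1 U (fun x => G x i)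

/-- The norm of `H²(U)`:
`‖u‖² = ‖u‖²_{L²} + ∑ᵢ ‖∂ᵢu‖²_{L²} + ∑ᵢⱼ ‖∂ⱼ∂ᵢu‖²_{L²}`. -/
def h2Norm {n : ℕ} (U : Set (Rn n)) (u : Rn n → ℝ) : ℝ :=
  Real.sqrt ((eLpNorm u 2 (volume.restrict U)).toReal ^ 2 +
    ∑ i : Fin n, h1Norm U (fun x => weakGrad U u x i) ^ 2)

/-- `u ∈ H¹₀(U)`: `u` is a limit in `H¹(U)` of functions in `C_c^∞(U)`. -/
def MemH10 {n : ℕ} (U : Set (Rn n)) (u : Rn n → ℝ) : Prop :=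
  MemH1 U u ∧ ∀ ε > 0, ∃ φ, IsTestFunction U φ ∧ h1Norm U (fun x => u x - φ x) < ε

/-- `u ∈ W^{1,∞}(U)`. -/
def MemW1inf {n : ℕ} (U : Set (Rn n)) (u : Rn n → ℝ) : Prop :=
  MemLp u ∞ (volume.restrict U) ∧
    ∃ G, HasWeakGrad U u G ∧ MemLp G ∞ (volume.restrict U)

/-- `u` belongs to the broken space `W^{1,∞}(S)`, for a family `S` of cells. -/
def MemBrokenW1inf {n : ℕ} (S : Set (Set (Rn n))) (u : Rn n → ℝ) : Prop :=
  ∀ K ∈ S, MemW1inf K u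

/-- The norm of the broken space `W^{1,∞}(S)`: the largest of the `W^{1,∞}(K)` norms, `K ∈ S`
(it is `0` if `S` is empty). -/
def brokenW1infNorm {n : ℕ} (S : Set (Set (Rn n))) (u : Rn n → ℝ) : ℝ :=
  (⨆ K ∈ S, (eLpNorm u ∞ (volume.restrict K) +
    eLpNorm (weakGrad K u) ∞ (volume.restrict K))).toReal

/-! The control problem -/

/-- `A` is measurable, bounded, uniformly elliptic and symmetric, almost everywhere on `Ω`. -/
structure IsDiffusionMatrix {n : ℕ} (Ω : Set (Rn n))
    (A : Rn n → Matrix (Fin n) (Fin n) ℝ) : Prop where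
  measurable : ∀ i j, AEStronglyMeasurable (fun x => A x i j) (volume.restrict Ω)
  bounded : ∃ B : ℝ, ∀ᵐ x ∂(volume.restrict Ω), ∀ i j, |A x i j| ≤ B
  elliptic : ∃ lam : ℝ, 0 < lam ∧ ∀ᵐ x ∂(volume.restrict Ω), ∀ ξ : Rn n,
    lam * ‖ξ‖ ^ 2 ≤ ξ.ofLp ⬝ᵥ (A x *ᵥ ξ.ofLp)
  symmetric : ∀ᵐ x ∂(volume.restrict Ω), (A x).IsSymm

/-- `∫_Ω A G · H`. -/
def diffusionForm {n : ℕ} (Ω : Set (Rn n)) (A : Rn n → Matrix (Fin n) (Fin n) ℝ)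
    (G H : Rn n → Rn n) : ℝ :=
  ∫ x in Ω, (A x *ᵥ (G x).ofLp) ⬝ᵥ (H x).ofLp

/-- `a(z, w) = ∫_Ω A ∇z · ∇w`. -/
def bilin {n : ℕ} (Ω : Set (Rn n)) (A : Rn n → Matrix (Fin n) (Fin n) ℝ)
    (z w : Rn n → ℝ) : ℝ :=
  diffusionForm Ω A (weakGrad Ω z) (weakGrad Ω w)

/-- `w ∈ H¹₀(Ω)` is the weak solution of `-div(A∇w) = g` in `Ω`, `w = 0` on `∂Ω`. -/
def IsWeakSolution {n : ℕ} (Ω : Set (Rn n)) (A : Rn n → Matrix (Fin n) (Fin n) ℝ)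
    (g w : L2 Ω) : Prop :=
  MemH10 Ω w ∧ ∀ v : L2 Ω, MemH10 Ω v → bilin Ω A w v = inner ℝ g v

/-- The admissible controls: `u ∈ L²(Ω)` with `a ≤ u ≤ b` a.e.; the bounds may be infinite. -/
def Uad {n : ℕ} (Ω : Set (Rn n)) (a b : EReal) : Set (L2 Ω) :=
  {u | ∀ᵐ x ∂(volume.restrict Ω), a ≤ ((u x : ℝ) : EReal) ∧ ((u x : ℝ) : EReal) ≤ b}

/-- The optimality (Karush-Kuhn-Tucker) system for the optimal state `y`, co-state `p` and
control `u`. -/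
structure IsOptimal {n : ℕ} (Ω : Set (Rn n)) (A : Rn n → Matrix (Fin n) (Fin n) ℝ)
    (α : ℝ) (a b : EReal) (f yd ud y p u : L2 Ω) : Prop where
  state_mem : MemH10 Ω y
  adjoint_mem : MemH10 Ω p
  control_mem : u ∈ Uad Ω a b
  state_eq : ∀ w : L2 Ω, MemH10 Ω w → bilin Ω A y w = inner ℝ (f + u) w
  adjoint_eq : ∀ w : L2 Ω, MemH10 Ω w → bilin Ω A w p = inner ℝ (y - yd) w
  control_ineq : ∀ v ∈ Uad Ω a b, 0 ≤ inner ℝ (p + α • (u - ud)) (v - u)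

/-! Gradient discretisations -/

/-- A gradient discretisation for homogeneous Dirichlet boundary conditions, with `X` as its
(finite-dimensional) space of degrees of freedom; `‖∇_D ·‖` is a norm on `X`. -/
structure GradientDiscretisation {n : ℕ} (Ω : Set (Rn n)) (X : Type*) [AddCommGroup X]
    [Module ℝ X] where
  /-- the reconstruction `Π_D` of functions -/
  recon : X →ₗ[ℝ] L2 Ω
  /-- the reconstruction `∇_D` of gradients -/
  grad : X →ₗ[ℝ] L2V Ω
  eq_zero_of_grad : ∀ v : X, ‖grad v‖ = 0 → v = 0

section Discrete

variable {n : ℕ} {Ω : Set (Rn n)} {X : Type*} [AddCommGroup X] [Module ℝ X]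

/-- `C_D = max_{w ≠ 0} ‖Π_D w‖ / ‖∇_D w‖`. -/
def GradientDiscretisation.coercivity (D : GradientDiscretisation Ω X) : ℝ :=
  sSup {r : ℝ | ∃ w : X, w ≠ 0 ∧ r = ‖D.recon w‖ / ‖D.grad w‖}

/-- `a_D(v, w) = ∫_Ω A ∇_D v · ∇_D w`. -/
def GradientDiscretisation.bilin (D : GradientDiscretisation Ω X)
    (A : Rn n → Matrix (Fin n) (Fin n) ℝ) (v w : X) : ℝ :=
  diffusionForm Ω A (D.grad v) (D.grad w)

/-- `ψ` solves the gradient scheme for `-div(A∇ψ) = F`, `ψ = 0` on the boundary. -/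
def GradientDiscretisation.IsSchemeSolution (D : GradientDiscretisation Ω X)
    (A : Rn n → Matrix (Fin n) (Fin n) ℝ) (F : L2 Ω) (ψ : X) : Prop :=
  ∀ w : X, D.bilin A ψ w = inner ℝ F (D.recon w)

end Discrete

/-! Meshes -/

/-- Open polygonal (`n = 2`) or polyhedral (`n = 3`) sets: interiors of finite unions of convex
polytopes. -/
def IsPolytopal {n : ℕ} (K : Set (Rn n)) : Prop :=
  ∃ F : Finset (Finset (Rn n)), K = interior (⋃ s ∈ F, convexHull ℝ (s : Set (Rn n)))

/-- The centre of gravity of a cell. -/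
def centroid {n : ℕ} (K : Set (Rn n)) : Rn n := ⨍ x in K, x

/-- A mesh of `Ω`: a finite partition of `Ω` (up to the boundaries of the cells) into open
polytopal cells, each of which is star-shaped with respect to its centroid. -/
structure IsMesh {n : ℕ} (Ω : Set (Rn n)) (T : Finset (Set (Rn n))) : Prop where
  subset : ∀ K ∈ T, K ⊆ Ω
  nonempty : ∀ K ∈ T, K.Nonempty
  polytopal : ∀ K ∈ T, IsPolytopal K
  disjoint : (T : Set (Set (Rn n))).PairwiseDisjoint id
  cover : Ω ⊆ ⋃ K ∈ T, closure K
  starShaped : ∀ K ∈ T, StarConvex ℝ (centroid K) K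

/-- The size `h` of the mesh: the largest diameter of its cells. -/
def meshSize {n : ℕ} (T : Finset (Set (Rn n))) : ℝ :=
  sSup (Metric.diam '' (T : Set (Set (Rn n))))

/-- `ρ_K`: the largest radius of balls centred at the centroid of `K` and included in `K`. -/
def inradius {n : ℕ} (K : Set (Rn n)) : ℝ :=
  sSup {r : ℝ | 0 < r ∧ Metric.ball (centroid K) r ⊆ K}

/-- The regularity of the mesh: `diam(K) / ρ_K ≤ η` for every cell. -/
def IsRegularMesh {n : ℕ} (T : Finset (Set (Rn n))) (η : ℝ) : Prop :=
  ∀ K ∈ T, Metric.diam K / inradius K ≤ η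

/-- The projection `P_T` on piecewise constant functions: the average of `v` on each cell. -/
def meshProj {n : ℕ} (T : Finset (Set (Rn n))) (v : Rn n → ℝ) : Rn n → ℝ :=
  fun x => ∑ K ∈ T, K.indicator (fun _ => ⨍ y in K, v y) x

/-- The space `U_h` of functions that are constant on each cell. -/
def Uh {n : ℕ} (Ω : Set (Rn n)) (T : Finset (Set (Rn n))) : Set (L2 Ω) :=
  {v | ∀ K ∈ T, ∃ r : ℝ, ∀ᵐ x ∂(volume.restrict K), v x = r}

/-- `T₁`: the cells on which it is false that `u = a` a.e., or `u = b` a.e., or `a < u < b` a.e.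
(neither fully active nor fully inactive). -/
def mixedCells {n : ℕ} (T : Finset (Set (Rn n))) (a b : EReal) (u : Rn n → ℝ) :
    Set (Set (Rn n)) :=
  {K | K ∈ T ∧ ¬ ((∀ᵐ x ∂(volume.restrict K), ((u x : ℝ) : EReal) = a) ∨
    (∀ᵐ x ∂(volume.restrict K), ((u x : ℝ) : EReal) = b) ∨
    (∀ᵐ x ∂(volume.restrict K), a < ((u x : ℝ) : EReal) ∧ ((u x : ℝ) : EReal) < b))}

/-- `Ω_{1,T}`: the interior of the union of the closures of the cells in `T₁`. -/
def mixedRegion {n : ℕ} (T : Finset (Set (Rn n))) (a b : EReal) (u : Rn n → ℝ) : Set (Rn n) :=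
  interior (⋃ K ∈ mixedCells T a b u, closure K)

/-! The discrete problem, the post-processed controls and the assumptions -/

section Discrete

variable {n : ℕ} {Ω : Set (Rn n)} {X : Type*} [AddCommGroup X] [Module ℝ X]

/-- The gradient scheme for the optimality system, with piecewise constant controls. -/
structure IsDiscreteOptimal (D : GradientDiscretisation Ω X)
    (A : Rn n → Matrix (Fin n) (Fin n) ℝ) (T : Finset (Set (Rn n)))
    (α : ℝ) (a b : EReal) (f yd ud : L2 Ω) (yD pD : X) (uh : L2 Ω) : Prop where
  control_mem : uh ∈ Uad Ω a b ∩ Uh Ω T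
  state_eq : ∀ w : X, D.bilin A yD w = inner ℝ (f + uh) (D.recon w)
  adjoint_eq : ∀ w : X, D.bilin A w pD = inner ℝ (D.recon yD - yd) (D.recon w)
  control_ineq : ∀ v ∈ Uad Ω a b ∩ Uh Ω T,
    0 ≤ inner ℝ (D.recon pD + α • (uh - ud)) (v - uh)

/-- Approximation and interpolation errors, for an operator `R : w ↦ w_T` (of which only the
values on `H²(Ω)` matter), with the constant `c`. -/
structure InterpolationAssumption (D : GradientDiscretisation Ω X)
    (A : Rn n → Matrix (Fin n) (Fin n) ℝ) (T : Finset (Set (Rn n)))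
    (R : L2 Ω → L2 Ω) (c : ℝ) : Prop where
  superconv : ∀ w g : L2 Ω, MemH2 Ω w → MemH1 Ω g → IsWeakSolution Ω A g w →
    ∀ wD : X, D.IsSchemeSolution A g wD →
      ‖D.recon wD - R w‖ ≤ c * meshSize T ^ 2 * h1Norm Ω g
  inner_recon : ∀ w : L2 Ω, MemH2 Ω w → ∀ v : X,
    |(inner ℝ (w - R w) (D.recon v) : ℝ)| ≤
      c * meshSize T ^ 2 * h2Norm Ω w * ‖D.recon v‖
  proj : ∀ w : L2 Ω, MemH2 Ω w →
    eLpNorm (meshProj T (w - R w : L2 Ω)) 2 (volume.restrict Ω) ≤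
      ENNReal.ofReal (c * meshSize T ^ 2 * h2Norm Ω w)

/-- `‖Π_D v - P_T(Π_D v)‖ ≤ c h ‖∇_D v‖`. -/
def ReconstructionAssumption (D : GradientDiscretisation Ω X)
    (T : Finset (Set (Rn n))) (c : ℝ) : Prop :=
  ∀ v : X, eLpNorm (fun x => D.recon v x - meshProj T (D.recon v) x) 2 (volume.restrict Ω) ≤
    ENNReal.ofReal (c * meshSize T * ‖D.grad v‖)

/-- `s` is a Sobolev exponent `2*` of `2` in dimension `n`. -/
def IsSobolevExponent (n : ℕ) (s : ℝ) : Prop :=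
  (n = 2 ∧ 2 ≤ s) ∨ (3 ≤ n ∧ s = 2 * n / (n - 2))

/-- The discrete Sobolev embedding `‖Π_D v‖_{L^s} ≤ c ‖∇_D v‖`. -/
def SobolevAssumption (D : GradientDiscretisation Ω X) (s c : ℝ) : Prop :=
  ∀ v : X, eLpNorm (D.recon v) (ENNReal.ofReal s) (volume.restrict Ω) ≤
    ENNReal.ofReal (c * ‖D.grad v‖)

end Discrete

/-- `|Ω_{1,T}| ≤ c h`, and `u` is in the broken space `W^{1,∞}(T₁)`. -/
structure ActiveSetAssumption {n : ℕ} (T : Finset (Set (Rn n))) (a b : EReal)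
    (u : Rn n → ℝ) (c : ℝ) : Prop where
  measure_le : volume (mixedRegion T a b u) ≤ ENNReal.ofReal (c * meshSize T)
  regular : MemBrokenW1inf (mixedCells T a b u) u

/-- `P_{[a,b]}(s) = min(b, max(a, s))`; this is finite as soon as `a ≠ +∞` and `b ≠ -∞`. -/
def proj (a b : EReal) (s : ℝ) : ℝ := (min b (max a (s : EReal))).toReal

/-- The post-processed control `P_{[a,b]}(P_T u_d - α⁻¹ q)`; it is used with `q = p_T` and
`q = Π_D p_D`. -/
def postProcess {n : ℕ} (T : Finset (Set (Rn n))) (α : ℝ) (a b : EReal)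
    (ud q : Rn n → ℝ) : Rn n → ℝ :=
  fun x => proj a b (meshProj T ud x - α⁻¹ * q x)

open Classical in
/-- `minmod(a, b) = 0` if `a b ≤ 0`, and `min(|a|, |b|)` otherwise; this is finite if `a ≤ b`,
`a ≠ +∞` and `b ≠ -∞`. -/
def minmod (a b : EReal) : ℝ := if a * b ≤ 0 then 0 else (min a.abs b.abs).toReal

/-- The data term
`minmod(a,b) + ‖y_d‖_{H¹} + ‖u_d‖_{H²} + ‖f‖_{H¹} + ‖y‖_{H²} + ‖p‖_{H²}`. -/
def dataTerm {n : ℕ} (Ω : Set (Rn n)) (a b : EReal) (yd ud f y p : L2 Ω) : ℝ :=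
  minmod a b + h1Norm Ω yd + h2Norm Ω ud + h1Norm Ω f + h2Norm Ω y + h2Norm Ω p

end GDM

end

/-!
Super-convergence of the post-processed control.

Write `w = u_d - α⁻¹ p`. The variational inequality says that `u = P_{[a,b]} w`
(`GDM.IsOptimal.control_eq`). The post-processing is `α⁻¹`-Lipschitz, so everything reduces to an
estimate of `‖p_T - Π_D p_D‖`. The discrete states are compared with the solutions `ŷ`, `p̂` of the
gradient schemes driven by the piecewise constant control `û = P_{[a,b]}(P_T w)`, the projection of
the *cell averages* of `w` (`GDM.cellControl`).

* Being defined cell by cell, `û` satisfies `(p + α (û - u_d), v_h - û) ≥ 0` for every admissible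
  piecewise constant `v_h`, without any error (`GDM.inner_cellControl_sub_nonneg`). Adding the
  inequality for `u_h`, and using that the contribution of `p̂ - p_D` is non-positive, one gets
  `α ‖û - u_h‖ ≤ ‖Π_D p̂ - p_T‖ + ‖P_T (p - p_T)‖` (`GDM.norm_interpolation_sub_recon_le`).
  Since no values at centroids are involved, no embedding of `H²` in the continuous functions is
  needed.
* What remains is that `u - û` is of order `h^{2-1/2*}` when tested against a reconstructed
  function `Π_D v` (`GDM.abs_inner_sub_cellControl_le`). On the cells that are fully active or fully
  inactive, `û` is the average of `u`, so that `Π_D v` may be replaced by `Π_D v - P_T Π_D v`: each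
  of the factors is of order `h`, the first one by Poincaré's inequality. On the mixed cells,
  `û` lies between the extreme values of `u`, whence an additional error of order `h` on a set of
  measure of order `h`, which Hölder's inequality and the discrete Sobolev embedding turn into
  `h^{2-1/2*}`.

The theory of Sobolev functions that this requires is the following, for weak derivatives on an open
set: Poincaré's inequality on a cell that is only star-shaped with respect to a point
(`GDM.lintegral_sub_average_sq_le_grad`), the bound of the oscillation by the sup norm of the gradient
(`GDM.ae_dist_le_of_weakGrad_bounded`), and the stability of `H¹` under Lipschitz truncation
(`GDM.exists_hasWeakGrad_comp`), which gives `u ∈ H¹`. All three follow from the mollification of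
the function by Fatou's lemma: mollification converges almost everywhere, and does not increase
the norms of the gradient. Truncation is then treated through difference quotients, with the Riesz
representation theorem providing the weak derivatives.
-/

open Filter Topology

noncomputable section

namespace GDM

/-! ### Weak gradients -/

section WeakGradient

variable {n : ℕ} {U : Set (Rn n)} {u v : Rn n → ℝ} {G H : Rn n → Rn n}

lemma IsTestFunction.continuous {φ : Rn n → ℝ} (h : IsTestFunction U φ) : Continuous φ :=
  h.smooth.continuous

lemma IsTestFunction.continuous_fderiv {φ : Rn n → ℝ} (h : IsTestFunction U φ) (e : Rn n) :
    Continuous fun x => fderiv ℝ φ x e :=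
  (h.smooth.continuous_fderiv (by simp)).clm_apply continuous_const

lemma IsTestFunction.tsupport_fderiv_subset {φ : Rn n → ℝ} (h : IsTestFunction U φ) (e : Rn n) :
    tsupport (fun x => fderiv ℝ φ x e) ⊆ U :=
  (tsupport_fderiv_apply_subset ℝ e).trans h.support_subset

lemma IsTestFunction.hasCompactSupport_fderiv {φ : Rn n → ℝ} (h : IsTestFunction U φ) (e : Rn n) :
    HasCompactSupport (fun x => fderiv ℝ φ x e) :=
  h.compact.fderiv_apply ℝ e

/-- A locally integrable function times a continuous function with compact support in `U` is
integrable on `U`. -/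
lemma integrableOn_mul_of_hasCompactSupport {f g : Rn n → ℝ} (hf : LocallyIntegrableOn f U volume)
    (hg : Continuous g) (hgc : HasCompactSupport g) (hgU : tsupport g ⊆ U) :
    IntegrableOn (fun x => f x * g x) U := by
  have h1 : IntegrableOn f (tsupport g) := hf.integrableOn_compact_subset hgU hgc
  have h2 : IntegrableOn (fun x => f x * g x) (tsupport g) :=
    h1.mul_continuousOn hg.continuousOn hgc
  have h3 : Integrable (fun x => f x * g x) := by
    refine (integrableOn_iff_integrable_of_support_subset ?_).1 h2
    intro x hx
    apply subset_tsupport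
    simp only [Function.mem_support] at hx ⊢
    exact fun h => hx (by simp [h])
  exact h3.integrableOn

lemma locallyIntegrableOn_inner_const (hG : LocallyIntegrableOn G U volume) (e : Rn n) :
    LocallyIntegrableOn (fun x => inner ℝ (G x) e) U volume := by
  intro x hx
  obtain ⟨s, hs, h⟩ := hG x hx
  exact ⟨s, hs, h.inner_const e⟩

lemma HasWeakGrad.integrableOn_left (h : HasWeakGrad U u G)
    {φ : Rn n → ℝ} (hφ : IsTestFunction U φ) (e : Rn n) :
    IntegrableOn (fun x => u x * fderiv ℝ φ x e) U :=
  integrableOn_mul_of_hasCompactSupport h.locInt (hφ.continuous_fderiv e)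
    (hφ.hasCompactSupport_fderiv e) (hφ.tsupport_fderiv_subset e)

lemma HasWeakGrad.integrableOn_right (h : HasWeakGrad U u G)
    {φ : Rn n → ℝ} (hφ : IsTestFunction U φ) (e : Rn n) :
    IntegrableOn (fun x => inner ℝ (G x) e * φ x) U :=
  integrableOn_mul_of_hasCompactSupport (locallyIntegrableOn_inner_const h.locInt_grad e) hφ.continuous
    hφ.compact hφ.support_subset

lemma HasWeakGrad.add (hu : HasWeakGrad U u G) (hv : HasWeakGrad U v H) :
    HasWeakGrad U (fun x => u x + v x) (fun x => G x + H x) where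
  locInt := hu.locInt.add hv.locInt
  locInt_grad := hu.locInt_grad.add hv.locInt_grad
  integral_eq φ hφ e := by
    simp only [add_mul, inner_add_left]
    rw [integral_add (hu.integrableOn_left hφ e) (hv.integrableOn_left hφ e),
      integral_add (hu.integrableOn_right hφ e) (hv.integrableOn_right hφ e),
      hu.integral_eq φ hφ e, hv.integral_eq φ hφ e]
    ring

lemma HasWeakGrad.const_smul (r : ℝ) (hu : HasWeakGrad U u G) :
    HasWeakGrad U (fun x => r * u x) (fun x => r • G x) where
  locInt := fun x hx => by
    obtain ⟨s, hs, h⟩ := hu.locInt x hx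
    exact ⟨s, hs, h.const_mul r⟩
  locInt_grad := fun x hx => by
    obtain ⟨s, hs, h⟩ := hu.locInt_grad x hx
    exact ⟨s, hs, h.smul r⟩
  integral_eq φ hφ e := by
    simp only [mul_assoc, inner_smul_left, integral_const_mul, hu.integral_eq φ hφ e]
    simp

lemma HasWeakGrad.congr (hu : HasWeakGrad U u G)
    (huv : u =ᵐ[volume.restrict U] v) : HasWeakGrad U v G where
  locInt := fun x hx => by
    obtain ⟨s, hs, h⟩ := hu.locInt x hx
    refine ⟨s ∩ U, Filter.inter_mem hs self_mem_nhdsWithin, ?_⟩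
    exact (h.mono_set inter_subset_left).congr
      (ae_mono (Measure.restrict_mono inter_subset_right le_rfl) huv)
  locInt_grad := hu.locInt_grad
  integral_eq φ hφ e := by
    rw [← hu.integral_eq φ hφ e]
    exact integral_congr_ae (huv.mono fun x hx => by simp only [hx])

lemma HasWeakGrad.mono {V : Set (Rn n)} (hU : MeasurableSet U)
    (hVU : V ⊆ U) (hu : HasWeakGrad U u G) :
    HasWeakGrad V u G where
  locInt := hu.locInt.mono_set hVU
  locInt_grad := hu.locInt_grad.mono_set hVU
  integral_eq φ hφ e := by
    have key : ∀ f : Rn n → ℝ, tsupport f ⊆ V → ∀ g : Rn n → ℝ,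
        ∫ x in V, g x * f x = ∫ x in U, g x * f x := by
      intro f hf g
      refine (setIntegral_eq_of_subset_of_forall_sdiff_eq_zero hU hVU fun x hx => ?_).symm
      rw [image_eq_zero_of_notMem_tsupport fun h => hx.2 (hf h), mul_zero]
    rw [key _ (hφ.tsupport_fderiv_subset e), key _ hφ.support_subset]
    exact hu.integral_eq φ ⟨hφ.smooth, hφ.compact, hφ.support_subset.trans hVU⟩ e

/-- Weak gradients are unique almost everywhere. -/
lemma HasWeakGrad.ae_eq (hU : IsOpen U) (hG : HasWeakGrad U u G) (hH : HasWeakGrad U u H) :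
    G =ᵐ[volume.restrict U] H := by
  have key : ∀ᵐ x ∂(volume : Measure (Rn n)), x ∈ U → ∀ i : Fin n, G x i - H x i = 0 := by
    have : ∀ i : Fin n, ∀ᵐ x ∂(volume : Measure (Rn n)), x ∈ U → G x i - H x i = 0 := by
      intro i
      set e : Rn n := EuclideanSpace.single i 1
      have he : ∀ z : Rn n, inner ℝ z e = z i := fun z => by
        simp [e, EuclideanSpace.inner_single_right]
      refine hU.ae_eq_zero_of_integral_contDiff_smul_eq_zero ?_ ?_
      · have := (locallyIntegrableOn_inner_const hG.locInt_grad e).sub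
          (locallyIntegrableOn_inner_const hH.locInt_grad e)
        simp only [he] at this
        exact this
      · intro φ h1 h2 h3
        have hφ : IsTestFunction U φ := ⟨h1, h2, h3⟩
        have h4 : ∫ x in U, (inner ℝ (G x) e * φ x - inner ℝ (H x) e * φ x) = 0 := by
          rw [integral_sub (hG.integrableOn_right hφ e)
            (hH.integrableOn_right hφ e)]
          have := hG.integral_eq φ hφ e
          have := hH.integral_eq φ hφ e
          linarith
        rw [← h4, ← setIntegral_eq_integral_of_forall_compl_eq_zero (s := U)]
        · refine integral_congr_ae (.of_forall fun x => ?_)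
          simp only [he, smul_eq_mul]; ring
        · intro x hx
          rw [image_eq_zero_of_notMem_tsupport fun h => hx (h3 h), zero_smul]
    filter_upwards [ae_all_iff.2 this] with x hx hxU i using hx i hxU
  rw [Filter.EventuallyEq, ae_restrict_iff' hU.measurableSet]
  filter_upwards [key] with x hx hxU
  ext i
  linarith [hx hxU i]

lemma weakGrad_spec (h : ∃ G, HasWeakGrad U u G) : HasWeakGrad U u (weakGrad U u) := by
  rw [weakGrad, dif_pos h]
  exact h.choose_spec

lemma HasWeakGrad.weakGrad_ae_eq (hU : IsOpen U) (h : HasWeakGrad U u G) :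
    weakGrad U u =ᵐ[volume.restrict U] G :=
  (weakGrad_spec ⟨G, h⟩).ae_eq hU h

lemma MemH1.hasWeakGrad (h : MemH1 U u) : HasWeakGrad U u (weakGrad U u) :=
  weakGrad_spec (h.2.imp fun _ hG => hG.1)

lemma MemH1.memLp_weakGrad (hU : IsOpen U) (h : MemH1 U u) :
    MemLp (weakGrad U u) 2 (volume.restrict U) := by
  obtain ⟨-, G, hG, hG2⟩ := h
  exact (memLp_congr_ae (hG.weakGrad_ae_eq hU)).2 hG2

lemma MemH1.add (hU : IsOpen U) (hu : MemH1 U u) (hv : MemH1 U v) :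
    MemH1 U (fun x => u x + v x) :=
  ⟨hu.1.add hv.1, _, hu.hasWeakGrad.add hv.hasWeakGrad,
    (hu.memLp_weakGrad hU).add (hv.memLp_weakGrad hU)⟩

lemma MemH1.const_mul (hU : IsOpen U) (r : ℝ) (hu : MemH1 U u) : MemH1 U (fun x => r * u x) :=
  ⟨hu.1.const_mul r, _, hu.hasWeakGrad.const_smul r, (hu.memLp_weakGrad hU).const_smul r⟩

lemma MemH1.congr (hU : IsOpen U) (hu : MemH1 U u) (huv : u =ᵐ[volume.restrict U] v) :
    MemH1 U v :=
  ⟨(memLp_congr_ae huv).1 hu.1, _, hu.hasWeakGrad.congr huv,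
    hu.memLp_weakGrad hU⟩

/-- The `L²(U)` norm of a function, as a real number. -/
def l2Norm {E : Type*} [NormedAddCommGroup E] (U : Set (Rn n)) (f : Rn n → E) : ℝ :=
  (eLpNorm f 2 (volume.restrict U)).toReal

lemma l2Norm_nonneg {E : Type*} [NormedAddCommGroup E] (f : Rn n → E) : 0 ≤ l2Norm U f :=
  ENNReal.toReal_nonneg

lemma l2Norm_congr {E : Type*} [NormedAddCommGroup E] {f g : Rn n → E}
    (h : f =ᵐ[volume.restrict U] g) : l2Norm U f = l2Norm U g := by
  rw [l2Norm, l2Norm, eLpNorm_congr_ae h]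

lemma l2Norm_add_le {E : Type*} [NormedAddCommGroup E] {f g : Rn n → E}
    (hf : MemLp f 2 (volume.restrict U)) (hg : MemLp g 2 (volume.restrict U)) :
    l2Norm U (fun x => f x + g x) ≤ l2Norm U f + l2Norm U g := by
  rw [l2Norm, l2Norm, l2Norm, ← ENNReal.toReal_add hf.2.ne hg.2.ne]
  exact ENNReal.toReal_mono (ENNReal.add_ne_top.2 ⟨hf.2.ne, hg.2.ne⟩)
    (eLpNorm_add_le hf.1 hg.1 (by norm_num))

lemma l2Norm_const_smul {E : Type*} [NormedAddCommGroup E] [NormedSpace ℝ E] (f : Rn n → E)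
    (r : ℝ) : l2Norm U (fun x => r • f x) = |r| * l2Norm U f := by
  have := eLpNorm_const_smul (p := 2) (μ := volume.restrict U) r f
  rw [l2Norm, l2Norm, show (fun x => r • f x) = r • f from rfl, this, ENNReal.toReal_mul]
  simp

lemma l2Norm_coe (f : L2 U) : l2Norm U f = ‖f‖ := (Lp.norm_def f).symm

lemma h1Norm_nonneg : 0 ≤ h1Norm U u := Real.sqrt_nonneg _

lemma h2Norm_nonneg : 0 ≤ h2Norm U u := Real.sqrt_nonneg _

lemma l2Norm_le_h1Norm : l2Norm U u ≤ h1Norm U u :=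
  Real.le_sqrt_of_sq_le (le_add_of_nonneg_right (sq_nonneg _))

lemma l2Norm_weakGrad_le_h1Norm : l2Norm U (weakGrad U u) ≤ h1Norm U u :=
  Real.le_sqrt_of_sq_le (le_add_of_nonneg_left (sq_nonneg _))

lemma h1Norm_le_add : h1Norm U u ≤ l2Norm U u + l2Norm U (weakGrad U u) := by
  have h1 := l2Norm_nonneg (U := U) u
  have h2 := l2Norm_nonneg (U := U) (weakGrad U u)
  refine Real.sqrt_le_iff.2 ⟨by positivity, ?_⟩
  simp only [l2Norm] at *
  nlinarith [mul_nonneg h1 h2]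

/-- The triangle inequality in `H¹`, up to a factor `2`. -/
lemma h1Norm_add_le (hU : IsOpen U) (hu : MemH1 U u) (hv : MemH1 U v) :
    h1Norm U (fun x => u x + v x) ≤ 2 * h1Norm U u + 2 * h1Norm U v := by
  have h1 := l2Norm_add_le hu.1 hv.1
  have h2 := l2Norm_add_le (hu.memLp_weakGrad hU) (hv.memLp_weakGrad hU)
  rw [← l2Norm_congr ((hu.hasWeakGrad.add hv.hasWeakGrad).weakGrad_ae_eq hU)]
    at h2
  have h3 := h1Norm_le_add (U := U) (u := fun x => u x + v x)
  have h4 := l2Norm_le_h1Norm (U := U) (u := u)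
  have h5 := l2Norm_le_h1Norm (U := U) (u := v)
  have h6 := l2Norm_weakGrad_le_h1Norm (U := U) (u := u)
  have h7 := l2Norm_weakGrad_le_h1Norm (U := U) (u := v)
  linarith

lemma h1Norm_const_mul (hU : IsOpen U) (r : ℝ) (hu : MemH1 U u) :
    h1Norm U (fun x => r * u x) = |r| * h1Norm U u := by
  have h1 := l2Norm_const_smul (U := U) u r
  have h2 := l2Norm_const_smul (U := U) (weakGrad U u) r
  rw [← l2Norm_congr ((hu.hasWeakGrad.const_smul r).weakGrad_ae_eq hU)] at h2
  simp only [l2Norm, smul_eq_mul] at h1 h2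
  rw [h1Norm, h1Norm, h1, h2, ← Real.sqrt_sq_eq_abs, ← Real.sqrt_mul (sq_nonneg r),
    Real.sqrt_sq_eq_abs]
  congr 1
  rw [mul_pow, mul_pow, sq_abs]; ring

lemma eq_sum_single (z : Rn n) :
    z = ∑ i, z i • (EuclideanSpace.single i (1 : ℝ) : Rn n) := by
  ext j
  simp [Finset.sum_apply, Pi.single_apply]

lemma memLp_smul_single {f : Rn n → ℝ} (hf : MemLp f 2 (volume.restrict U)) (i : Fin n) :
    MemLp (fun x => f x • (EuclideanSpace.single i (1 : ℝ) : Rn n)) 2 (volume.restrict U) := by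
  refine hf.of_le (hf.1.smul_const _) (.of_forall fun x => ?_)
  simp [norm_smul]

lemma memLp_of_components (h : ∀ i, MemLp (fun x => G x i) 2 (volume.restrict U)) :
    MemLp G 2 (volume.restrict U) := by
  have h1 : MemLp (fun x => ∑ i, (G x i) • (EuclideanSpace.single i (1 : ℝ) : Rn n)) 2
      (volume.restrict U) :=
    memLp_finsetSum _ fun i _ => memLp_smul_single (h i) i
  convert h1 using 2 with x
  exact eq_sum_single _

lemma l2Norm_le_sum_components (h : ∀ i, MemLp (fun x => G x i) 2 (volume.restrict U)) :
    l2Norm U G ≤ ∑ i, l2Norm U (fun x => G x i) := by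
  have hG : G = fun x => ∑ i, (G x i) • (EuclideanSpace.single i (1 : ℝ) : Rn n) := by
    funext x
    exact eq_sum_single _
  have h1 : eLpNorm G 2 (volume.restrict U) ≤
      ∑ i, eLpNorm (fun x => G x i) 2 (volume.restrict U) := by
    conv_lhs => rw [hG]
    have := eLpNorm_sum_le (μ := volume.restrict U) (p := 2) (s := Finset.univ)
      (f := fun i x => (G x i) • (EuclideanSpace.single i (1 : ℝ) : Rn n))
      (fun i _ => (memLp_smul_single (h i) i).1) (by norm_num)
    refine le_trans (le_of_eq ?_) (this.trans (le_of_eq ?_))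
    · congr 1; funext x; simp [Finset.sum_apply]
    · refine Finset.sum_congr rfl fun i _ => ?_
      refine eLpNorm_congr_norm_ae (.of_forall fun x => ?_)
      simp [norm_smul]
  rw [l2Norm]
  refine (ENNReal.toReal_mono ?_ h1).trans (le_of_eq ?_)
  · exact (ENNReal.sum_lt_top.2 fun i _ => (h i).2).ne
  · exact ENNReal.toReal_sum fun i _ => (h i).2.ne

lemma MemH2.components (hU : IsOpen U) (h : MemH2 U u) (i : Fin n) :
    MemH1 U (fun x => weakGrad U u x i) := by
  obtain ⟨-, G, hG, hGi⟩ := h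
  refine (hGi i).congr hU ?_
  filter_upwards [hG.weakGrad_ae_eq hU] with x hx
  rw [hx]

lemma MemH2.memH1 (hU : IsOpen U) (h : MemH2 U u) : MemH1 U u :=
  ⟨h.1, _, weakGrad_spec (h.2.imp fun _ hG => hG.1),
    memLp_of_components fun i => (h.components hU i).1⟩

lemma MemH2.l2Norm_weakGrad_le (hU : IsOpen U) (h : MemH2 U u) :
    l2Norm U (weakGrad U u) ≤ n * h2Norm U u := by
  refine (l2Norm_le_sum_components fun i => (h.components hU i).1).trans ?_
  have : ∀ i ∈ (Finset.univ : Finset (Fin n)),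
      l2Norm U (fun x => weakGrad U u x i) ≤ h2Norm U u := by
    intro i _
    refine l2Norm_le_h1Norm.trans (Real.le_sqrt_of_sq_le ?_)
    have := Finset.single_le_sum (f := fun i => h1Norm U (fun x => weakGrad U u x i) ^ 2)
      (fun i _ => sq_nonneg _) (Finset.mem_univ i)
    simp only at this
    nlinarith [sq_nonneg (eLpNorm u 2 (volume.restrict U)).toReal]
  simpa using Finset.sum_le_card_nsmul _ _ _ this

lemma l2Norm_le_h2Norm : l2Norm U u ≤ h2Norm U u := by
  refine Real.le_sqrt_of_sq_le (le_add_of_nonneg_right ?_)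
  exact Finset.sum_nonneg fun i _ => sq_nonneg _

lemma MemH2.h1Norm_le (hU : IsOpen U) (h : MemH2 U u) : h1Norm U u ≤ (n + 1) * h2Norm U u := by
  have := h1Norm_le_add (U := U) (u := u)
  have := h.l2Norm_weakGrad_le hU
  have := l2Norm_le_h2Norm (U := U) (u := u)
  linarith

end WeakGradient

end GDM

/-! ### Jensen's inequality for `∫⁻` -/

lemma lintegral_mul_sq_le {β : Type*} [MeasurableSpace β] (μ : Measure β) {w f : β → ℝ≥0∞}
    (hw : AEMeasurable w μ) (hf : AEMeasurable f μ) :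
    (∫⁻ x, w x * f x ∂μ) ^ 2 ≤ (∫⁻ x, w x ∂μ) * ∫⁻ x, w x * f x ^ 2 ∂μ := by
  have h := ENNReal.lintegral_mul_le_Lp_mul_Lq μ (p := 2) (q := 2)
    (by constructor <;> norm_num)
    (hw.pow_const (1 / 2 : ℝ)) ((hw.pow_const (1 / 2 : ℝ)).mul hf)
  have e1 : ∀ x, ((fun x => w x ^ (1 / 2 : ℝ)) * ((fun x => w x ^ (1 / 2 : ℝ)) * f)) x =
      w x * f x := by
    intro x
    simp only [Pi.mul_apply]
    rw [← mul_assoc, ← ENNReal.rpow_add_of_nonneg _ _ (by norm_num) (by norm_num)]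
    norm_num
  have e2 : ∀ x, (w x ^ (1 / 2 : ℝ)) ^ (2 : ℝ) = w x := fun x => by
    rw [← ENNReal.rpow_mul]; norm_num
  have e3 : ∀ x, ((fun x => w x ^ (1 / 2 : ℝ)) * f) x ^ (2 : ℝ) = w x * f x ^ 2 := fun x => by
    simp only [Pi.mul_apply]
    rw [ENNReal.mul_rpow_of_nonneg _ _ (by norm_num), e2]
    norm_num
  simp only [e1, e2, e3] at h
  calc (∫⁻ x, w x * f x ∂μ) ^ 2
      ≤ ((∫⁻ x, w x ∂μ) ^ (1 / 2 : ℝ) * (∫⁻ x, w x * f x ^ 2 ∂μ) ^ (1 / 2 : ℝ)) ^ 2 := by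
        gcongr
    _ = _ := by
        rw [mul_pow, ← ENNReal.rpow_natCast, ← ENNReal.rpow_natCast, ← ENNReal.rpow_mul,
          ← ENNReal.rpow_mul]
        norm_num

lemma lintegral_sq_le {β : Type*} [MeasurableSpace β] (μ : Measure β) {f : β → ℝ≥0∞}
    (hf : AEMeasurable f μ) :
    (∫⁻ x, f x ∂μ) ^ 2 ≤ μ univ * ∫⁻ x, f x ^ 2 ∂μ := by
  simpa using lintegral_mul_sq_le μ (w := fun _ => 1) aemeasurable_const hf

namespace GDM

/-! ### Mollification -/

section Mollify

variable {n : ℕ} {U : Set (Rn n)} {u : Rn n → ℝ} {G : Rn n → Rn n}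

/-- The radius of the `k`-th mollifier. -/
def mollifierRadius (k : ℕ) : ℝ := 1 / ((k : ℝ) + 1)

lemma mollifierRadius_pos (k : ℕ) : 0 < mollifierRadius k := Nat.one_div_pos_of_nat

lemma tendsto_mollifierRadius : Tendsto mollifierRadius atTop (𝓝 0) :=
  tendsto_one_div_add_atTop_nhds_zero_nat

/-- A smooth bump supported in the ball of radius `mollifierRadius k`. -/
def mollifierBump (n k : ℕ) : ContDiffBump (0 : Rn n) where
  rIn := mollifierRadius k / 2
  rOut := mollifierRadius k
  rIn_pos := half_pos (mollifierRadius_pos k)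
  rIn_lt_rOut := half_lt_self (mollifierRadius_pos k)

/-- The `k`-th mollifier: non-negative, smooth, of integral one, supported in the ball of radius
`mollifierRadius k`. -/
def mollifier (n k : ℕ) : Rn n → ℝ := (mollifierBump n k).normed volume

lemma mollifier_nonneg (k : ℕ) (x : Rn n) : 0 ≤ mollifier n k x :=
  (mollifierBump n k).nonneg_normed x

lemma contDiff_mollifier (k : ℕ) : ContDiff ℝ ∞ (mollifier n k) :=
  (mollifierBump n k).contDiff_normed

lemma hasCompactSupport_mollifier (k : ℕ) : HasCompactSupport (mollifier n k) :=
  (mollifierBump n k).hasCompactSupport_normed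

lemma tsupport_mollifier (k : ℕ) :
    tsupport (mollifier n k) = Metric.closedBall 0 (mollifierRadius k) :=
  (mollifierBump n k).tsupport_normed_eq

lemma lintegral_mollifier (k : ℕ) : ∫⁻ x, ENNReal.ofReal (mollifier n k x) = 1 := by
  unfold mollifier
  rw [← ofReal_integral_eq_lintegral_ofReal ((mollifierBump n k).integrable_normed)
    (.of_forall (mollifier_nonneg k))]
  simp [(mollifierBump n k).integral_normed]

lemma lintegral_mollifier_sub_left (k : ℕ) (x : Rn n) :
    ∫⁻ y, ENNReal.ofReal (mollifier n k (x - y)) = 1 := by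
  rw [← lintegral_mollifier (n := n) k]
  exact lintegral_sub_left_eq_self (fun y => ENNReal.ofReal (mollifier n k y)) x

lemma lintegral_mollifier_sub_right (k : ℕ) (y : Rn n) :
    ∫⁻ x, ENNReal.ofReal (mollifier n k (x - y)) = 1 := by
  rw [← lintegral_mollifier (n := n) k]
  exact lintegral_sub_right_eq_self (fun y => ENNReal.ofReal (mollifier n k y)) y

/-- The mollification of `u`, extended by zero outside of `U`. -/
def mollify (k : ℕ) (U : Set (Rn n)) (u : Rn n → ℝ) : Rn n → ℝ :=
  convolution (mollifier n k) (U.indicator u) (ContinuousLinearMap.lsmul ℝ ℝ) volume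

lemma mollify_tendsto_ae (hU : MeasurableSet U) (hu : IntegrableOn u U) :
    ∀ᵐ x ∂(volume.restrict U), Tendsto (fun k => mollify k U u x) atTop (𝓝 (u x)) := by
  rw [ae_restrict_iff' hU]
  have h := ContDiffBump.ae_convolution_tendsto_right_of_locallyIntegrable (K := 2)
    (φ := fun k => mollifierBump n k) (l := atTop) (μ := volume) (g := U.indicator u)
    tendsto_mollifierRadius
    (.of_forall fun k => by simp only [mollifierBump]; linarith [mollifierRadius_pos k])
    ((integrable_indicator_iff hU).2 hu).locallyIntegrable
  filter_upwards [h] with x hx hxU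
  rw [indicator_of_mem hxU] at hx
  exact hx

lemma contDiff_mollify (k : ℕ) (hU : MeasurableSet U) (hu : IntegrableOn u U) :
    ContDiff ℝ 1 (mollify k U u) :=
  (hasCompactSupport_mollifier k).contDiff_convolution_left (n := 1) _
    ((contDiff_mollifier k).of_le (mod_cast le_top))
    ((integrable_indicator_iff hU).2 hu).locallyIntegrable

lemma isTestFunction_mollifier_sub (k : ℕ) {x : Rn n}
    (hx : Metric.closedBall x (mollifierRadius k) ⊆ U) :
    IsTestFunction U (fun y => mollifier n k (x - y)) where
  smooth := (contDiff_mollifier k).comp (contDiff_const.sub contDiff_id)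
  compact := (hasCompactSupport_mollifier k).comp_homeomorph (Homeomorph.subLeft x)
  support_subset := by
    have h1 : tsupport (mollifier n k ∘ (Homeomorph.subLeft x)) =
        (Homeomorph.subLeft x) ⁻¹' tsupport (mollifier n k) :=
      tsupport_comp_eq_preimage _ (Homeomorph.subLeft x)
    change tsupport (mollifier n k ∘ (Homeomorph.subLeft x)) ⊆ U
    rw [h1, tsupport_mollifier]
    refine Subset.trans (fun y hy => ?_) hx
    simpa [dist_eq_norm, norm_sub_rev] using hy

/-- Well inside `U`, the derivative of the mollification is the mollification of the weak
gradient. -/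
lemma fderiv_mollify (hU : MeasurableSet U) (hu : IntegrableOn u U)
    (hG : HasWeakGrad U u G) {k : ℕ} {x : Rn n}
    (hx : Metric.closedBall x (mollifierRadius k) ⊆ U) (e : Rn n) :
    fderiv ℝ (mollify k U u) x e = ∫ y in U, inner ℝ (G y) e * mollifier n k (x - y) := by
  have hli : LocallyIntegrable (U.indicator u) volume :=
    ((integrable_indicator_iff hU).2 hu).locallyIntegrable
  have h1 : ContDiff ℝ 1 (mollifier n k) := (contDiff_mollifier k).of_le (mod_cast le_top)
  have h := (hasCompactSupport_mollifier (n := n) k).hasFDerivAt_convolution_left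
    (ContinuousLinearMap.lsmul ℝ ℝ) h1 hli x
  rw [mollify, h.fderiv, convolution_eq_swap, ContinuousLinearMap.integral_apply]
  · have hT := isTestFunction_mollifier_sub k hx
    rw [← neg_neg (∫ y in U, _), ← hG.integral_eq _ hT e, ← integral_neg, ← integral_indicator hU]
    refine integral_congr_ae (.of_forall fun y => ?_)
    have h2 : HasFDerivAt (fun y => mollifier n k (x - y)) (-(fderiv ℝ (mollifier n k) (x - y))) y := by
      have := ((h1.differentiable one_ne_zero).differentiableAt (x := x - y)).hasFDerivAt.comp y
        ((hasFDerivAt_const x y).sub (hasFDerivAt_id y))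
      simpa using! this
    by_cases hy : y ∈ U
    · simp [hy, h2.fderiv, ContinuousLinearMap.precompL_apply, mul_comm]
    · simp [hy]
  · have h3 := (hasCompactSupport_mollifier (n := n) k).fderiv ℝ |>.convolutionExists_left
      ((ContinuousLinearMap.lsmul ℝ ℝ : ℝ →L[ℝ] ℝ →L[ℝ] ℝ).precompL (Rn n))
      (h1.continuous_fderiv one_ne_zero) hli
    exact (h3 x).integrable_swap

lemma enorm_fderiv_mollify_le (hU : MeasurableSet U) (hu : IntegrableOn u U)
    (hG : HasWeakGrad U u G) {k : ℕ} {x : Rn n}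
    (hx : Metric.closedBall x (mollifierRadius k) ⊆ U) :
    ‖fderiv ℝ (mollify k U u) x‖ₑ ≤
      ∫⁻ y in U, ENNReal.ofReal (mollifier n k (x - y)) * ‖G y‖ₑ := by
  set B := ∫⁻ y in U, ENNReal.ofReal (mollifier n k (x - y)) * ‖G y‖ₑ
  by_cases hB : B = ⊤
  · simp [hB]
  rw [← ENNReal.ofReal_toReal hB, ← ofReal_norm]
  refine ENNReal.ofReal_le_ofReal
    (ContinuousLinearMap.opNorm_le_bound _ ENNReal.toReal_nonneg fun e => ?_)
  rw [fderiv_mollify hU hu hG hx e]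
  have h1 : ‖∫ y in U, inner ℝ (G y) e * mollifier n k (x - y)‖ₑ ≤ B * ‖e‖ₑ := by
    refine (enorm_integral_le_lintegral_enorm _).trans ?_
    rw [← lintegral_mul_const' _ _ enorm_ne_top]
    refine lintegral_mono fun y => ?_
    rw [enorm_mul, Real.enorm_of_nonneg (mollifier_nonneg k _), mul_comm, mul_assoc]
    gcongr
    rw [← ofReal_norm, ← ofReal_norm, ← ofReal_norm, ← ENNReal.ofReal_mul (norm_nonneg _)]
    exact ENNReal.ofReal_le_ofReal (norm_inner_le_norm (G y) e)
  have h2 := ENNReal.toReal_mono (ENNReal.mul_ne_top hB enorm_ne_top) h1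
  simpa [ENNReal.toReal_mul] using h2

/-- Well inside `U`, mollification does not increase the sup norm of the gradient. -/
lemma norm_fderiv_mollify_le_of_bound (hU : MeasurableSet U) (hu : IntegrableOn u U)
    (hG : HasWeakGrad U u G) {L : ℝ} (hL0 : 0 ≤ L) (hL : ∀ᵐ y ∂(volume.restrict U), ‖G y‖ ≤ L)
    {k : ℕ} {x : Rn n} (hx : Metric.closedBall x (mollifierRadius k) ⊆ U) :
    ‖fderiv ℝ (mollify k U u) x‖ ≤ L := by
  have h := enorm_fderiv_mollify_le hU hu hG hx
  have h2 : ∫⁻ y in U, ENNReal.ofReal (mollifier n k (x - y)) * ‖G y‖ₑ ≤ ENNReal.ofReal L := by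
    calc _ ≤ ∫⁻ y in U, ENNReal.ofReal (mollifier n k (x - y)) * ENNReal.ofReal L := by
          refine lintegral_mono_ae (hL.mono fun y hy => ?_)
          gcongr
          rw [← ofReal_norm]
          exact ENNReal.ofReal_le_ofReal hy
      _ ≤ ∫⁻ y, ENNReal.ofReal (mollifier n k (x - y)) * ENNReal.ofReal L :=
          setLIntegral_le_lintegral _ _
      _ = ENNReal.ofReal L := by
          rw [lintegral_mul_const' _ _ ENNReal.ofReal_ne_top, lintegral_mollifier_sub_left, one_mul]
  rw [← ofReal_norm] at h
  exact (ENNReal.ofReal_le_ofReal_iff hL0).1 (h.trans h2)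

/-- Well inside `U`, mollification does not increase the `L²` norm of the gradient. -/
lemma lintegral_fderiv_mollify_sq_le (hU : MeasurableSet U) (hu : IntegrableOn u U)
    (hG : HasWeakGrad U u G) (hGm : AEStronglyMeasurable G (volume.restrict U)) {k : ℕ}
    {S : Set (Rn n)} (hSm : MeasurableSet S)
    (hS : ∀ x ∈ S, Metric.closedBall x (mollifierRadius k) ⊆ U) :
    ∫⁻ x in S, ‖fderiv ℝ (mollify k U u) x‖ₑ ^ 2 ≤ ∫⁻ y in U, ‖G y‖ₑ ^ 2 := by
  have hm : Measurable fun z : Rn n × Rn n => ENNReal.ofReal (mollifier n k (z.1 - z.2)) :=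
    ((contDiff_mollifier k).continuous.comp
      (continuous_fst.sub continuous_snd)).measurable.ennreal_ofReal
  calc ∫⁻ x in S, ‖fderiv ℝ (mollify k U u) x‖ₑ ^ 2
      ≤ ∫⁻ x in S, ∫⁻ y in U, ENNReal.ofReal (mollifier n k (x - y)) * ‖G y‖ₑ ^ 2 := by
        refine setLIntegral_mono_ae' hSm (.of_forall fun x hx => ?_)
        calc ‖fderiv ℝ (mollify k U u) x‖ₑ ^ 2
            ≤ (∫⁻ y in U, ENNReal.ofReal (mollifier n k (x - y)) * ‖G y‖ₑ) ^ 2 := by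
              gcongr
              exact enorm_fderiv_mollify_le hU hu hG (hS x hx)
          _ ≤ (∫⁻ y in U, ENNReal.ofReal (mollifier n k (x - y))) *
                ∫⁻ y in U, ENNReal.ofReal (mollifier n k (x - y)) * ‖G y‖ₑ ^ 2 :=
              lintegral_mul_sq_le _ (hm.comp measurable_prodMk_left).aemeasurable hGm.enorm
          _ ≤ 1 * ∫⁻ y in U, ENNReal.ofReal (mollifier n k (x - y)) * ‖G y‖ₑ ^ 2 := by
              gcongr
              exact (setLIntegral_le_lintegral _ _).trans (lintegral_mollifier_sub_left k x).le
          _ = _ := one_mul _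
    _ = ∫⁻ y in U, ∫⁻ x in S, ENNReal.ofReal (mollifier n k (x - y)) * ‖G y‖ₑ ^ 2 := by
        refine lintegral_lintegral_swap (AEMeasurable.mul hm.aemeasurable ?_)
        exact (hGm.enorm.pow_const 2).comp_quasiMeasurePreserving
          Measure.quasiMeasurePreserving_snd
    _ ≤ ∫⁻ y in U, ‖G y‖ₑ ^ 2 := by
        refine lintegral_mono fun y => ?_
        rw [lintegral_mul_const' _ _ (by simp)]
        calc _ ≤ 1 * ‖G y‖ₑ ^ 2 := by
              gcongr
              exact (setLIntegral_le_lintegral _ _).trans (lintegral_mollifier_sub_right k y).le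
          _ = _ := one_mul _

end Mollify

/-! ### Increments of continuously differentiable functions along segments -/

section Increments

variable {n : ℕ}

lemma enorm_sq_eq_ofReal (r : ℝ) : ‖r‖ₑ ^ 2 = ENNReal.ofReal (r ^ 2) := by
  rw [← ofReal_norm, ← ENNReal.ofReal_pow (norm_nonneg r), Real.norm_eq_abs, sq_abs]

lemma measurable_enorm_fderiv_sq {v : Rn n → ℝ} (hv : ContDiff ℝ 1 v) :
    Measurable fun x => ‖fderiv ℝ v x‖ₑ ^ 2 :=
  (hv.continuous_fderiv one_ne_zero).enorm.measurable.pow_const 2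

lemma enorm_sub_sq_le_lintegral_fderiv {v : Rn n → ℝ} (hv : ContDiff ℝ 1 v) (x y : Rn n) :
    ‖v y - v x‖ₑ ^ 2 ≤
      ‖y - x‖ₑ ^ 2 * ∫⁻ s in Ioc (0 : ℝ) 1, ‖fderiv ℝ v (x + s • (y - x))‖ₑ ^ 2 := by
  have hc : Continuous fun s : ℝ => x + s • (y - x) := by fun_prop
  have hd : ∀ s : ℝ, HasDerivAt (fun s : ℝ => v (x + s • (y - x)))
      (fderiv ℝ v (x + s • (y - x)) (y - x)) s := by
    intro s
    have h1 : HasDerivAt (fun s : ℝ => x + s • (y - x)) (y - x) s := by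
      simpa using ((hasDerivAt_id s).smul_const (y - x)).const_add x
    exact ((hv.differentiable one_ne_zero).differentiableAt.hasFDerivAt).comp_hasDerivAt s h1
  have hcd : Continuous fun s : ℝ => fderiv ℝ v (x + s • (y - x)) :=
    (hv.continuous_fderiv one_ne_zero).comp hc
  have h2 : v y - v x = ∫ s in Ioc (0 : ℝ) 1, fderiv ℝ v (x + s • (y - x)) (y - x) := by
    rw [← intervalIntegral.integral_of_le zero_le_one,
      intervalIntegral.integral_eq_sub_of_hasDerivAt (fun s _ => hd s)
        ((hcd.clm_apply continuous_const).intervalIntegrable _ _)]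
    simp
  have h3 : ‖v y - v x‖ₑ ≤
      (∫⁻ s in Ioc (0 : ℝ) 1, ‖fderiv ℝ v (x + s • (y - x))‖ₑ) * ‖y - x‖ₑ := by
    rw [h2, ← lintegral_mul_const' _ _ enorm_ne_top]
    refine (enorm_integral_le_lintegral_enorm _).trans (lintegral_mono fun s => ?_)
    exact ContinuousLinearMap.le_opENorm _ _
  calc ‖v y - v x‖ₑ ^ 2
      ≤ ((∫⁻ s in Ioc (0 : ℝ) 1, ‖fderiv ℝ v (x + s • (y - x))‖ₑ) * ‖y - x‖ₑ) ^ 2 := by gcongr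
    _ = ‖y - x‖ₑ ^ 2 * (∫⁻ s in Ioc (0 : ℝ) 1, ‖fderiv ℝ v (x + s • (y - x))‖ₑ) ^ 2 := by
        rw [mul_pow, mul_comm]
    _ ≤ _ := by
        gcongr
        refine (lintegral_sq_le _ hcd.enorm.measurable.aemeasurable).trans ?_
        simp

lemma lintegral_comp_affine_le {r r₀ : ℝ} (hr₀ : 0 < r₀) (hr : r₀ ≤ r) (b : Rn n)
    {S' S : Set (Rn n)} (hS' : MeasurableSet S') (hS : MeasurableSet S)
    (hmaps : ∀ x ∈ S', r • x + b ∈ S) {F : Rn n → ℝ≥0∞} (hF : Measurable F) :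
    ∫⁻ x in S', F (r • x + b) ≤ ENNReal.ofReal ((r₀ ^ n)⁻¹) * ∫⁻ x in S, F x := by
  have hr' : 0 < r := hr₀.trans_le hr
  have hFS : Measurable (S.indicator F) := hF.indicator hS
  calc ∫⁻ x in S', F (r • x + b) ≤ ∫⁻ x in S', S.indicator F (r • x + b) := by
        refine setLIntegral_mono_ae' hS' (.of_forall fun x hx => ?_)
        rw [indicator_of_mem (hmaps x hx)]
    _ ≤ ∫⁻ x, S.indicator F (r • x + b) := setLIntegral_le_lintegral _ _
    _ = ∫⁻ z, S.indicator F (z + b) ∂(Measure.map (fun x : Rn n => r • x) volume) :=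
        (lintegral_map (hFS.comp (measurable_add_const b)) (measurable_const_smul r)).symm
    _ = ENNReal.ofReal ((r ^ n)⁻¹) * ∫⁻ x in S, F x := by
        rw [Measure.map_addHaar_smul volume hr'.ne', lintegral_smul_measure,
          lintegral_add_right_eq_self, lintegral_indicator hS, finrank_euclideanSpace_fin,
          abs_of_pos (by positivity), smul_eq_mul]
    _ ≤ _ := by gcongr

/-- `L²` estimate of the increment of `v` between the points of `S'` and their images under an
affine contraction, along segments that stay in `S`. -/
lemma lintegral_affine_increment_le {v : Rn n → ℝ} (hv : ContDiff ℝ 1 v) {t d : ℝ}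
    (ht : 0 < t) (ht1 : t ≤ 1) (b : Rn n)
    {S' S : Set (Rn n)} (hS' : MeasurableSet S') (hS : MeasurableSet S)
    (hmaps : ∀ x ∈ S', ∀ s ∈ Icc (0 : ℝ) 1, x + s • (t • x + b - x) ∈ S)
    (hd : ∀ x ∈ S', ‖t • x + b - x‖ ≤ d) :
    ∫⁻ x in S', ‖v (t • x + b) - v x‖ₑ ^ 2 ≤
      ENNReal.ofReal (d ^ 2 * (t ^ n)⁻¹) * ∫⁻ x in S, ‖fderiv ℝ v x‖ₑ ^ 2 := by
  have hF := measurable_enorm_fderiv_sq hv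
  have hc : Continuous fun z : Rn n × ℝ => z.1 + z.2 • (t • z.1 + b - z.1) := by fun_prop
  calc ∫⁻ x in S', ‖v (t • x + b) - v x‖ₑ ^ 2
      ≤ ∫⁻ x in S', ENNReal.ofReal (d ^ 2) *
          ∫⁻ s in Ioc (0 : ℝ) 1, ‖fderiv ℝ v (x + s • (t • x + b - x))‖ₑ ^ 2 := by
        refine setLIntegral_mono_ae' hS' (.of_forall fun x hx => ?_)
        refine (enorm_sub_sq_le_lintegral_fderiv hv _ _).trans ?_
        gcongr
        rw [← ofReal_norm, ← ENNReal.ofReal_pow (norm_nonneg _)]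
        gcongr
        exact hd x hx
    _ = ENNReal.ofReal (d ^ 2) * ∫⁻ s in Ioc (0 : ℝ) 1,
          ∫⁻ x in S', ‖fderiv ℝ v (x + s • (t • x + b - x))‖ₑ ^ 2 := by
        rw [lintegral_const_mul' _ _ ENNReal.ofReal_ne_top, lintegral_lintegral_swap]
        exact (hF.comp hc.measurable).aemeasurable
    _ ≤ ENNReal.ofReal (d ^ 2) * ∫⁻ s in Ioc (0 : ℝ) 1,
          ENNReal.ofReal ((t ^ n)⁻¹) * ∫⁻ x in S, ‖fderiv ℝ v x‖ₑ ^ 2 := by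
        refine mul_le_mul' le_rfl ?_
        refine setLIntegral_mono_ae' measurableSet_Ioc (.of_forall fun s hs => ?_)
        have e : ∀ x : Rn n, x + s • (t • x + b - x) = (1 - s + s * t) • x + s • b := fun x => by
          module
        simp only [e]
        refine lintegral_comp_affine_le ht ?_ _ hS' hS (fun x hx => ?_) hF
        · nlinarith [hs.1, hs.2]
        · rw [← e]; exact hmaps x hx s ⟨hs.1.le, hs.2⟩
    _ = _ := by
        rw [lintegral_const, Measure.restrict_apply_univ, Real.volume_Ioc,
          ENNReal.ofReal_mul (sq_nonneg d)]
        simp [mul_assoc]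

/-- `L²` estimate of the increments of `v` between two points of the image of `S'` under an affine
contraction. Along the segment from the image of `x` to the image of `y`, one of `x`, `y` always
has a weight of at least `1/2`: this is the variable with respect to which one integrates
first. -/
lemma lintegral_lintegral_affine_increment_le {v : Rn n → ℝ} (hv : ContDiff ℝ 1 v) {t d : ℝ}
    (ht : 0 < t) (b : Rn n)
    {S' S : Set (Rn n)} (hS' : MeasurableSet S') (hS : MeasurableSet S)
    (hmaps : ∀ x ∈ S', ∀ y ∈ S', ∀ s ∈ Icc (0 : ℝ) 1,
      ((1 - s) * t) • x + (s * t) • y + b ∈ S)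
    (hd : ∀ x ∈ S', ∀ y ∈ S', ‖(t • y + b) - (t • x + b)‖ ≤ d) :
    ∫⁻ x in S', ∫⁻ y in S', ‖v (t • y + b) - v (t • x + b)‖ₑ ^ 2 ≤
      ENNReal.ofReal (d ^ 2 * ((t / 2) ^ n)⁻¹) * volume S' *
        ∫⁻ x in S, ‖fderiv ℝ v x‖ₑ ^ 2 := by
  set F : Rn n → ℝ≥0∞ := fun x => ‖fderiv ℝ v x‖ₑ ^ 2
  have hF : Measurable F := measurable_enorm_fderiv_sq hv
  set B := ENNReal.ofReal (((t / 2) ^ n)⁻¹) * volume S' * ∫⁻ x in S, F x with hB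
  have hc2 : ∀ s : ℝ, Continuous fun z : Rn n × Rn n =>
      ((1 - s) * t) • z.1 + (s * t) • z.2 + b := fun s => by fun_prop
  have key : ∀ s ∈ Icc (0 : ℝ) 1,
      ∫⁻ x in S', ∫⁻ y in S', F (((1 - s) * t) • x + (s * t) • y + b) ≤ B := by
    intro s hs
    have hconst : B = ∫⁻ _ in S', ENNReal.ofReal (((t / 2) ^ n)⁻¹) * ∫⁻ x in S, F x := by
      rw [lintegral_const, Measure.restrict_apply_univ, hB]; ring
    rcases le_total (1 / 2) s with h | h
    · rw [hconst]
      refine setLIntegral_mono_ae' hS' (.of_forall fun x hx => ?_)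
      have e : ∀ y : Rn n, ((1 - s) * t) • x + (s * t) • y + b =
          (s * t) • y + (((1 - s) * t) • x + b) := fun y => by module
      simp only [e]
      refine lintegral_comp_affine_le (half_pos ht) (by nlinarith) _ hS' hS (fun y hy => ?_) hF
      rw [← e]; exact hmaps x hx y hy s hs
    · rw [lintegral_lintegral_swap
        (f := fun x y : Rn n => F (((1 - s) * t) • x + (s * t) • y + b))
        (hF.comp (hc2 s).measurable).aemeasurable, hconst]
      refine setLIntegral_mono_ae' hS' (.of_forall fun y hy => ?_)
      have e : ∀ x : Rn n, ((1 - s) * t) • x + (s * t) • y + b =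
          ((1 - s) * t) • x + ((s * t) • y + b) := fun x => by module
      simp only [e]
      refine lintegral_comp_affine_le (half_pos ht) (by nlinarith) _ hS' hS (fun x hx => ?_) hF
      rw [← e]; exact hmaps x hx y hy s hs
  have hc3 : Continuous fun z : Rn n × Rn n × ℝ =>
      ((1 - z.2.2) * t) • z.1 + (z.2.2 * t) • z.2.1 + b := by fun_prop
  calc ∫⁻ x in S', ∫⁻ y in S', ‖v (t • y + b) - v (t • x + b)‖ₑ ^ 2
      ≤ ∫⁻ x in S', ∫⁻ y in S', ENNReal.ofReal (d ^ 2) *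
          ∫⁻ s in Ioc (0 : ℝ) 1, F (((1 - s) * t) • x + (s * t) • y + b) := by
        refine setLIntegral_mono_ae' hS' (.of_forall fun x hx => ?_)
        refine setLIntegral_mono_ae' hS' (.of_forall fun y hy => ?_)
        refine (enorm_sub_sq_le_lintegral_fderiv hv _ _).trans ?_
        have e : ∀ s : ℝ, ((1 - s) * t) • x + (s * t) • y + b =
          t • x + b + s • (t • y + b - (t • x + b)) := fun s => by module
        simp only [e]
        gcongr
        rw [← ofReal_norm, ← ENNReal.ofReal_pow (norm_nonneg _)]
        gcongr
        exact hd x hx y hy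
    _ = ENNReal.ofReal (d ^ 2) * ∫⁻ s in Ioc (0 : ℝ) 1,
          ∫⁻ x in S', ∫⁻ y in S', F (((1 - s) * t) • x + (s * t) • y + b) := by
        simp only [lintegral_const_mul' _ _ (ENNReal.ofReal_ne_top (r := d ^ 2))]
        congr 1
        have h1 : ∀ x : Rn n, ∫⁻ y in S', ∫⁻ s in Ioc (0 : ℝ) 1,
            F (((1 - s) * t) • x + (s * t) • y + b) = ∫⁻ s in Ioc (0 : ℝ) 1, ∫⁻ y in S',
            F (((1 - s) * t) • x + (s * t) • y + b) := fun x =>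
          lintegral_lintegral_swap
            (hF.comp (hc3.comp (by fun_prop :
              Continuous fun z : Rn n × ℝ => (x, z.1, z.2))).measurable).aemeasurable
        simp only [h1]
        refine lintegral_lintegral_swap (Measurable.aemeasurable ?_)
        refine Measurable.lintegral_prod_right' (f := fun z : (Rn n × ℝ) × Rn n =>
          F (((1 - z.1.2) * t) • z.1.1 + (z.1.2 * t) • z.2 + b)) ?_
        exact hF.comp (hc3.comp (by fun_prop :
              Continuous fun z : (Rn n × ℝ) × Rn n => (z.1.1, z.2, z.1.2))).measurable
    _ ≤ ENNReal.ofReal (d ^ 2) * ∫⁻ _ in Ioc (0 : ℝ) 1, B := by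
        refine mul_le_mul' le_rfl ?_
        exact setLIntegral_mono_ae' measurableSet_Ioc
          (.of_forall fun s hs => key s ⟨hs.1.le, hs.2⟩)
    _ = _ := by
        rw [lintegral_const, Measure.restrict_apply_univ, Real.volume_Ioc,
          ENNReal.ofReal_mul (sq_nonneg d), hB]
        simp [mul_assoc]

/-- Poincaré's inequality for a continuously differentiable function, in the form of a bound on its
mutual increments over `S'`. The set `S` contains the segments that join `S'` to `p`, and a ball
around `p`; two points `x`, `y` of `S'` are joined through `p + τ (x - p)` and `p + τ (y - p)`,
where `τ = 1/(2Λ)` is so small that these two points belong to the ball. -/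
lemma lintegral_lintegral_sub_sq_le_of_contDiff {v : Rn n → ℝ} (hv : ContDiff ℝ 1 v)
    {p : Rn n} {ρ d Λ : ℝ} (hΛ : 1 ≤ Λ)
    {S' S : Set (Rn n)} (hS' : MeasurableSet S') (hS : MeasurableSet S)
    (hstar : ∀ x ∈ S', ∀ s ∈ Icc (0 : ℝ) 1, p + s • (x - p) ∈ S)
    (hball : Metric.closedBall p (ρ / 2) ⊆ S)
    (hΛρ : ∀ x ∈ S', ‖x - p‖ ≤ Λ * ρ)
    (hp : ∀ x ∈ S', ‖x - p‖ ≤ d) (hd : ∀ x ∈ S', ∀ y ∈ S', ‖y - x‖ ≤ d) :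
    ∫⁻ x in S', ∫⁻ y in S', ‖v x - v y‖ₑ ^ 2 ≤
      ENNReal.ofReal (9 * (4 * Λ) ^ n * d ^ 2) * volume S' *
        ∫⁻ x in S, ‖fderiv ℝ v x‖ₑ ^ 2 := by
  have hΛ0 : 0 < Λ := by linarith
  set t : ℝ := 1 / (2 * Λ) with ht
  set b : Rn n := (1 - t) • p with hb
  set I := ∫⁻ x in S, ‖fderiv ℝ v x‖ₑ ^ 2 with hI
  have ht0 : 0 < t := by positivity
  have ht1 : t ≤ 1 := by rw [ht, div_le_one (by positivity)]; linarith
  have htΛ : t * Λ = 1 / 2 := by rw [ht]; field_simp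
  have hA := lintegral_affine_increment_le hv (d := d) ht0 ht1 b hS' hS
    (fun x hx s hs => by
      have : x + s • (t • x + b - x) = p + (1 - s * (1 - t)) • (x - p) := by rw [hb]; module
      rw [this]
      exact hstar x hx _ ⟨by nlinarith [hs.1, hs.2], by nlinarith [hs.1, hs.2]⟩)
    (fun x hx => by
      have : t • x + b - x = (1 - t) • (p - x) := by rw [hb]; module
      rw [this, norm_smul, Real.norm_of_nonneg (by linarith), norm_sub_rev]
      have h1 := hp x hx
      nlinarith [norm_nonneg (x - p)])
  have hB := lintegral_lintegral_affine_increment_le hv (d := d) ht0 b hS' hS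
    (fun x hx y hy s hs => by
      apply hball
      have : ((1 - s) * t) • x + (s * t) • y + b = p + t • ((1 - s) • (x - p) + s • (y - p)) := by
        rw [hb]; module
      rw [this, Metric.mem_closedBall, dist_eq_norm, add_sub_cancel_left, norm_smul,
        Real.norm_of_nonneg ht0.le]
      have h1 : ‖(1 - s) • (x - p) + s • (y - p)‖ ≤ Λ * ρ := by
        refine (norm_add_le _ _).trans ?_
        rw [norm_smul, norm_smul, Real.norm_of_nonneg hs.1,
          Real.norm_of_nonneg (sub_nonneg.2 hs.2)]
        nlinarith [hΛρ x hx, hΛρ y hy, hs.1, hs.2]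
      calc t * _ ≤ t * (Λ * ρ) := by gcongr
        _ = ρ / 2 := by rw [← mul_assoc, htΛ]; ring)
    (fun x hx y hy => by
      have : (t • y + b) - (t • x + b) = t • (y - x) := by module
      rw [this, norm_smul, Real.norm_of_nonneg ht0.le]
      have h1 := hd x hx y hy
      nlinarith [norm_nonneg (y - x)])
  have hcv := hv.continuous
  have hc : Continuous fun x : Rn n => t • x + b := by fun_prop
  have hm1 : Measurable fun x => ‖v (t • x + b) - v x‖ₑ ^ 2 :=
    ((hcv.comp hc).sub hcv).enorm.measurable.pow_const 2
  have hm2 : ∀ x, Measurable fun y => ‖v (t • y + b) - v (t • x + b)‖ₑ ^ 2 := fun x =>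
    ((hcv.comp hc).sub continuous_const).enorm.measurable.pow_const 2
  set A := ∫⁻ x in S', ‖v (t • x + b) - v x‖ₑ ^ 2 with hAdef
  calc ∫⁻ x in S', ∫⁻ y in S', ‖v x - v y‖ₑ ^ 2
      ≤ ∫⁻ x in S', ∫⁻ y in S', (3 * ‖v (t • x + b) - v x‖ₑ ^ 2 +
          (3 * ‖v (t • y + b) - v (t • x + b)‖ₑ ^ 2 + 3 * ‖v (t • y + b) - v y‖ₑ ^ 2)) := by
        refine lintegral_mono fun x => lintegral_mono fun y => ?_
        simp only [enorm_sq_eq_ofReal]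
        rw [show (3 : ℝ≥0∞) = ENNReal.ofReal 3 by simp, ← ENNReal.ofReal_mul (by norm_num),
          ← ENNReal.ofReal_mul (by norm_num), ← ENNReal.ofReal_mul (by norm_num),
          ← ENNReal.ofReal_add (by positivity) (by positivity),
          ← ENNReal.ofReal_add (by positivity) (by positivity)]
        refine ENNReal.ofReal_le_ofReal ?_
        nlinarith [sq_nonneg ((v (t • x + b) - v x) - (v (t • y + b) - v (t • x + b))),
          sq_nonneg ((v (t • x + b) - v x) + (v (t • y + b) - v y)),
          sq_nonneg ((v (t • y + b) - v (t • x + b)) + (v (t • y + b) - v y))]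
    _ = 3 * A * volume S' + (3 * (∫⁻ x in S', ∫⁻ y in S', ‖v (t • y + b) - v (t • x + b)‖ₑ ^ 2) +
          3 * A * volume S') := by
        have h1 : ∀ x, ∫⁻ y in S', (3 * ‖v (t • x + b) - v x‖ₑ ^ 2 +
          (3 * ‖v (t • y + b) - v (t • x + b)‖ₑ ^ 2 + 3 * ‖v (t • y + b) - v y‖ₑ ^ 2)) =
          3 * ‖v (t • x + b) - v x‖ₑ ^ 2 * volume S' +
            (3 * ∫⁻ y in S', ‖v (t • y + b) - v (t • x + b)‖ₑ ^ 2) + 3 * A := by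
          intro x
          rw [lintegral_add_left measurable_const, lintegral_const, Measure.restrict_apply_univ,
            lintegral_add_left ((hm2 x).const_mul 3), lintegral_const_mul _ (hm2 x),
            lintegral_const_mul _ hm1, add_assoc]
        simp only [h1]
        have hm3 : Measurable fun x => 3 * ‖v (t • x + b) - v x‖ₑ ^ 2 * volume S' :=
          (hm1.const_mul 3).mul_const _
        rw [lintegral_add_right _ measurable_const, lintegral_add_left hm3, lintegral_const,
          Measure.restrict_apply_univ, lintegral_mul_const _ (hm1.const_mul 3),
          lintegral_const_mul _ hm1, lintegral_const_mul' _ _ (by simp), add_assoc]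
    _ ≤ 3 * (ENNReal.ofReal (d ^ 2 * ((t / 2) ^ n)⁻¹) * I) * volume S' +
          (3 * (ENNReal.ofReal (d ^ 2 * ((t / 2) ^ n)⁻¹) * volume S' * I) +
          3 * (ENNReal.ofReal (d ^ 2 * ((t / 2) ^ n)⁻¹) * I) * volume S') := by
        have hA' : A ≤ ENNReal.ofReal (d ^ 2 * ((t / 2) ^ n)⁻¹) * I := by
          refine hA.trans ?_
          gcongr
          linarith
        gcongr
    _ = _ := by
        have : 9 * (4 * Λ) ^ n * d ^ 2 = 9 * (d ^ 2 * ((t / 2) ^ n)⁻¹) := by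
          rw [← inv_pow, ht]
          have : (1 / (2 * Λ) / 2)⁻¹ = 4 * Λ := by field_simp; norm_num
          rw [this]; ring
        rw [this, ENNReal.ofReal_mul (by norm_num : (0 : ℝ) ≤ 9),
          show ENNReal.ofReal 9 = 9 by simp]
        ring

end Increments

end GDM

/-- Fatou's lemma for an almost everywhere convergent sequence of bounded integrals. -/
lemma lintegral_le_of_ae_tendsto {β : Type*} [MeasurableSpace β] {μ : Measure β} {f : β → ℝ≥0∞}
    {F : ℕ → β → ℝ≥0∞} (hm : ∀ k, Measurable (F k))
    (hF : ∀ᵐ x ∂μ, Tendsto (fun k => F k x) atTop (𝓝 (f x))) {B : ℝ≥0∞}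
    (hB : ∀ᶠ k in atTop, ∫⁻ x, F k x ∂μ ≤ B) : ∫⁻ x, f x ∂μ ≤ B := by
  calc ∫⁻ x, f x ∂μ = ∫⁻ x, liminf (fun k => F k x) atTop ∂μ :=
        lintegral_congr_ae (hF.mono fun x hx => hx.liminf_eq.symm)
    _ ≤ liminf (fun k => ∫⁻ x, F k x ∂μ) atTop := lintegral_liminf_le hm
    _ ≤ B := liminf_le_of_frequently_le' hB.frequently

/-- The mean square deviation from the average is controlled by the mutual increments. -/
lemma lintegral_sub_average_sq_le {β : Type*} [MeasurableSpace β] {μ : Measure β}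
    [IsFiniteMeasure μ] {u : β → ℝ} (hu : Integrable u μ) (h0 : μ ≠ 0) {B : ℝ≥0∞}
    (hB : ∫⁻ x, ∫⁻ y, ‖u x - u y‖ₑ ^ 2 ∂μ ∂μ ≤ B * μ univ) :
    ∫⁻ x, ‖u x - ⨍ y, u y ∂μ‖ₑ ^ 2 ∂μ ≤ B := by
  have hm0 : μ univ ≠ 0 := by simpa using h0
  have hmt : μ univ ≠ ⊤ := measure_ne_top _ _
  have h1 : ∀ x, μ univ * ‖u x - ⨍ y, u y ∂μ‖ₑ ^ 2 ≤ ∫⁻ y, ‖u x - u y‖ₑ ^ 2 ∂μ := by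
    intro x
    have h2 : μ univ * ‖u x - ⨍ y, u y ∂μ‖ₑ ≤ ∫⁻ y, ‖u x - u y‖ₑ ∂μ := by
      have e : ∫ y, (u x - u y) ∂μ = μ.real univ * (u x - ⨍ y, u y ∂μ) := by
        rw [integral_sub (integrable_const _) hu, integral_const, mul_sub,
          ← measure_smul_average μ u]
        simp
      have h3 : ‖∫ y, (u x - u y) ∂μ‖ₑ = μ univ * ‖u x - ⨍ y, u y ∂μ‖ₑ := by
        rw [e, enorm_mul, Real.enorm_of_nonneg measureReal_nonneg, measureReal_def,
          ENNReal.ofReal_toReal hmt]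
      rw [← h3]
      exact enorm_integral_le_lintegral_enorm _
    have h4 : (μ univ * ‖u x - ⨍ y, u y ∂μ‖ₑ) ^ 2 ≤ μ univ * ∫⁻ y, ‖u x - u y‖ₑ ^ 2 ∂μ :=
      (pow_le_pow_left' h2 2).trans
        (lintegral_sq_le μ ((aestronglyMeasurable_const.sub hu.1).enorm))
    rw [mul_pow, sq, mul_assoc] at h4
    exact (ENNReal.mul_le_mul_iff_right hm0 hmt).1 h4
  have h5 : μ univ * ∫⁻ x, ‖u x - ⨍ y, u y ∂μ‖ₑ ^ 2 ∂μ ≤ μ univ * B := by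
    rw [← lintegral_const_mul' _ _ hmt, mul_comm _ B]
    exact (lintegral_mono h1).trans hB
  exact (ENNReal.mul_le_mul_iff_right hm0 hmt).1 h5

namespace GDM

/-! ### Poincaré's inequality and oscillation on star-shaped cells -/

section Cells

variable {n : ℕ} {K U : Set (Rn n)} {u : Rn n → ℝ} {G : Rn n → Rn n} {p : Rn n}

/-- The points at distance at least `r` from the complement of `K`. -/
def deepPart (K : Set (Rn n)) (r : ℝ) : Set (Rn n) := {q | ENNReal.ofReal r ≤ Metric.infEDist q Kᶜ}

lemma isClosed_deepPart (r : ℝ) : IsClosed (deepPart K r) :=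
  isClosed_le continuous_const Metric.continuous_infEDist

lemma closedBall_subset_of_mem_deepPart {r s : ℝ} (hsr : s < r) {q : Rn n}
    (hq : q ∈ deepPart K r) : Metric.closedBall q s ⊆ K := by
  intro z hz
  by_contra hzK
  have h1 : ENNReal.ofReal r ≤ edist q z := le_trans hq (Metric.infEDist_le_edist_of_mem hzK)
  rw [edist_dist, ENNReal.ofReal_le_ofReal_iff dist_nonneg, dist_comm] at h1
  have := Metric.mem_closedBall.1 hz
  linarith

lemma closedBall_subset_deepPart {ρ r s : ℝ} (hK : Metric.ball p ρ ⊆ K) (h : s + r ≤ ρ) :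
    Metric.closedBall p s ⊆ deepPart K r := by
  intro q hq
  refine Metric.le_infEDist.2 fun z hz => ?_
  rw [edist_dist]
  refine ENNReal.ofReal_le_ofReal ?_
  by_contra hlt
  apply hz
  apply hK
  rw [Metric.mem_ball]
  have h1 := dist_triangle z q p
  rw [dist_comm z q] at h1
  have := Metric.mem_closedBall.1 hq
  linarith

/-- A compact subset of an open set `K` lies well inside `K`. -/
lemma eventually_subset_deepPart (hK : IsOpen K) {S : Set (Rn n)} (hS : IsCompact S)
    (hSK : S ⊆ K) : ∀ᶠ k in atTop, S ⊆ deepPart K (2 * mollifierRadius k) := by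
  obtain ⟨δ, hδ, h⟩ := hS.exists_cthickening_subset_open hK hSK
  have h1 : Tendsto (fun k => 2 * mollifierRadius k) atTop (𝓝 0) := by
    simpa using tendsto_mollifierRadius.const_mul 2
  filter_upwards [h1.eventually (gt_mem_nhds hδ)] with k hk q hq
  refine Metric.le_infEDist.2 fun z hz => ?_
  rw [edist_dist]
  refine ENNReal.ofReal_le_ofReal ?_
  by_contra hlt
  apply hz
  apply h
  refine Metric.mem_cthickening_of_dist_le z q δ S hq ?_
  rw [dist_comm]
  linarith

/-- The points joined to `p` by a segment that stays at distance at least `r` from the complement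
of `K`. -/
def starDeepPart (K : Set (Rn n)) (p : Rn n) (r : ℝ) : Set (Rn n) :=
  {x | ∀ s ∈ Icc (0 : ℝ) 1, p + s • (x - p) ∈ deepPart K r}

lemma isClosed_starDeepPart (r : ℝ) : IsClosed (starDeepPart K p r) := by
  have : starDeepPart K p r =
      ⋂ s ∈ Icc (0 : ℝ) 1, (fun x : Rn n => p + s • (x - p)) ⁻¹' deepPart K r := by
    ext x; simp [starDeepPart]
  rw [this]
  exact isClosed_biInter fun s _ => (isClosed_deepPart r).preimage (by fun_prop)

lemma starDeepPart_subset {r : ℝ} (hr : 0 < r) : starDeepPart K p r ⊆ K := by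
  intro x hx
  have h := hx 1 ⟨zero_le_one, le_rfl⟩
  have h2 := closedBall_subset_of_mem_deepPart (half_lt_self hr) h
  have : p + (1 : ℝ) • (x - p) = x := by module
  rw [this] at h2
  exact h2 (Metric.mem_closedBall_self (half_pos hr).le)

lemma eventually_mem_starDeepPart (hK : IsOpen K) (hstar : StarConvex ℝ p K) {x : Rn n}
    (hx : x ∈ K) : ∀ᶠ k in atTop, x ∈ starDeepPart K p (2 * mollifierRadius k) := by
  have h1 : IsCompact ((fun s : ℝ => p + s • (x - p)) '' Icc 0 1) :=
    isCompact_Icc.image (by fun_prop)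
  have h2 : (fun s : ℝ => p + s • (x - p)) '' Icc 0 1 ⊆ K := by
    rintro _ ⟨s, hs, rfl⟩
    exact hstar.add_smul_sub_mem hx hs.1 hs.2
  filter_upwards [eventually_subset_deepPart hK h1 h2] with k hk s hs
  exact hk ⟨s, hs, rfl⟩

lemma closedBall_mollifierRadius_subset {k : ℕ} {q : Rn n}
    (hq : q ∈ deepPart K (2 * mollifierRadius k)) :
    Metric.closedBall q (mollifierRadius k) ⊆ K :=
  closedBall_subset_of_mem_deepPart (by linarith [mollifierRadius_pos k]) hq

/-- Poincaré's inequality in mutual form: mollify, and apply Fatou's lemma. -/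
lemma lintegral_lintegral_sub_sq_le (hK : IsOpen K) (hstar : StarConvex ℝ p K)
    (hu : IntegrableOn u K) (hG : HasWeakGrad K u G)
    (hGm : AEStronglyMeasurable G (volume.restrict K)) {ρ d Λ : ℝ} (hρ : 0 < ρ) (hΛ : 1 ≤ Λ)
    (hball : Metric.ball p ρ ⊆ K) (hΛρ : ∀ x ∈ K, ‖x - p‖ ≤ Λ * ρ)
    (hp : ∀ x ∈ K, ‖x - p‖ ≤ d) (hd : ∀ x ∈ K, ∀ y ∈ K, ‖y - x‖ ≤ d) :
    ∫⁻ x in K, ∫⁻ y in K, ‖u x - u y‖ₑ ^ 2 ≤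
      ENNReal.ofReal (9 * (4 * Λ) ^ n * d ^ 2) * volume K * ∫⁻ x in K, ‖G x‖ₑ ^ 2 := by
  have hKm := hK.measurableSet
  set S' : ℕ → Set (Rn n) := fun k => starDeepPart K p (2 * mollifierRadius k) with hS'
  have hr : ∀ k, 0 < 2 * mollifierRadius k := fun k => by linarith [mollifierRadius_pos k]
  have hS'm : ∀ k, MeasurableSet (S' k) := fun k => (isClosed_starDeepPart _).measurableSet
  have hS'K : ∀ k, S' k ⊆ K := fun k => starDeepPart_subset (hr k)
  have hvc : ∀ k, ContDiff ℝ 1 (mollify k K u) := fun k => contDiff_mollify k hKm hu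
  set f : Rn n × Rn n → ℝ≥0∞ := fun z => ‖u z.1 - u z.2‖ₑ ^ 2 with hf
  set F₀ : ℕ → Rn n × Rn n → ℝ≥0∞ :=
    fun k z => ‖mollify k K u z.1 - mollify k K u z.2‖ₑ ^ 2 with hF₀
  have hF₀m : ∀ k, Measurable (F₀ k) := fun k =>
    (((hvc k).continuous.comp continuous_fst).sub
      ((hvc k).continuous.comp continuous_snd)).enorm.measurable.pow_const 2
  set F : ℕ → Rn n × Rn n → ℝ≥0∞ := fun k => (S' k ×ˢ S' k).indicator (F₀ k) with hF
  have hFm : ∀ k, Measurable (F k) := fun k => (hF₀m k).indicator ((hS'm k).prod (hS'm k))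
  set μ := volume.restrict K with hμ
  have hfm : AEMeasurable f (μ.prod μ) := by
    have h1 : AEStronglyMeasurable (fun z : Rn n × Rn n => u z.1 - u z.2) (μ.prod μ) :=
      (hu.1.comp_quasiMeasurePreserving Measure.quasiMeasurePreserving_fst).sub
        (hu.1.comp_quasiMeasurePreserving Measure.quasiMeasurePreserving_snd)
    exact h1.enorm.pow_const 2
  have hlim : ∀ᵐ z ∂(μ.prod μ), Tendsto (fun k => F k z) atTop (𝓝 (f z)) := by
    have h1 : ∀ᵐ x ∂μ, x ∈ K ∧ Tendsto (fun k => mollify k K u x) atTop (𝓝 (u x)) :=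
      (ae_restrict_mem hKm).and (mollify_tendsto_ae hKm hu)
    filter_upwards [Measure.quasiMeasurePreserving_fst.ae h1,
      Measure.quasiMeasurePreserving_snd.ae h1] with z hz1 hz2
    have h2 : Tendsto (fun k => F₀ k z) atTop (𝓝 (f z)) :=
      ENNReal.Tendsto.pow (hz1.2.sub hz2.2).enorm
    refine h2.congr' ?_
    filter_upwards [eventually_mem_starDeepPart hK hstar hz1.1,
      eventually_mem_starDeepPart hK hstar hz2.1] with k hk1 hk2
    exact (indicator_of_mem (show z ∈ S' k ×ˢ S' k from ⟨hk1, hk2⟩) (F₀ k)).symm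
  have hbound : ∀ᶠ k in atTop, ∫⁻ z, F k z ∂(μ.prod μ) ≤
      ENNReal.ofReal (9 * (4 * Λ) ^ n * d ^ 2) * volume K * ∫⁻ x in K, ‖G x‖ₑ ^ 2 := by
    have h1 : Tendsto (fun k => 2 * mollifierRadius k) atTop (𝓝 0) := by
      simpa using tendsto_mollifierRadius.const_mul 2
    filter_upwards [h1.eventually (gt_mem_nhds (half_pos hρ))] with k hk
    have e1 : (μ.prod μ).restrict (S' k ×ˢ S' k) =
        (volume.restrict (S' k)).prod (volume.restrict (S' k)) := by
      rw [← Measure.prod_restrict, hμ, Measure.restrict_restrict (hS'm k),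
        inter_eq_left.2 (hS'K k)]
    rw [hF, lintegral_indicator ((hS'm k).prod (hS'm k)), e1,
      lintegral_prod _ (hF₀m k).aemeasurable]
    calc ∫⁻ x in S' k, ∫⁻ y in S' k, F₀ k (x, y)
        ≤ ENNReal.ofReal (9 * (4 * Λ) ^ n * d ^ 2) * volume (S' k) *
            ∫⁻ x in deepPart K (2 * mollifierRadius k), ‖fderiv ℝ (mollify k K u) x‖ₑ ^ 2 :=
          lintegral_lintegral_sub_sq_le_of_contDiff (hvc k) (ρ := ρ) hΛ (hS'm k)
            (isClosed_deepPart _).measurableSet (fun x hx s hs => hx s hs)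
            (closedBall_subset_deepPart hball (by linarith))
            (fun x hx => hΛρ x (hS'K k hx)) (fun x hx => hp x (hS'K k hx))
            (fun x hx y hy => hd x (hS'K k hx) y (hS'K k hy))
      _ ≤ _ := by
          refine mul_le_mul' (mul_le_mul' le_rfl (measure_mono (hS'K k))) ?_
          exact lintegral_fderiv_mollify_sq_le hKm hu hG hGm
            (isClosed_deepPart _).measurableSet
            (fun x hx => closedBall_mollifierRadius_subset hx)
  have := lintegral_le_of_ae_tendsto hFm hlim hbound
  rwa [lintegral_prod _ hfm] at this

/-- Poincaré's inequality on a cell that is star-shaped with respect to a point. -/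
lemma lintegral_sub_average_sq_le_grad (hK : IsOpen K) (hstar : StarConvex ℝ p K)
    (hKf : volume K ≠ ⊤)
    (hu : IntegrableOn u K) (hG : HasWeakGrad K u G)
    (hGm : AEStronglyMeasurable G (volume.restrict K)) {ρ d Λ : ℝ} (hρ : 0 < ρ) (hΛ : 1 ≤ Λ)
    (hball : Metric.ball p ρ ⊆ K) (hΛρ : ∀ x ∈ K, ‖x - p‖ ≤ Λ * ρ)
    (hp : ∀ x ∈ K, ‖x - p‖ ≤ d) (hd : ∀ x ∈ K, ∀ y ∈ K, ‖y - x‖ ≤ d) :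
    ∫⁻ x in K, ‖u x - ⨍ y in K, u y‖ₑ ^ 2 ≤
      ENNReal.ofReal (9 * (4 * Λ) ^ n * d ^ 2) * ∫⁻ x in K, ‖G x‖ₑ ^ 2 := by
  have : IsFiniteMeasure (volume.restrict K) := isFiniteMeasure_restrict.2 hKf
  have hK0 : volume K ≠ 0 :=
    (hK.measure_pos volume ⟨p, hball (Metric.mem_ball_self hρ)⟩).ne'
  refine lintegral_sub_average_sq_le hu (by simpa using hK0) ?_
  refine (lintegral_lintegral_sub_sq_le hK hstar hu hG hGm hρ hΛ hball hΛρ hp hd).trans_eq ?_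
  rw [Measure.restrict_apply_univ]; ring

/-- On a star-shaped cell, a function with a bounded weak gradient has a bounded oscillation. -/
lemma ae_dist_le_of_weakGrad_bounded (hK : IsOpen K) (hstar : StarConvex ℝ p K)
    (hu : IntegrableOn u K) (hG : HasWeakGrad K u G) {L d : ℝ} (hL0 : 0 ≤ L)
    (hL : ∀ᵐ y ∂(volume.restrict K), ‖G y‖ ≤ L) (hp : ∀ x ∈ K, ‖x - p‖ ≤ d) :
    ∃ S : Set (Rn n), (∀ᵐ x ∂(volume.restrict K), x ∈ S) ∧
      ∀ x ∈ S, ∀ y ∈ S, |u x - u y| ≤ 2 * d * L := by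
  have hKm := hK.measurableSet
  refine ⟨{x | x ∈ K ∧ Tendsto (fun k => mollify k K u x) atTop (𝓝 (u x))},
    (ae_restrict_mem hKm).and (mollify_tendsto_ae hKm hu), ?_⟩
  have key : ∀ x ∈ K, ∀ᶠ k in atTop, |mollify k K u x - mollify k K u p| ≤ d * L := by
    intro x hx
    filter_upwards [eventually_mem_starDeepPart hK hstar hx] with k hk
    have hseg : ∀ q ∈ segment ℝ p x, ‖fderiv ℝ (mollify k K u) q‖ ≤ L := by
      intro q hq
      rw [segment_eq_image'] at hq
      obtain ⟨s, hs, rfl⟩ := hq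
      exact norm_fderiv_mollify_le_of_bound hKm hu hG hL0 hL
        (closedBall_mollifierRadius_subset (hk s hs))
    have h1 := (convex_segment (𝕜 := ℝ) p x).norm_image_sub_le_of_norm_fderiv_le
      (f := mollify k K u) (𝕜 := ℝ)
      (fun q _ => ((contDiff_mollify k hKm hu).differentiable one_ne_zero).differentiableAt)
      hseg (left_mem_segment ℝ p x) (right_mem_segment ℝ p x)
    rw [Real.norm_eq_abs] at h1
    nlinarith [hp x hx]
  intro x hx y hy
  refine le_of_tendsto ((hx.2.sub hy.2).abs) ?_
  filter_upwards [key x hx.1, key y hy.1] with k h1 h2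
  have h3 := abs_sub_le (mollify k K u x) (mollify k K u p) (mollify k K u y)
  rw [abs_sub_comm (mollify k K u p)] at h3
  linarith

/-- `L²` estimate of the increments of a function with a square integrable weak gradient. -/
lemma lintegral_translate_sub_sq_le (hU : IsOpen U) (hu : IntegrableOn u U)
    (hG : HasWeakGrad U u G) (hGm : AEStronglyMeasurable G (volume.restrict U))
    {S' : Set (Rn n)} (hS' : IsCompact S') (z : Rn n)
    (hSU : ∀ x ∈ S', ∀ s ∈ Icc (0 : ℝ) 1, x + s • z ∈ U) :
    ∫⁻ x in S', ‖u (x + z) - u x‖ₑ ^ 2 ≤ ENNReal.ofReal (‖z‖ ^ 2) * ∫⁻ x in U, ‖G x‖ₑ ^ 2 := by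
  have hUm := hU.measurableSet
  have hvc : ∀ k, ContDiff ℝ 1 (mollify k U u) := fun k => contDiff_mollify k hUm hu
  refine lintegral_le_of_ae_tendsto
    (F := fun k x => ‖mollify k U u (x + z) - mollify k U u x‖ₑ ^ 2) (fun k => ?_) ?_ ?_
  · exact (((hvc k).continuous.comp (continuous_add_const z)).sub
      (hvc k).continuous).enorm.measurable.pow_const 2
  · have h1 : ∀ᵐ x ∂(volume : Measure (Rn n)), x ∈ U →
        Tendsto (fun k => mollify k U u x) atTop (𝓝 (u x)) :=
      (ae_restrict_iff' hUm).1 (mollify_tendsto_ae hUm hu)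
    have h2 := (measurePreserving_add_right volume z).quasiMeasurePreserving.ae h1
    rw [ae_restrict_iff' hS'.measurableSet]
    filter_upwards [h1, h2] with x hx1 hx2 hx
    have hxU : x ∈ U := by simpa using hSU x hx 0 ⟨le_rfl, zero_le_one⟩
    have hxzU : x + z ∈ U := by simpa using hSU x hx 1 ⟨zero_le_one, le_rfl⟩
    exact ENNReal.Tendsto.pow ((hx2 hxzU).sub (hx1 hxU)).enorm
  · have h1 : IsCompact ((fun q : Rn n × ℝ => q.1 + q.2 • z) '' (S' ×ˢ Icc 0 1)) :=
      (hS'.prod isCompact_Icc).image (by fun_prop)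
    have h2 : (fun q : Rn n × ℝ => q.1 + q.2 • z) '' (S' ×ˢ Icc 0 1) ⊆ U := by
      rintro _ ⟨q, hq, rfl⟩
      exact hSU _ hq.1 _ hq.2
    filter_upwards [eventually_subset_deepPart hU h1 h2] with k hk
    have h3 := lintegral_affine_increment_le (hvc k) (d := ‖z‖) one_pos le_rfl z
      hS'.measurableSet (isClosed_deepPart (K := U) (2 * mollifierRadius k)).measurableSet
      (fun x hx s hs => by
        have : x + s • ((1 : ℝ) • x + z - x) = x + s • z := by module
        rw [this]
        exact hk ⟨(x, s), ⟨hx, hs⟩, rfl⟩)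
      (fun x _ => by simp)
    simp only [one_smul, one_pow, inv_one, mul_one] at h3
    refine h3.trans (mul_le_mul' le_rfl ?_)
    exact lintegral_fderiv_mollify_sq_le hUm hu hG hGm (isClosed_deepPart _).measurableSet
      (fun x hx => closedBall_mollifierRadius_subset hx)

end Cells

end GDM

lemma lintegral_mul_sq_le_mul {β : Type*} [MeasurableSpace β] (μ : Measure β) {f g : β → ℝ≥0∞}
    (hf : AEMeasurable f μ) (hg : AEMeasurable g μ) :
    (∫⁻ x, f x * g x ∂μ) ^ 2 ≤ (∫⁻ x, f x ^ 2 ∂μ) * ∫⁻ x, g x ^ 2 ∂μ := by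
  have h := ENNReal.lintegral_mul_le_Lp_mul_Lq μ (p := 2) (q := 2)
    (by constructor <;> norm_num) hf hg
  simp only [ENNReal.rpow_two, Pi.mul_apply] at h
  calc (∫⁻ x, f x * g x ∂μ) ^ 2
      ≤ ((∫⁻ x, f x ^ 2 ∂μ) ^ (1 / 2 : ℝ) * (∫⁻ x, g x ^ 2 ∂μ) ^ (1 / 2 : ℝ)) ^ 2 := by
        gcongr
    _ = _ := by
        rw [mul_pow, ← ENNReal.rpow_natCast, ← ENNReal.rpow_natCast, ← ENNReal.rpow_mul,
          ← ENNReal.rpow_mul]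
        norm_num

lemma lintegral_enorm_sq_eq {β E : Type*} [MeasurableSpace β] [NormedAddCommGroup E]
    (μ : Measure β) (f : β → E) : ∫⁻ x, ‖f x‖ₑ ^ 2 ∂μ = eLpNorm f 2 μ ^ 2 := by
  rw [eLpNorm_eq_lintegral_rpow_enorm_toReal (by norm_num) (by norm_num), ← ENNReal.rpow_natCast,
    ← ENNReal.rpow_mul]
  simp

/-- A linear form that is bounded by the norm of `ι v` is represented by a vector. -/
lemma exists_inner_eq_of_bound {V H : Type*} [AddCommGroup V] [Module ℝ V]
    [NormedAddCommGroup H] [InnerProductSpace ℝ H] [CompleteSpace H]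
    (ι : V →ₗ[ℝ] H) (l : V →ₗ[ℝ] ℝ) {C : ℝ} (hC : 0 ≤ C) (h : ∀ v, |l v| ≤ C * ‖ι v‖) :
    ∃ g : H, ‖g‖ ≤ C ∧ ∀ v, l v = inner ℝ g (ι v) := by
  have hker : LinearMap.ker ι ≤ LinearMap.ker l := by
    intro v hv
    have h1 := h v
    rw [LinearMap.mem_ker.1 hv, norm_zero, mul_zero] at h1
    exact abs_nonpos_iff.1 h1
  let l₁ : LinearMap.range ι →ₗ[ℝ] ℝ :=
    ((LinearMap.ker ι).liftQ l hker).comp ι.quotKerEquivRange.symm.toLinearMap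
  have hl₁ : ∀ v, l₁ ⟨ι v, LinearMap.mem_range_self ι v⟩ = l v := by
    intro v
    have h2 : ι.quotKerEquivRange.symm ⟨ι v, LinearMap.mem_range_self ι v⟩ =
        Submodule.Quotient.mk v := by
      rw [LinearEquiv.symm_apply_eq]
      rfl
    simp only [l₁, LinearMap.comp_apply, LinearEquiv.coe_coe, h2]
    rfl
  let l₂ : LinearMap.range ι →L[ℝ] ℝ := l₁.mkContinuous C (by
    rintro ⟨_, v, rfl⟩
    rw [hl₁]
    exact h v)
  obtain ⟨L, hL, hLn⟩ := exists_extension_norm_eq _ l₂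
  refine ⟨(InnerProductSpace.toDual ℝ H).symm L, ?_, fun v => ?_⟩
  · rw [LinearIsometryEquiv.norm_map, hLn]
    exact LinearMap.mkContinuous_norm_le _ hC _
  · rw [InnerProductSpace.toDual_symm_apply]
    have := hL ⟨ι v, LinearMap.mem_range_self ι v⟩
    simp only at this
    rw [this]
    exact (hl₁ v).symm

namespace GDM

/-! ### Lipschitz truncations of `H¹` functions -/

section Truncation

variable {n : ℕ} {U : Set (Rn n)} {w : Rn n → ℝ} {G : Rn n → Rn n}

lemma IsTestFunction.memLp {φ : Rn n → ℝ} (h : IsTestFunction U φ) (q : ℝ≥0∞) :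
    MemLp φ q (volume.restrict U) :=
  (h.continuous.memLp_of_hasCompactSupport h.compact).restrict U

/-- The weak derivatives of a Lipschitz function `f = P ∘ w` of `w ∈ H¹(U)` are bounded forms on
`L²(U)`: write the derivative of the test function as a limit of difference quotients, and move
these onto `f`. -/
lemma abs_integral_comp_mul_fderiv_le (hU : IsOpen U) (hw : MemLp w 2 (volume.restrict U))
    (hUf : volume U ≠ ⊤) (hG : HasWeakGrad U w G) (hG2 : MemLp G 2 (volume.restrict U))
    {P : ℝ → ℝ} (hP : ∀ s t, |P s - P t| ≤ |s - t|)
    (hf : MemLp (fun x => P (w x)) 2 (volume.restrict U))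
    {φ : Rn n → ℝ} (hφ : IsTestFunction U φ) (e : Rn n) :
    |∫ x in U, P (w x) * fderiv ℝ φ x e| ≤ ‖e‖ * l2Norm U G * l2Norm U φ := by
  have hUm := hU.measurableSet
  have : IsFiniteMeasure (volume.restrict U) := isFiniteMeasure_restrict.2 hUf
  have hwi : IntegrableOn w U := hw.integrable (by norm_num)
  set f₀ : Rn n → ℝ := U.indicator fun x => P (w x) with hf₀
  have hf₀i : Integrable f₀ :=
    (integrable_indicator_iff hUm).2 (hf.integrable (by norm_num))
  obtain ⟨C, hC⟩ := hφ.smooth.lipschitzWith_of_hasCompactSupport hφ.compact (by simp)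
  have hφd : Differentiable ℝ φ := hφ.smooth.differentiable (by simp)
  set t : ℕ → ℝ := fun k => 1 / ((k : ℝ) + 1) with ht
  have ht0 : ∀ k, 0 < t k := fun k => Nat.one_div_pos_of_nat
  have htlim : Tendsto t atTop (𝓝 0) := tendsto_one_div_add_atTop_nhds_zero_nat
  have htlim' : Tendsto t atTop (𝓝[≠] 0) :=
    tendsto_nhdsWithin_iff.2 ⟨htlim, .of_forall fun k => (ht0 k).ne'⟩
  -- difference quotients of the test function
  set D : ℕ → ℝ := fun k => ∫ x, f₀ x * ((t k)⁻¹ * (φ (x + t k • e) - φ x)) with hD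
  have hlim : Tendsto D atTop (𝓝 (∫ x in U, P (w x) * fderiv ℝ φ x e)) := by
    have e1 : ∫ x in U, P (w x) * fderiv ℝ φ x e = ∫ x, f₀ x * fderiv ℝ φ x e := by
      rw [← integral_indicator hUm]
      congr 1; funext x
      by_cases hx : x ∈ U <;> simp [hf₀, hx]
    rw [e1]
    refine tendsto_integral_of_dominated_convergence (fun x => ‖f₀ x‖ * (C * ‖e‖)) (fun k => ?_)
      (hf₀i.norm.mul_const _) (fun k => .of_forall fun x => ?_) (.of_forall fun x => ?_)
    · have hc : Continuous fun x => (t k)⁻¹ * (φ (x + t k • e) - φ x) :=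
        continuous_const.mul ((hφ.continuous.comp (continuous_add_const _)).sub hφ.continuous)
      exact hf₀i.1.mul hc.aestronglyMeasurable
    · rw [norm_mul]
      gcongr
      have h1 := hC.dist_le_mul (x + t k • e) x
      rw [dist_eq_norm, dist_eq_norm, add_sub_cancel_left, norm_smul,
        Real.norm_of_nonneg (ht0 k).le] at h1
      rw [norm_mul, norm_inv, Real.norm_of_nonneg (ht0 k).le, inv_mul_le_iff₀ (ht0 k)]
      linarith
    · refine Tendsto.const_mul _ ?_
      have h1 := (hφd x).hasFDerivAt.hasLineDerivAt e
      have h2 := h1.tendsto_slope_zero.comp htlim'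
      simpa [smul_eq_mul] using! h2
  -- the same quotients, moved onto `f₀`
  have hmove : ∀ k, D k = (t k)⁻¹ * ∫ x, (f₀ (x + -(t k • e)) - f₀ x) * φ x := by
    intro k
    obtain ⟨B, hB⟩ := hφ.continuous.bounded_above_of_compact_support hφ.compact
    have hi1 : Integrable fun x => f₀ x * φ (x + t k • e) :=
      hf₀i.mul_bdd (c := B) (hφ.continuous.comp (continuous_add_const _)).aestronglyMeasurable
        (.of_forall fun x => hB _)
    have hi2 : Integrable fun x => f₀ x * φ x :=
      hf₀i.mul_bdd (c := B) hφ.continuous.aestronglyMeasurable (.of_forall fun x => hB _)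
    have hi3 : Integrable fun x => f₀ (x + -(t k • e)) * φ x :=
      (hf₀i.comp_add_right _).mul_bdd (c := B) hφ.continuous.aestronglyMeasurable
        (.of_forall fun x => hB _)
    have e1 : ∫ x, f₀ (x + -(t k • e)) * φ x = ∫ x, f₀ x * φ (x + t k • e) := by
      rw [← integral_add_right_eq_self (fun x => f₀ (x + -(t k • e)) * φ x) (t k • e)]
      simp
    simp only [hD, sub_mul]
    rw [integral_sub hi3 hi2, e1, ← integral_sub hi1 hi2, ← integral_const_mul]
    congr 1; funext x; ring
  have hG2' : eLpNorm G 2 (volume.restrict U) ≠ ⊤ := hG2.2.ne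
  have hφ2' : eLpNorm φ 2 (volume.restrict U) ≠ ⊤ := (hφ.memLp 2).2.ne
  have hbound : ∀ᶠ k in atTop, |D k| ≤ ‖e‖ * l2Norm U G * l2Norm U φ := by
    obtain ⟨δ, hδ, h⟩ := hφ.compact.exists_cthickening_subset_open hU hφ.support_subset
    have h1 : Tendsto (fun k => t k * ‖e‖) atTop (𝓝 0) := by
      simpa using htlim.mul_const ‖e‖
    filter_upwards [h1.eventually (gt_mem_nhds hδ)] with k hk
    have hseg : ∀ x ∈ tsupport φ, ∀ s ∈ Icc (0 : ℝ) 1, x + s • (-(t k • e)) ∈ U := by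
      intro x hx s hs
      apply h
      refine Metric.mem_cthickening_of_dist_le _ x δ _ hx ?_
      rw [dist_eq_norm, add_sub_cancel_left, norm_smul, norm_neg, norm_smul,
        Real.norm_of_nonneg hs.1, Real.norm_of_nonneg (ht0 k).le]
      nlinarith [hs.2, mul_nonneg (ht0 k).le (norm_nonneg e)]
    have hT := lintegral_translate_sub_sq_le hU hwi hG hG2.1 hφ.compact (-(t k • e)) hseg
    have hS : MeasurableSet (tsupport φ) := (isClosed_tsupport φ).measurableSet
    set I := ∫ x, (f₀ (x + -(t k • e)) - f₀ x) * φ x with hI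
    have e2 : I = ∫ x in tsupport φ, (f₀ (x + -(t k • e)) - f₀ x) * φ x := by
      refine (setIntegral_eq_integral_of_forall_compl_eq_zero fun x hx => ?_).symm
      rw [image_eq_zero_of_notMem_tsupport hx, mul_zero]
    have h3 : ‖I‖ₑ ^ 2 ≤ (ENNReal.ofReal (t k * ‖e‖) * eLpNorm G 2 (volume.restrict U) *
        eLpNorm φ 2 (volume.restrict U)) ^ 2 := by
      calc ‖I‖ₑ ^ 2 ≤ (∫⁻ x in tsupport φ, ‖f₀ (x + -(t k • e)) - f₀ x‖ₑ * ‖φ x‖ₑ) ^ 2 := by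
            refine pow_le_pow_left' ?_ 2
            rw [e2]
            refine (enorm_integral_le_lintegral_enorm _).trans_eq ?_
            simp only [enorm_mul]
        _ ≤ (∫⁻ x in tsupport φ, ‖f₀ (x + -(t k • e)) - f₀ x‖ₑ ^ 2) *
              ∫⁻ x in tsupport φ, ‖φ x‖ₑ ^ 2 :=
            lintegral_mul_sq_le_mul _
              (((hf₀i.comp_add_right _).sub hf₀i).1.enorm.mono_measure Measure.restrict_le_self)
              hφ.continuous.enorm.measurable.aemeasurable
        _ ≤ (ENNReal.ofReal (‖-(t k • e)‖ ^ 2) * ∫⁻ x in U, ‖G x‖ₑ ^ 2) *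
              ∫⁻ x in U, ‖φ x‖ₑ ^ 2 := by
            refine mul_le_mul' (le_trans ?_ hT) (lintegral_mono_set hφ.support_subset)
            refine setLIntegral_mono_ae' hS (.of_forall fun x hx => ?_)
            have hxU : x ∈ U := hφ.support_subset hx
            have hxU' : x + -(t k • e) ∈ U := by
              simpa using hseg x hx 1 ⟨zero_le_one, le_rfl⟩
            rw [hf₀, indicator_of_mem hxU, indicator_of_mem hxU']
            refine pow_le_pow_left' ?_ 2
            rw [← ofReal_norm, ← ofReal_norm]
            exact ENNReal.ofReal_le_ofReal (hP _ _)
        _ = _ := by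
            rw [lintegral_enorm_sq_eq, lintegral_enorm_sq_eq, norm_neg, norm_smul,
              Real.norm_of_nonneg (ht0 k).le, ENNReal.ofReal_pow (by have := ht0 k; positivity)]
            ring
    have h4 : ‖I‖ₑ ≤ ENNReal.ofReal (t k * ‖e‖) * eLpNorm G 2 (volume.restrict U) *
        eLpNorm φ 2 (volume.restrict U) := (ENNReal.pow_le_pow_left_iff two_ne_zero).1 h3
    have h5 := ENNReal.toReal_mono (ENNReal.mul_ne_top
      (ENNReal.mul_ne_top ENNReal.ofReal_ne_top hG2') hφ2') h4
    rw [ENNReal.toReal_mul, ENNReal.toReal_mul, toReal_enorm, ENNReal.toReal_ofReal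
      (by have := ht0 k; positivity), Real.norm_eq_abs] at h5
    rw [hmove, abs_mul, abs_inv, abs_of_pos (ht0 k), inv_mul_le_iff₀ (ht0 k)]
    refine h5.trans_eq ?_
    simp only [l2Norm]; ring
  exact le_of_tendsto hlim.abs hbound

/-- The space `C_c^∞(U)`. -/
def testFunctions (U : Set (Rn n)) : Submodule ℝ (Rn n → ℝ) where
  carrier := {φ | IsTestFunction U φ}
  add_mem' {φ ψ} hφ hψ :=
    ⟨hφ.smooth.add hψ.smooth, hφ.compact.add hψ.compact,
      (tsupport_add φ ψ).trans (union_subset hφ.support_subset hψ.support_subset)⟩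
  zero_mem' := ⟨contDiff_const, HasCompactSupport.zero, by simp [tsupport]⟩
  smul_mem' r φ hφ :=
    ⟨contDiff_const.smul hφ.smooth, hφ.compact.smul_left (f := fun _ => r),
      (tsupport_smul_subset_right (fun _ => r) φ).trans hφ.support_subset⟩

/-- A `1`-Lipschitz function of a function of `H¹(U)` belongs to `H¹(U)`; the norm of its
gradient is bounded up to the dimension. -/
lemma exists_hasWeakGrad_comp (hU : IsOpen U) (hUf : volume U ≠ ⊤) (hw : MemH1 U w)
    {P : ℝ → ℝ} (hP : ∀ s t, |P s - P t| ≤ |s - t|)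
    (hf : MemLp (fun x => P (w x)) 2 (volume.restrict U)) :
    ∃ H, HasWeakGrad U (fun x => P (w x)) H ∧ MemLp H 2 (volume.restrict U) ∧
      l2Norm U H ≤ n * l2Norm U (weakGrad U w) := by
  have : IsFiniteMeasure (volume.restrict U) := isFiniteMeasure_restrict.2 hUf
  have hfl : LocallyIntegrableOn (fun x => P (w x)) U volume :=
    IntegrableOn.locallyIntegrableOn (hf.integrable (by norm_num))
  set N := l2Norm U (weakGrad U w)
  have hint : ∀ φ : testFunctions U, ∀ e : Rn n,
      IntegrableOn (fun x => P (w x) * fderiv ℝ (φ : Rn n → ℝ) x e) U := fun φ e =>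
    integrableOn_mul_of_hasCompactSupport hfl (φ.2.continuous_fderiv e)
      (φ.2.hasCompactSupport_fderiv e) (φ.2.tsupport_fderiv_subset e)
  have hdiff : ∀ (φ : testFunctions U) x, DifferentiableAt ℝ (φ : Rn n → ℝ) x := fun φ x =>
    (φ.2.smooth.differentiable (by simp)).differentiableAt
  let ι : testFunctions U →ₗ[ℝ] L2 U :=
    { toFun := fun φ => (φ.2.memLp 2).toLp _
      map_add' := fun φ ψ => rfl
      map_smul' := fun r φ => rfl }
  have hι : ∀ φ : testFunctions U, ‖ι φ‖ = l2Norm U (φ : Rn n → ℝ) := fun φ =>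
    Lp.norm_toLp _ (φ.2.memLp 2)
  have hcoe : ∀ φ : testFunctions U, ι φ =ᵐ[volume.restrict U] (φ : Rn n → ℝ) := fun φ =>
    MemLp.coeFn_toLp (φ.2.memLp 2)
  have key : ∀ i : Fin n, ∃ g : L2 U, ‖g‖ ≤ N ∧ ∀ φ : testFunctions U,
      -∫ x in U, P (w x) * fderiv ℝ (φ : Rn n → ℝ) x (EuclideanSpace.single i 1) =
        inner ℝ g (ι φ) := by
    intro i
    let l : testFunctions U →ₗ[ℝ] ℝ :=
      { toFun := fun φ =>
          -∫ x in U, P (w x) * fderiv ℝ (φ : Rn n → ℝ) x (EuclideanSpace.single i 1)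
        map_add' := fun φ ψ => by
          rw [← neg_add, ← integral_add (hint φ _) (hint ψ _)]
          congr 2; funext x
          rw [Submodule.coe_add, fderiv_add (hdiff φ x) (hdiff ψ x),
            _root_.add_apply]
          ring
        map_smul' := fun r φ => by
          rw [RingHom.id_apply, smul_eq_mul, mul_neg, ← integral_const_mul]
          congr 2; funext x
          rw [Submodule.coe_smul, fderiv_const_smul (hdiff φ x),
            _root_.smul_apply, smul_eq_mul]
          ring }
    refine exists_inner_eq_of_bound ι l (l2Norm_nonneg _) fun φ => ?_
    change |-∫ x in U, P (w x) * fderiv ℝ (φ : Rn n → ℝ) x (EuclideanSpace.single i 1)| ≤ _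
    rw [abs_neg, hι]
    have := abs_integral_comp_mul_fderiv_le hU hw.1 hUf hw.hasWeakGrad (hw.memLp_weakGrad hU) hP
      hf φ.2 (EuclideanSpace.single i (1 : ℝ))
    simpa using this
  choose g hgN hg using key
  set H : Rn n → Rn n := fun x => WithLp.toLp 2 fun i => g i x with hH
  have hHi : ∀ i, MemLp (fun x => H x i) 2 (volume.restrict U) := fun i => Lp.memLp (g i)
  have hH2 : MemLp H 2 (volume.restrict U) := memLp_of_components hHi
  refine ⟨H, ⟨hfl, IntegrableOn.locallyIntegrableOn (hH2.integrable (by norm_num)), ?_⟩, hH2, ?_⟩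
  · intro φ hφ e
    set φ' : testFunctions U := ⟨φ, hφ⟩
    have hgφ : ∀ i, IntegrableOn (fun x => g i x * φ x) U := fun i =>
      MemLp.integrable_mul (p := 2) (q := 2) (Lp.memLp (g i)) (hφ.memLp 2)
    have h1 : ∀ i, ∫ x in U, P (w x) * fderiv ℝ φ x (EuclideanSpace.single i 1) =
        -∫ x in U, g i x * φ x := by
      intro i
      rw [← neg_neg (∫ x in U, P (w x) * _), hg i φ', L2.inner_def]
      congr 1
      refine integral_congr_ae ((hcoe φ').mono fun x hx => ?_)
      simp only [hx]
      simp [φ', mul_comm]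
    have e1 : ∀ x, P (w x) * fderiv ℝ φ x e =
        ∑ i, e i * (P (w x) * fderiv ℝ φ x (EuclideanSpace.single i 1)) := by
      intro x
      conv_lhs => rw [eq_sum_single e]
      rw [map_sum, Finset.mul_sum]
      refine Finset.sum_congr rfl fun i _ => ?_
      rw [map_smul, smul_eq_mul]; ring
    have e2 : ∀ x, inner ℝ (H x) e * φ x = ∑ i, e i * (g i x * φ x) := by
      intro x
      rw [PiLp.inner_apply, Finset.sum_mul]
      refine Finset.sum_congr rfl fun i _ => ?_
      simp [hH]; ring
    simp only [e1, e2]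
    rw [integral_finsetSum _ fun i _ => (hint φ' _).const_mul _,
      integral_finsetSum _ fun i _ => (hgφ i).const_mul _, ← Finset.sum_neg_distrib]
    refine Finset.sum_congr rfl fun i _ => ?_
    rw [integral_const_mul, integral_const_mul, h1]; ring
  · refine (l2Norm_le_sum_components hHi).trans ?_
    have h2 : ∀ i ∈ (Finset.univ : Finset (Fin n)), l2Norm U (fun x => H x i) ≤ N := fun i _ => by
      have := hgN i
      rwa [← l2Norm_coe] at this
    simpa using Finset.sum_le_card_nsmul _ _ _ h2

end Truncation

/-! ### The projection onto the interval of admissible values -/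

section Proj

variable {a b : EReal}

lemma coe_proj (ha : a ≠ ⊤) (hb : b ≠ ⊥) (s : ℝ) :
    ((proj a b s : ℝ) : EReal) = min b (max a (s : EReal)) := by
  refine EReal.coe_toReal ?_ ?_
  · refine (lt_of_le_of_lt (min_le_right _ _) ?_).ne
    exact max_lt (lt_top_iff_ne_top.2 ha) (EReal.coe_lt_top s)
  · refine (lt_min (bot_lt_iff_ne_bot.2 hb) ?_).ne'
    exact lt_of_lt_of_le (EReal.bot_lt_coe s) (le_max_right _ _)

lemma le_proj (hab : a ≤ b) (ha : a ≠ ⊤) (hb : b ≠ ⊥) (s : ℝ) :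
    a ≤ ((proj a b s : ℝ) : EReal) := by
  rw [coe_proj ha hb]
  exact le_min hab (le_max_left _ _)

lemma proj_le (ha : a ≠ ⊤) (hb : b ≠ ⊥) (s : ℝ) :
    ((proj a b s : ℝ) : EReal) ≤ b := by
  rw [coe_proj ha hb]
  exact min_le_left _ _

lemma proj_of_mem {s : ℝ} (h1 : a ≤ s) (h2 : (s : EReal) ≤ b) : proj a b s = s := by
  rw [proj, max_eq_right h1, min_eq_right h2, EReal.toReal_coe]

lemma le_proj_of_proj_lt (ha : a ≠ ⊤) (hb : b ≠ ⊥) {s : ℝ} (h : ((proj a b s : ℝ) : EReal) < b) :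
    s ≤ proj a b s := by
  rw [← EReal.coe_le_coe_iff]
  rw [coe_proj ha hb] at h ⊢
  rcases min_lt_iff.1 h with h | h
  · exact absurd h (lt_irrefl _)
  · rw [min_eq_right h.le]; exact le_max_right _ _

lemma proj_le_of_lt_proj (ha : a ≠ ⊤) (hb : b ≠ ⊥) {s : ℝ} (h : a < ((proj a b s : ℝ) : EReal)) :
    proj a b s ≤ s := by
  rw [← EReal.coe_le_coe_iff]
  rw [coe_proj ha hb] at h ⊢
  rcases lt_max_iff.1 (lt_min_iff.1 h).2 with h | h
  · exact absurd h (lt_irrefl _)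
  · rw [max_eq_right h.le]; exact min_le_right _ _

/-- The variational characterisation of the projection on an interval. -/
lemma mul_proj_nonpos (ha : a ≠ ⊤) (hb : b ≠ ⊥) (s : ℝ) {v : ℝ} (h1 : a ≤ v)
    (h2 : (v : EReal) ≤ b) : (s - proj a b s) * (v - proj a b s) ≤ 0 := by
  rcases lt_trichotomy (proj a b s) v with h | h | h
  · have : s ≤ proj a b s :=
      le_proj_of_proj_lt ha hb (lt_of_lt_of_le (EReal.coe_lt_coe_iff.2 h) h2)
    nlinarith
  · rw [h]; simp
  · have : proj a b s ≤ s :=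
      proj_le_of_lt_proj ha hb (lt_of_le_of_lt h1 (EReal.coe_lt_coe_iff.2 h))
    nlinarith

lemma abs_proj_sub_le (hab : a ≤ b) (ha : a ≠ ⊤) (hb : b ≠ ⊥) (s t : ℝ) :
    |proj a b s - proj a b t| ≤ |s - t| := by
  have h1 := mul_proj_nonpos ha hb s (le_proj hab ha hb t) (proj_le ha hb t)
  have h2 := mul_proj_nonpos ha hb t (le_proj hab ha hb s) (proj_le ha hb s)
  rw [← sq_le_sq]
  nlinarith [sq_nonneg ((s - t) - (proj a b s - proj a b t))]

lemma continuous_proj (hab : a ≤ b) (ha : a ≠ ⊤) (hb : b ≠ ⊥) : Continuous (proj a b) :=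
  (LipschitzWith.of_dist_le_mul (K := 1) fun s t => by
    simpa [Real.dist_eq] using abs_proj_sub_le hab ha hb s t).continuous

lemma minmod_nonneg (a b : EReal) : 0 ≤ minmod a b := by
  unfold minmod
  split_ifs
  · exact le_rfl
  · exact ENNReal.toReal_nonneg

lemma abs_proj_le (hab : a ≤ b) (ha : a ≠ ⊤) (hb : b ≠ ⊥) (s : ℝ) :
    |proj a b s| ≤ minmod a b + |s| := by
  by_cases h : a ≤ 0 ∧ 0 ≤ b
  · have h0 : proj a b 0 = 0 := proj_of_mem (by simpa using h.1) (by simpa using h.2)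
    have := abs_proj_sub_le hab ha hb s 0
    rw [h0, sub_zero, sub_zero] at this
    linarith [minmod_nonneg a b]
  · rw [not_and_or, not_le, not_le] at h
    rcases h with h | h
    · -- both bounds are positive
      have hb0 : 0 < b := h.trans_le hab
      lift a to ℝ using ⟨ha, (bot_lt_iff_ne_bot.1 (lt_trans EReal.bot_lt_zero h))⟩
      have ha0 : 0 < a := by exact_mod_cast h
      have hm : minmod a b = a := by
        rw [minmod, if_neg (not_le.2 (EReal.mul_pos h hb0))]
        have : ((a : ℝ) : EReal).abs ≤ b.abs := by
          induction b with
          | bot => exact absurd rfl hb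
          | top => simp
          | coe b =>
            rw [EReal.coe_le_coe_iff] at hab
            rw [EReal.abs_def, EReal.abs_def]
            exact ENNReal.ofReal_le_ofReal (abs_le_abs_of_nonneg ha0.le hab)
        rw [min_eq_left this, EReal.abs_def, ENNReal.toReal_ofReal (abs_nonneg _),
          abs_of_pos ha0]
      have h1 := le_proj hab ha hb s
      rw [EReal.coe_le_coe_iff] at h1
      have h2 : proj a b s ≤ max a s := by
        rw [← EReal.coe_le_coe_iff, coe_proj ha hb, EReal.coe_strictMono.monotone.map_max]
        exact min_le_right _ _
      rw [hm, abs_of_nonneg (ha0.le.trans h1)]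
      refine h2.trans (max_le (by linarith [abs_nonneg s]) (by linarith [le_abs_self s]))
    · -- both bounds are negative
      have ha0 : a < 0 := hab.trans_lt h
      lift b to ℝ using ⟨(lt_top_iff_ne_top.1 (lt_trans h EReal.zero_lt_top)), hb⟩
      have hb0 : b < 0 := by exact_mod_cast h
      have hm : minmod a b = -b := by
        rw [minmod, if_neg (not_le.2 (EReal.mul_pos_iff.2 (.inr ⟨ha0, h⟩)))]
        have : ((b : ℝ) : EReal).abs ≤ a.abs := by
          induction a with
          | top => exact absurd rfl ha
          | bot => simp
          | coe a =>
            rw [EReal.coe_le_coe_iff] at hab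
            rw [EReal.abs_def, EReal.abs_def]
            exact ENNReal.ofReal_le_ofReal (abs_le_abs_of_nonpos hb0.le hab)
        rw [min_eq_right this, EReal.abs_def, ENNReal.toReal_ofReal (abs_nonneg _),
          abs_of_neg hb0]
      have h1 := proj_le ha hb s
      rw [EReal.coe_le_coe_iff] at h1
      have h2 : min b s ≤ proj a b s := by
        rw [← EReal.coe_le_coe_iff, coe_proj ha hb, EReal.coe_strictMono.monotone.map_min]
        exact min_le_min le_rfl (le_max_right _ _)
      rw [hm, abs_of_nonpos (h1.trans hb0.le)]
      have h3 : min b s ≥ b - |s| :=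
        le_min (by linarith [abs_nonneg s]) (by linarith [neg_abs_le s])
      linarith

variable {β : Type*} [MeasurableSpace β] {μ : Measure β} [IsFiniteMeasure μ] [NeZero μ]
  {w : β → ℝ} {m : ℝ}

lemma average_le_of_ae_le (hw : Integrable w μ) (h : ∀ᵐ x ∂μ, w x ≤ m) : ⨍ x, w x ∂μ ≤ m := by
  calc ⨍ x, w x ∂μ ≤ ⨍ _, m ∂μ := by
        rw [average_eq, average_eq]
        exact smul_le_smul_of_nonneg_left (integral_mono_ae hw (integrable_const m) h)
          (by positivity)
    _ = m := average_const μ m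

lemma le_average_of_ae_le (hw : Integrable w μ) (h : ∀ᵐ x ∂μ, m ≤ w x) : m ≤ ⨍ x, w x ∂μ := by
  calc m = ⨍ _, m ∂μ := (average_const μ m).symm
    _ ≤ ⨍ x, w x ∂μ := by
        rw [average_eq, average_eq]
        exact smul_le_smul_of_nonneg_left (integral_mono_ae (integrable_const m) hw h)
          (by positivity)

/-- Projecting the average does not exceed an upper bound of the projected function. -/
lemma proj_average_le (hab : a ≤ b) (ha : a ≠ ⊤) (hb : b ≠ ⊥) (hw : Integrable w μ)
    (h : ∀ᵐ x ∂μ, proj a b (w x) ≤ m) : proj a b (⨍ x, w x ∂μ) ≤ m := by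
  rw [← EReal.coe_le_coe_iff]
  rcases le_or_gt b m with hbm | hbm
  · exact (proj_le ha hb _).trans hbm
  · have h1 : ∀ᵐ x ∂μ, w x ≤ m := h.mono fun x hx =>
      (le_proj_of_proj_lt ha hb (lt_of_le_of_lt (EReal.coe_le_coe_iff.2 hx) hbm)).trans hx
    obtain ⟨x, hx⟩ := h.exists
    have h2 : ⨍ x, w x ∂μ ≤ m := average_le_of_ae_le hw h1
    rw [coe_proj ha hb]
    exact (min_le_right _ _).trans (max_le ((le_proj hab ha hb _).trans
      (EReal.coe_le_coe_iff.2 hx)) (EReal.coe_le_coe_iff.2 h2))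

/-- Projecting the average does not go below a lower bound of the projected function. -/
lemma le_proj_average (hab : a ≤ b) (ha : a ≠ ⊤) (hb : b ≠ ⊥) (hw : Integrable w μ)
    (h : ∀ᵐ x ∂μ, m ≤ proj a b (w x)) : m ≤ proj a b (⨍ x, w x ∂μ) := by
  rw [← EReal.coe_le_coe_iff]
  rcases le_or_gt (m : EReal) a with ham | ham
  · exact ham.trans (le_proj hab ha hb _)
  · have h1 : ∀ᵐ x ∂μ, m ≤ w x := h.mono fun x hx =>
      hx.trans (proj_le_of_lt_proj ha hb (lt_of_lt_of_le ham (EReal.coe_le_coe_iff.2 hx)))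
    obtain ⟨x, hx⟩ := h.exists
    have h2 : m ≤ ⨍ x, w x ∂μ := le_average_of_ae_le hw h1
    rw [coe_proj ha hb]
    exact le_min ((EReal.coe_le_coe_iff.2 hx).trans (proj_le ha hb _))
      ((EReal.coe_le_coe_iff.2 h2).trans (le_max_right _ _))

end Proj

/-! ### Meshes and piecewise constant functions -/

section Mesh

variable {n : ℕ} {Ω : Set (Rn n)} {T : Finset (Set (Rn n))} {K : Set (Rn n)}

lemma IsPolytopal.isOpen (h : IsPolytopal K) : IsOpen K := by
  obtain ⟨F, rfl⟩ := h
  exact isOpen_interior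

/-- The boundary of a polytopal set is contained in the boundaries of its finitely many convex
pieces. -/
lemma IsPolytopal.volume_closure_diff (h : IsPolytopal K) : volume (closure K \ K) = 0 := by
  obtain ⟨F, hF⟩ := h
  set P : Finset (Rn n) → Set (Rn n) := fun s => convexHull ℝ (s : Set (Rn n)) with hP
  have hcl : IsClosed (⋃ s ∈ F, P s) :=
    F.finite_toSet.isClosed_biUnion fun s _ =>
      (s.finite_toSet.isCompact_convexHull (𝕜 := ℝ)).isClosed
  have h1 : closure K \ K ⊆ ⋃ s ∈ F, frontier (P s) := by
    rintro x ⟨hx, hxK⟩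
    have hx1 : x ∈ ⋃ s ∈ F, P s := by
      rw [hF] at hx
      exact closure_minimal interior_subset hcl hx
    simp only [mem_iUnion] at hx1
    obtain ⟨s, hs, hxs⟩ := hx1
    simp only [mem_iUnion]
    refine ⟨s, hs, subset_closure hxs, fun hxi => hxK ?_⟩
    rw [hF]
    exact interior_mono (subset_biUnion_of_mem (u := P) hs) hxi
  refine measure_mono_null h1 ((measure_biUnion_null_iff F.countable_toSet).2 fun s _ => ?_)
  exact (convex_convexHull ℝ _).addHaar_frontier volume

namespace IsMesh

lemma isOpen (hT : IsMesh Ω T) (hK : K ∈ T) : IsOpen K := (hT.polytopal K hK).isOpen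

lemma measurableSet (hT : IsMesh Ω T) (hK : K ∈ T) : MeasurableSet K := (hT.isOpen hK).measurableSet

lemma volume_ne_zero (hT : IsMesh Ω T) (hK : K ∈ T) : volume K ≠ 0 :=
  ((hT.isOpen hK).measure_pos volume (hT.nonempty K hK)).ne'

lemma neZero_restrict (hT : IsMesh Ω T) (hK : K ∈ T) : NeZero (volume.restrict K) :=
  ⟨by simpa using hT.volume_ne_zero hK⟩

lemma volume_ne_top (hT : IsMesh Ω T) (hΩ : volume Ω ≠ ⊤) (hK : K ∈ T) : volume K ≠ ⊤ :=
  ne_top_of_le_ne_top hΩ (measure_mono (hT.subset K hK))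

lemma isFiniteMeasure_restrict (hT : IsMesh Ω T) (hΩ : volume Ω ≠ ⊤) (hK : K ∈ T) :
    IsFiniteMeasure (volume.restrict K) :=
  MeasureTheory.isFiniteMeasure_restrict.2 (hT.volume_ne_top hΩ hK)

lemma restrict_le (hT : IsMesh Ω T) (hK : K ∈ T) : volume.restrict K ≤ volume.restrict Ω :=
  Measure.restrict_mono (hT.subset K hK) le_rfl

/-- The mesh covers the domain up to a null set. -/
lemma ae_eq_iUnion (hT : IsMesh Ω T) : (⋃ K ∈ T, K) =ᵐ[volume] Ω := by
  refine Filter.EventuallyLE.antisymm (LE.le.eventuallyLE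
    (iUnion₂_subset hT.subset)) ?_
  refine ae_le_set.2 (measure_mono_null (t := ⋃ K ∈ T, closure K \ K) ?_ ?_)
  · rintro x ⟨hx, hxK⟩
    have := hT.cover hx
    simp only [mem_iUnion] at this hxK ⊢
    obtain ⟨K, hK, hxc⟩ := this
    exact ⟨K, hK, hxc, fun h => hxK ⟨K, hK, h⟩⟩
  · exact (measure_biUnion_null_iff T.countable_toSet).2
      fun K hK => (hT.polytopal K hK).volume_closure_diff

lemma lintegral_eq_sum (hT : IsMesh Ω T) (f : Rn n → ℝ≥0∞) :
    ∫⁻ x in Ω, f x = ∑ K ∈ T, ∫⁻ x in K, f x := by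
  rw [← Measure.restrict_congr_set hT.ae_eq_iUnion]
  exact lintegral_biUnion_finset hT.disjoint (fun K hK => hT.measurableSet hK) f

lemma integral_eq_sum (hT : IsMesh Ω T) {f : Rn n → ℝ} (hf : IntegrableOn f Ω) :
    ∫ x in Ω, f x = ∑ K ∈ T, ∫ x in K, f x := by
  rw [← Measure.restrict_congr_set hT.ae_eq_iUnion]
  exact integral_biUnion_finset T (fun K hK => hT.measurableSet hK) hT.disjoint
    fun K hK => hf.mono_set (hT.subset K hK)

lemma ae_of_cells (hT : IsMesh Ω T) {Q : Rn n → Prop}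
    (h : ∀ K ∈ T, ∀ᵐ x ∂(volume.restrict K), Q x) : ∀ᵐ x ∂(volume.restrict Ω), Q x := by
  rw [← Measure.restrict_congr_set hT.ae_eq_iUnion,
    ae_restrict_biUnion_finset_iff]
  exact h

end IsMesh

/-- The function that takes the value `k K` on each cell `K`. -/
def cellConst (T : Finset (Set (Rn n))) (k : Set (Rn n) → ℝ) : Rn n → ℝ :=
  fun x => ∑ K ∈ T, K.indicator (fun _ => k K) x

lemma cellConst_apply (hT : IsMesh Ω T) (k : Set (Rn n) → ℝ) (hK : K ∈ T) {x : Rn n}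
    (hx : x ∈ K) : cellConst T k x = k K := by
  rw [cellConst, Finset.sum_eq_single_of_mem K hK]
  · simp [hx]
  · intro K' hK' hne
    have : x ∉ K' := fun hx' =>
      disjoint_left.1 (hT.disjoint hK' hK hne) hx' hx
    simp [this]

lemma cellConst_ae (hT : IsMesh Ω T) (k : Set (Rn n) → ℝ) (hK : K ∈ T) :
    ∀ᵐ x ∂(volume.restrict K), cellConst T k x = k K :=
  (ae_restrict_mem (hT.measurableSet hK)).mono fun _ hx => cellConst_apply hT k hK hx

lemma memLp_cellConst (hT : IsMesh Ω T) (hΩ : volume Ω ≠ ⊤) (k : Set (Rn n) → ℝ) :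
    MemLp (cellConst T k) 2 (volume.restrict Ω) := by
  have : IsFiniteMeasure (volume.restrict Ω) := isFiniteMeasure_restrict.2 hΩ
  exact memLp_finsetSum _ fun K hK => (memLp_const (k K)).indicator (hT.measurableSet hK)

/-- The piecewise constant function of values `k K`, as an element of `L²(Ω)`. -/
def cellL2 (hT : IsMesh Ω T) (hΩ : volume Ω ≠ ⊤) (k : Set (Rn n) → ℝ) : L2 Ω :=
  (memLp_cellConst hT hΩ k).toLp _

lemma coe_cellL2 (hT : IsMesh Ω T) (hΩ : volume Ω ≠ ⊤) (k : Set (Rn n) → ℝ) :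
    cellL2 hT hΩ k =ᵐ[volume.restrict Ω] cellConst T k :=
  MemLp.coeFn_toLp _

lemma cellL2_ae (hT : IsMesh Ω T) (hΩ : volume Ω ≠ ⊤) (k : Set (Rn n) → ℝ) (hK : K ∈ T) :
    ∀ᵐ x ∂(volume.restrict K), cellL2 hT hΩ k x = k K := by
  filter_upwards [cellConst_ae hT k hK, ae_mono (hT.restrict_le hK) (coe_cellL2 hT hΩ k)]
    with x h1 h2
  rw [h2, h1]

lemma integrableOn_cell (hT : IsMesh Ω T) (hΩ : volume Ω ≠ ⊤) (v : L2 Ω) (hK : K ∈ T) :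
    IntegrableOn v K := by
  have := hT.isFiniteMeasure_restrict hΩ hK
  exact ((Lp.memLp v).mono_measure (hT.restrict_le hK)).integrable (by norm_num)

lemma inner_eq_sum (hT : IsMesh Ω T) (v w : L2 Ω) :
    inner ℝ v w = ∑ K ∈ T, ∫ x in K, v x * w x := by
  rw [L2.inner_def, hT.integral_eq_sum]
  · refine Finset.sum_congr rfl fun K _ => integral_congr_ae (.of_forall fun x => ?_)
    simp [mul_comm]
  · exact L2.integrable_inner v w

lemma inner_cellL2 (hT : IsMesh Ω T) (hΩ : volume Ω ≠ ⊤) (k : Set (Rn n) → ℝ) (v : L2 Ω) :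
    inner ℝ (cellL2 hT hΩ k) v = ∑ K ∈ T, k K * ∫ x in K, v x := by
  rw [inner_eq_sum hT]
  refine Finset.sum_congr rfl fun K hK => ?_
  rw [← integral_const_mul]
  exact integral_congr_ae ((cellL2_ae hT hΩ k hK).mono fun x hx => by simp only [hx])

/-- The projection on piecewise constant functions, on `L²(Ω)`. -/
def cellAverage (hT : IsMesh Ω T) (hΩ : volume Ω ≠ ⊤) (v : L2 Ω) : L2 Ω :=
  cellL2 hT hΩ fun K => ⨍ y in K, v y

lemma coe_cellAverage (hT : IsMesh Ω T) (hΩ : volume Ω ≠ ⊤) (v : L2 Ω) :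
    cellAverage hT hΩ v =ᵐ[volume.restrict Ω] meshProj T v :=
  coe_cellL2 hT hΩ _

lemma integral_cellL2 (hT : IsMesh Ω T) (hΩ : volume Ω ≠ ⊤) (k : Set (Rn n) → ℝ) (hK : K ∈ T) :
    ∫ x in K, cellL2 hT hΩ k x = volume.real K * k K := by
  rw [integral_congr_ae (cellL2_ae hT hΩ k hK), setIntegral_const, smul_eq_mul]

lemma integral_cell_eq (hT : IsMesh Ω T) (hΩ : volume Ω ≠ ⊤) (v : L2 Ω) (hK : K ∈ T) :
    ∫ x in K, v x = volume.real K * ⨍ x in K, v x := by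
  have := hT.isFiniteMeasure_restrict hΩ hK
  rw [← measure_smul_average (volume.restrict K) v]
  simp

lemma integral_sub_cellAverage (hT : IsMesh Ω T) (hΩ : volume Ω ≠ ⊤) (v : L2 Ω) (hK : K ∈ T) :
    ∫ x in K, (v - cellAverage hT hΩ v : L2 Ω) x = 0 := by
  have h1 := ae_mono (hT.restrict_le hK) (Lp.coeFn_sub v (cellAverage hT hΩ v))
  rw [integral_congr_ae h1]
  simp only [Pi.sub_apply]
  rw [integral_sub (integrableOn_cell hT hΩ v hK) (integrableOn_cell hT hΩ _ hK),
    cellAverage, integral_cellL2 hT hΩ _ hK, integral_cell_eq hT hΩ v hK, sub_self]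

/-- `v - P_T v` is orthogonal to piecewise constant functions. -/
lemma inner_cellL2_sub_cellAverage (hT : IsMesh Ω T) (hΩ : volume Ω ≠ ⊤) (k : Set (Rn n) → ℝ)
    (v : L2 Ω) : inner ℝ (cellL2 hT hΩ k) (v - cellAverage hT hΩ v) = 0 := by
  rw [inner_cellL2]
  exact Finset.sum_eq_zero fun K hK => by rw [integral_sub_cellAverage hT hΩ v hK, mul_zero]

lemma exists_eq_cellL2 (hT : IsMesh Ω T) (hΩ : volume Ω ≠ ⊤) {v : L2 Ω} (hv : v ∈ Uh Ω T) :
    ∃ k : Set (Rn n) → ℝ, v = cellL2 hT hΩ k := by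
  classical
  choose! k hk using hv
  refine ⟨k, Lp.ext ?_⟩
  refine hT.ae_of_cells fun K hK => ?_
  filter_upwards [hk K hK, cellL2_ae hT hΩ k hK] with x h1 h2
  rw [h1, h2]

lemma cellL2_mem_Uh (hT : IsMesh Ω T) (hΩ : volume Ω ≠ ⊤) (k : Set (Rn n) → ℝ) :
    cellL2 hT hΩ k ∈ Uh Ω T := fun K hK => ⟨k K, cellL2_ae hT hΩ k hK⟩

lemma diam_le_meshSize (hK : K ∈ T) : Metric.diam K ≤ meshSize T :=
  le_csSup (T.finite_toSet.image _).bddAbove ⟨K, hK, rfl⟩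

lemma meshSize_nonneg (T : Finset (Set (Rn n))) : 0 ≤ meshSize T :=
  Real.sSup_nonneg (by rintro _ ⟨K, _, rfl⟩; exact Metric.diam_nonneg)

lemma IsMesh.centroid_mem (hT : IsMesh Ω T) (hK : K ∈ T) : centroid K ∈ K :=
  (hT.starShaped K hK).mem (hT.nonempty K hK)

lemma IsMesh.isBounded (hT : IsMesh Ω T) (hΩ : Bornology.IsBounded Ω) (hK : K ∈ T) :
    Bornology.IsBounded K := hΩ.subset (hT.subset K hK)

lemma norm_sub_le_meshSize (hT : IsMesh Ω T) (hΩ : Bornology.IsBounded Ω) (hK : K ∈ T)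
    {x y : Rn n} (hx : x ∈ K) (hy : y ∈ K) : ‖y - x‖ ≤ meshSize T := by
  rw [← dist_eq_norm]
  exact (Metric.dist_le_diam_of_mem (hT.isBounded hΩ hK) hy hx).trans (diam_le_meshSize hK)

/-- In a regular mesh, each cell contains a ball around its centroid, of radius comparable to its
diameter. -/
lemma exists_ball_of_isRegularMesh (hn : 0 < n) (hT : IsMesh Ω T) (hΩ : Bornology.IsBounded Ω)
    {η : ℝ} (hη : IsRegularMesh T η) (hK : K ∈ T) :
    ∃ ρ > 0, Metric.ball (centroid K) ρ ⊆ K ∧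
      ∀ x ∈ K, ‖x - centroid K‖ ≤ max 1 (2 * η) * ρ := by
  set R : Set ℝ := {r : ℝ | 0 < r ∧ Metric.ball (centroid K) r ⊆ K} with hR
  have hKb := hT.isBounded hΩ hK
  have hc := hT.centroid_mem hK
  obtain ⟨r₀, hr₀, hr₀K⟩ := Metric.isOpen_iff.1 (hT.isOpen hK) _ hc
  have hne : R.Nonempty := ⟨r₀, hr₀, hr₀K⟩
  have hbd : BddAbove R := by
    refine ⟨2 * Metric.diam K, ?_⟩
    rintro r ⟨hr, hrK⟩
    set e : Rn n := EuclideanSpace.single ⟨0, hn⟩ 1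
    have he : ‖(r / 2) • e‖ = r / 2 := by
      rw [norm_smul, Real.norm_of_nonneg (by linarith)]; simp [e]
    have h1 : centroid K + (r / 2) • e ∈ K := hrK (by
      rw [Metric.mem_ball, dist_eq_norm, add_sub_cancel_left, he]; linarith)
    have h2 := Metric.dist_le_diam_of_mem hKb h1 hc
    rw [dist_eq_norm, add_sub_cancel_left, he] at h2
    linarith
  have hρ : 0 < inradius K := hr₀.trans_le (le_csSup hbd ⟨hr₀, hr₀K⟩)
  obtain ⟨ρ, ⟨hρ0, hρK⟩, hρ2⟩ := exists_lt_of_lt_csSup hne (half_lt_self hρ)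
  refine ⟨ρ, hρ0, hρK, fun x hx => ?_⟩
  have h1 := (div_le_iff₀ hρ).1 (hη K hK)
  have hη0 : 0 ≤ η := (div_nonneg Metric.diam_nonneg hρ.le).trans (hη K hK)
  have h2 := Metric.dist_le_diam_of_mem hKb hx hc
  rw [dist_eq_norm] at h2
  have h3 : (inradius K / 2 : ℝ) < ρ := hρ2
  calc ‖x - centroid K‖ ≤ η * inradius K := h2.trans h1
    _ ≤ 2 * η * ρ := by nlinarith
    _ ≤ max 1 (2 * η) * ρ := by gcongr; exact le_max_right _ _

/-- The approximation of an `H¹` function by its averages on the cells. -/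
lemma norm_sub_cellAverage_le (hn : 0 < n) (hT : IsMesh Ω T) (hΩ : Bornology.IsBounded Ω)
    (hΩo : IsOpen Ω) (hΩf : volume Ω ≠ ⊤) {η : ℝ} (hη : IsRegularMesh T η) {u : L2 Ω}
    {G : Rn n → Rn n} (hG : HasWeakGrad Ω u G) (hG2 : MemLp G 2 (volume.restrict Ω)) :
    ‖u - cellAverage hT hΩf u‖ ≤
      Real.sqrt (9 * (4 * max 1 (2 * η)) ^ n) * meshSize T * l2Norm Ω G := by
  set Λ := max 1 (2 * η) with hΛ
  set h := meshSize T
  have hh : 0 ≤ h := meshSize_nonneg T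
  have hΛ1 : 1 ≤ Λ := le_max_left _ _
  have key : ∀ K ∈ T, ∫⁻ x in K, ‖(u - cellAverage hT hΩf u : L2 Ω) x‖ₑ ^ 2 ≤
      ENNReal.ofReal (9 * (4 * Λ) ^ n * h ^ 2) * ∫⁻ x in K, ‖G x‖ₑ ^ 2 := by
    intro K hK
    obtain ⟨ρ, hρ, hball, hΛρ⟩ := exists_ball_of_isRegularMesh hn hT hΩ hη hK
    have h1 := lintegral_sub_average_sq_le_grad (hT.isOpen hK) (hT.starShaped K hK)
      (hT.volume_ne_top hΩf hK) (integrableOn_cell hT hΩf u hK)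
      (hG.mono hΩo.measurableSet (hT.subset K hK))
      (hG2.1.mono_measure (hT.restrict_le hK)) hρ hΛ1 hball hΛρ
      (fun x hx => norm_sub_le_meshSize hT hΩ hK (hT.centroid_mem hK) hx)
      (fun x hx y hy => norm_sub_le_meshSize hT hΩ hK hx hy)
    refine le_trans (le_of_eq (lintegral_congr_ae ?_)) h1
    filter_upwards [ae_mono (hT.restrict_le hK) (Lp.coeFn_sub u (cellAverage hT hΩf u)),
      cellL2_ae hT hΩf (fun K => ⨍ y in K, u y) hK] with x h2 h3
    rw [h2, Pi.sub_apply, cellAverage, h3]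
  have h2 : eLpNorm (u - cellAverage hT hΩf u : L2 Ω) 2 (volume.restrict Ω) ^ 2 ≤
      ENNReal.ofReal (9 * (4 * Λ) ^ n * h ^ 2) * eLpNorm G 2 (volume.restrict Ω) ^ 2 := by
    rw [← lintegral_enorm_sq_eq, ← lintegral_enorm_sq_eq, hT.lintegral_eq_sum,
      hT.lintegral_eq_sum, Finset.mul_sum]
    exact Finset.sum_le_sum key
  have h3 := ENNReal.toReal_mono (ENNReal.mul_ne_top ENNReal.ofReal_ne_top
    (ENNReal.pow_ne_top hG2.2.ne)) h2
  rw [ENNReal.toReal_mul, ENNReal.toReal_pow, ENNReal.toReal_pow,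
    ENNReal.toReal_ofReal (by positivity), ← Lp.norm_def] at h3
  refine abs_le_of_sq_le_sq' ?_ (by have := l2Norm_nonneg (U := Ω) G; positivity) |>.2
  rw [mul_pow, mul_pow, Real.sq_sqrt (by positivity)]
  exact h3

end Mesh

/-! ### The diffusion form and gradient schemes -/

section Scheme

variable {n : ℕ} {Ω : Set (Rn n)} {A : Rn n → Matrix (Fin n) (Fin n) ℝ}

lemma memLp_component {E : Rn n → Rn n} (hE : MemLp E 2 (volume.restrict Ω)) (i : Fin n) :
    MemLp (fun x => E x i) 2 (volume.restrict Ω) :=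
  hE.of_le ((EuclideanSpace.proj (𝕜 := ℝ) i).continuous.comp_aestronglyMeasurable hE.1)
    (.of_forall fun x => PiLp.norm_apply_le (E x) i)

lemma mulVec_dotProduct_eq_sum (B : Matrix (Fin n) (Fin n) ℝ) (ξ ζ : Rn n) :
    (B *ᵥ ξ.ofLp) ⬝ᵥ ζ.ofLp = ∑ i, ∑ j, B i j * (ξ j * ζ i) := by
  simp only [dotProduct, Matrix.mulVec, Finset.sum_mul, mul_assoc]

lemma integrable_diffusion (hA : IsDiffusionMatrix Ω A) {G H : Rn n → Rn n}
    (hG : MemLp G 2 (volume.restrict Ω)) (hH : MemLp H 2 (volume.restrict Ω)) :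
    IntegrableOn (fun x => (A x *ᵥ (G x).ofLp) ⬝ᵥ (H x).ofLp) Ω := by
  obtain ⟨B, hB⟩ := hA.bounded
  simp only [mulVec_dotProduct_eq_sum]
  refine integrable_finsetSum _ fun i _ => integrable_finsetSum _ fun j _ => ?_
  refine Integrable.bdd_mul (c := B)
    (MemLp.integrable_mul (p := 2) (q := 2) (memLp_component hG j) (memLp_component hH i))
    (hA.measurable i j) ?_
  filter_upwards [hB] with x hx using hx i j

lemma diffusionForm_symm (hA : IsDiffusionMatrix Ω A) (G H : Rn n → Rn n) :
    diffusionForm Ω A G H = diffusionForm Ω A H G := by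
  refine integral_congr_ae (hA.symmetric.mono fun x hx => ?_)
  simp only [mulVec_dotProduct_eq_sum]
  rw [Finset.sum_comm]
  refine Finset.sum_congr rfl fun i _ => Finset.sum_congr rfl fun j _ => ?_
  rw [hx.apply]; ring

variable {X : Type*} [AddCommGroup X] [Module ℝ X] (D : GradientDiscretisation Ω X)

namespace GradientDiscretisation

lemma bilin_symm (hA : IsDiffusionMatrix Ω A) (v w : X) : D.bilin A v w = D.bilin A w v :=
  diffusionForm_symm hA _ _

lemma bilin_add_left (hA : IsDiffusionMatrix Ω A) (v v' w : X) :
    D.bilin A (v + v') w = D.bilin A v w + D.bilin A v' w := by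
  unfold bilin diffusionForm
  rw [← integral_add (integrable_diffusion hA (Lp.memLp _) (Lp.memLp _))
    (integrable_diffusion hA (Lp.memLp _) (Lp.memLp _)), map_add]
  refine integral_congr_ae ((Lp.coeFn_add (D.grad v) (D.grad v')).mono fun x hx => ?_)
  simp only [hx, Pi.add_apply, WithLp.ofLp_add, Matrix.mulVec_add, add_dotProduct]

lemma bilin_smul_left (r : ℝ) (v w : X) : D.bilin A (r • v) w = r * D.bilin A v w := by
  unfold bilin diffusionForm
  rw [← integral_const_mul, map_smul]
  refine integral_congr_ae ((Lp.coeFn_smul r (D.grad v)).mono fun x hx => ?_)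
  simp only [hx, Pi.smul_apply, WithLp.ofLp_smul, Matrix.mulVec_smul, smul_dotProduct, smul_eq_mul]

lemma bilin_sub_left (hA : IsDiffusionMatrix Ω A) (v v' w : X) :
    D.bilin A (v - v') w = D.bilin A v w - D.bilin A v' w := by
  have := D.bilin_add_left hA (v - v') v' w
  rw [sub_add_cancel] at this
  linarith

lemma coercive (hA : IsDiffusionMatrix Ω A) {lam : ℝ}
    (hlam : ∀ᵐ x ∂(volume.restrict Ω), ∀ ξ : Rn n,
      lam * ‖ξ‖ ^ 2 ≤ ξ.ofLp ⬝ᵥ (A x *ᵥ ξ.ofLp)) (v : X) :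
    lam * ‖D.grad v‖ ^ 2 ≤ D.bilin A v v := by
  have h1 : ‖D.grad v‖ ^ 2 = ∫ x in Ω, ‖D.grad v x‖ ^ 2 := by
    rw [← real_inner_self_eq_norm_sq, L2.inner_def]
    exact integral_congr_ae (.of_forall fun x => real_inner_self_eq_norm_sq _)
  rw [h1, ← integral_const_mul]
  refine integral_mono_ae ?_ (integrable_diffusion hA (Lp.memLp _) (Lp.memLp _)) ?_
  · exact ((Lp.memLp (D.grad v)).integrable_norm_pow (by norm_num)).const_mul lam
  · filter_upwards [hlam] with x hx
    rw [dotProduct_comm]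
    exact hx _

/-- The form `a_D`, as a linear map from `X` to its dual. -/
def toDualMap (hA : IsDiffusionMatrix Ω A) : X →ₗ[ℝ] Module.Dual ℝ X where
  toFun v :=
    { toFun := fun w => D.bilin A v w
      map_add' := fun w w' => by
        rw [D.bilin_symm hA, D.bilin_add_left hA, D.bilin_symm hA w, D.bilin_symm hA w']
      map_smul' := fun r w => by
        rw [D.bilin_symm hA, D.bilin_smul_left, D.bilin_symm hA w]; rfl }
  map_add' v v' := LinearMap.ext fun w => D.bilin_add_left hA v v' w
  map_smul' r v := LinearMap.ext fun w => D.bilin_smul_left r v w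

lemma exists_isSchemeSolution [FiniteDimensional ℝ X] (hA : IsDiffusionMatrix Ω A) (F : L2 Ω) :
    ∃ ψ : X, D.IsSchemeSolution A F ψ := by
  obtain ⟨lam, hlam0, hlam⟩ := hA.elliptic
  have hinj : Function.Injective (D.toDualMap hA) := by
    rw [injective_iff_map_eq_zero]
    intro v hv
    have h1 : D.bilin A v v = 0 := LinearMap.congr_fun hv v
    have h2 := D.coercive hA hlam v
    rw [h1] at h2
    apply D.eq_zero_of_grad
    have h3 : ‖D.grad v‖ ^ 2 ≤ 0 := by nlinarith [sq_nonneg ‖D.grad v‖]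
    exact pow_eq_zero_iff two_ne_zero |>.1 (le_antisymm h3 (sq_nonneg _))
  have hsurj : Function.Surjective (D.toDualMap hA) :=
    (LinearMap.injective_iff_surjective_of_finrank_eq_finrank
      Subspace.dual_finrank_eq.symm).1 hinj
  obtain ⟨ψ, hψ⟩ := hsurj ((innerₛₗ ℝ F).comp D.recon)
  exact ⟨ψ, fun w => LinearMap.congr_fun hψ w⟩

/-- The supremum that defines `C_D` is finite, since `X` is finite-dimensional. -/
lemma norm_recon_le [FiniteDimensional ℝ X] (v : X) :
    ‖D.recon v‖ ≤ D.coercivity * ‖D.grad v‖ := by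
  have hinj : Function.Injective D.grad := by
    rw [injective_iff_map_eq_zero]
    intro v hv
    exact D.eq_zero_of_grad v (by rw [hv, norm_zero])
  let e : X ≃ₗ[ℝ] LinearMap.range D.grad := LinearEquiv.ofInjective D.grad hinj
  let L : LinearMap.range D.grad →L[ℝ] L2 Ω :=
    LinearMap.toContinuousLinearMap (D.recon.comp e.symm.toLinearMap)
  have hL : ∀ w : X, ‖D.recon w‖ ≤ ‖L‖ * ‖D.grad w‖ := by
    intro w
    have h1 := L.le_opNorm (e w)
    have h2 : L (e w) = D.recon w := by simp [L]
    rw [h2] at h1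
    exact h1
  have hbd : BddAbove {r : ℝ | ∃ w : X, w ≠ 0 ∧ r = ‖D.recon w‖ / ‖D.grad w‖} := by
    refine ⟨‖L‖, ?_⟩
    rintro _ ⟨w, _, rfl⟩
    exact div_le_of_le_mul₀ (norm_nonneg _) L.opNorm_nonneg (hL w)
  by_cases hv : v = 0
  · simp [hv]
  · have hpos : 0 < ‖D.grad v‖ :=
      lt_of_le_of_ne (norm_nonneg _) fun h => hv (D.eq_zero_of_grad v h.symm)
    exact (div_le_iff₀ hpos).1 (le_csSup hbd ⟨v, hv, rfl⟩)

/-- Stability of gradient schemes, for a right-hand side that is bounded on the reconstructed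
functions only. -/
lemma IsSchemeSolution.norm_recon_le {D : GradientDiscretisation Ω X}
    (hA : IsDiffusionMatrix Ω A) {lam M κ : ℝ} (hlam0 : 0 < lam)
    (hlam : ∀ᵐ x ∂(volume.restrict Ω), ∀ ξ : Rn n,
      lam * ‖ξ‖ ^ 2 ≤ ξ.ofLp ⬝ᵥ (A x *ᵥ ξ.ofLp))
    (hM0 : 0 ≤ M) (hκ : 0 ≤ κ) (hM : ∀ v : X, ‖D.recon v‖ ≤ M * ‖D.grad v‖)
    {F : L2 Ω} {ψ : X} (hψ : D.IsSchemeSolution A F ψ)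
    (hF : ∀ w : X, |inner ℝ F (D.recon w)| ≤ κ * ‖D.grad w‖) :
    ‖D.recon ψ‖ ≤ M / lam * κ := by
  have h1 := D.coercive hA hlam ψ
  rw [hψ ψ] at h1
  have h2 := (le_abs_self _).trans (hF ψ)
  have h3 : ‖D.grad ψ‖ ≤ κ / lam := by
    rcases (norm_nonneg (D.grad ψ)).eq_or_lt with h0 | h0
    · rw [← h0]; positivity
    · rw [le_div_iff₀ hlam0]
      nlinarith
  calc ‖D.recon ψ‖ ≤ M * ‖D.grad ψ‖ := hM ψ
    _ ≤ M * (κ / lam) := by gcongr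
    _ = _ := by ring

lemma IsSchemeSolution.sub {D : GradientDiscretisation Ω X} (hA : IsDiffusionMatrix Ω A)
    {F F' : L2 Ω} {ψ ψ' : X} (h : D.IsSchemeSolution A F ψ) (h' : D.IsSchemeSolution A F' ψ') :
    D.IsSchemeSolution A (F - F') (ψ - ψ') := fun w => by
  rw [D.bilin_sub_left hA, h w, h' w, inner_sub_left]

end GradientDiscretisation

end Scheme

/-! ### The optimal control as a projection -/

section Control

variable {n : ℕ} {Ω : Set (Rn n)} {A : Rn n → Matrix (Fin n) (Fin n) ℝ} {T : Finset (Set (Rn n))}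
  {α : ℝ} {a b : EReal} {f yd ud y p u w : L2 Ω}

lemma h1Norm_congr {U : Set (Rn n)} {u v : Rn n → ℝ} (hU : IsOpen U) (hu : MemH1 U u)
    (huv : u =ᵐ[volume.restrict U] v) : h1Norm U u = h1Norm U v := by
  rw [h1Norm, h1Norm, eLpNorm_congr_ae huv,
    eLpNorm_congr_ae ((hu.hasWeakGrad.congr huv).weakGrad_ae_eq hU)]

lemma memLp_proj_comp (hΩf : volume Ω ≠ ⊤) (hab : a ≤ b) (ha : a ≠ ⊤) (hb : b ≠ ⊥) (w : L2 Ω) :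
    MemLp (fun x => proj a b (w x)) 2 (volume.restrict Ω) := by
  have : IsFiniteMeasure (volume.restrict Ω) := isFiniteMeasure_restrict.2 hΩf
  refine ((memLp_const (minmod a b)).add (Lp.memLp w).norm).of_le
    ((continuous_proj hab ha hb).comp_aestronglyMeasurable (Lp.memLp w).1)
    (.of_forall fun x => ?_)
  rw [Real.norm_eq_abs, Real.norm_eq_abs]
  exact (abs_proj_le hab ha hb (w x)).trans (le_abs_self _)

lemma l2Norm_proj_comp_le (hΩf : volume Ω ≠ ⊤) (hab : a ≤ b) (ha : a ≠ ⊤) (hb : b ≠ ⊥)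
    (w : L2 Ω) : l2Norm Ω (fun x => proj a b (w x)) ≤
      minmod a b * l2Norm Ω (fun _ => (1 : ℝ)) + ‖w‖ := by
  have : IsFiniteMeasure (volume.restrict Ω) := isFiniteMeasure_restrict.2 hΩf
  have h1 : MemLp (fun _ => minmod a b) 2 (volume.restrict Ω) := memLp_const _
  have h2 : MemLp (fun x => |w x|) 2 (volume.restrict Ω) := (Lp.memLp w).norm
  have h3 : l2Norm Ω (fun x => proj a b (w x)) ≤ l2Norm Ω (fun x => minmod a b + |w x|) := by
    refine ENNReal.toReal_mono (h1.add h2).2.ne (eLpNorm_mono fun x => ?_)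
    rw [Real.norm_eq_abs, Real.norm_eq_abs]
    exact (abs_proj_le hab ha hb (w x)).trans (le_abs_self _)
  have h4 := l2Norm_add_le h1 h2
  have h5 := l2Norm_const_smul (U := Ω) (fun _ => (1 : ℝ)) (minmod a b)
  simp only [smul_eq_mul, mul_one, abs_of_nonneg (minmod_nonneg a b)] at h5
  have h6 : l2Norm Ω (fun x => |w x|) = ‖w‖ := by
    rw [← l2Norm_coe, l2Norm, l2Norm]
    congr 1
    exact eLpNorm_norm (f := (w : Rn n → ℝ))
  linarith

/-- The variational inequality says that the control is the projection of `u_d - α⁻¹ p`. -/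
lemma IsOptimal.control_eq (hΩf : volume Ω ≠ ⊤) (hα : 0 < α) (hab : a ≤ b) (ha : a ≠ ⊤)
    (hb : b ≠ ⊥) (h : IsOptimal Ω A α a b f yd ud y p u) :
    u =ᵐ[volume.restrict Ω] fun x => proj a b ((ud - α⁻¹ • p : L2 Ω) x) := by
  set w : L2 Ω := ud - α⁻¹ • p with hw
  set v : L2 Ω := (memLp_proj_comp hΩf hab ha hb w).toLp _ with hv
  have hvx : v =ᵐ[volume.restrict Ω] fun x => proj a b (w x) := MemLp.coeFn_toLp _
  have hvU : v ∈ Uad Ω a b := by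
    filter_upwards [hvx] with x hx
    rw [hx]
    exact ⟨le_proj hab ha hb _, proj_le ha hb _⟩
  have h1 := h.control_ineq v hvU
  have e : p + α • (u - ud) = α • (u - w) := by
    rw [hw, smul_sub, smul_sub, smul_sub, smul_smul, mul_inv_cancel₀ hα.ne', one_smul]
    abel
  rw [e, inner_smul_left] at h1
  have h2 : 0 ≤ inner ℝ (u - w) (v - u) := nonneg_of_mul_nonneg_right h1 (by simpa using hα)
  have h3 : inner ℝ (w - v) (u - v) ≤ 0 := by
    rw [L2.inner_def]
    refine integral_nonpos_of_ae ?_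
    filter_upwards [hvx, Lp.coeFn_sub w v, Lp.coeFn_sub u v, h.control_mem] with x h1 h2 h3 h4
    rw [h2, h3, Pi.sub_apply, Pi.sub_apply, h1]
    have := mul_proj_nonpos ha hb (w x) h4.1 h4.2
    simpa [mul_comm] using this
  have h4 : inner ℝ (u - w) (v - u) = inner ℝ (w - v) (u - v) - ‖v - u‖ ^ 2 := by
    rw [← real_inner_self_eq_norm_sq]
    have : u - w = -(w - v) - (v - u) := by abel
    rw [this, inner_sub_left, inner_neg_left, ← inner_neg_right, neg_sub]
  have h5 : ‖v - u‖ ^ 2 ≤ 0 := by linarith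
  have h6 : v - u = 0 := norm_eq_zero.1 (pow_eq_zero_iff two_ne_zero |>.1
    (le_antisymm h5 (sq_nonneg _)))
  rw [← sub_eq_zero.1 h6]
  exact hvx

lemma memH1_sub_smul (hΩ : IsOpen Ω) (r : ℝ) (hud : MemH2 Ω ud) (hp : MemH2 Ω p) :
    MemH1 Ω (ud - r • p : L2 Ω) ∧
      l2Norm Ω (weakGrad Ω (ud - r • p : L2 Ω)) ≤ n * (h2Norm Ω ud + |r| * h2Norm Ω p) := by
  have h1 := hud.memH1 hΩ
  have h2 := (hp.memH1 hΩ).const_mul hΩ (-r)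
  have hae : (fun x => ud x + -r * p x) =ᵐ[volume.restrict Ω] (ud - r • p : L2 Ω) := by
    filter_upwards [Lp.coeFn_sub ud (r • p), Lp.coeFn_smul r p] with x h3 h4
    rw [h3, Pi.sub_apply, h4, Pi.smul_apply, smul_eq_mul]; ring
  refine ⟨(h1.add hΩ h2).congr hΩ hae, ?_⟩
  have h3 := (((h1.hasWeakGrad.add ((hp.memH1 hΩ).hasWeakGrad.const_smul (-r)))).congr
    hae).weakGrad_ae_eq hΩ
  rw [l2Norm_congr h3]
  refine (l2Norm_add_le (g := fun x => -r • weakGrad Ω p x) (h1.memLp_weakGrad hΩ)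
    (((hp.memH1 hΩ).memLp_weakGrad hΩ).const_smul (-r))).trans ?_
  rw [l2Norm_const_smul, abs_neg, mul_add]
  refine add_le_add (hud.l2Norm_weakGrad_le hΩ) ?_
  calc |r| * l2Norm Ω (weakGrad Ω p) ≤ |r| * (n * h2Norm Ω p) := by
        gcongr; exact hp.l2Norm_weakGrad_le hΩ
    _ = _ := by ring

/-- The optimal control belongs to `H¹(Ω)`. -/
lemma memH1_of_eq_proj (hΩ : IsOpen Ω) (hΩf : volume Ω ≠ ⊤) (hab : a ≤ b) (ha : a ≠ ⊤)
    (hb : b ≠ ⊥) (hw : MemH1 Ω w)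
    (hu : u =ᵐ[volume.restrict Ω] fun x => proj a b (w x)) :
    MemH1 Ω u ∧ l2Norm Ω (weakGrad Ω u) ≤ n * l2Norm Ω (weakGrad Ω w) ∧
      h1Norm Ω u ≤ minmod a b * l2Norm Ω (fun _ => (1 : ℝ)) + ‖w‖ +
        n * l2Norm Ω (weakGrad Ω w) := by
  have h2 := memLp_proj_comp hΩf hab ha hb w
  obtain ⟨H, hH, hH2, hHn⟩ := exists_hasWeakGrad_comp hΩ hΩf hw (abs_proj_sub_le hab ha hb) h2
  have hH' := hH.congr hu.symm
  have h3 := hH'.weakGrad_ae_eq hΩ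
  have h4 : l2Norm Ω (weakGrad Ω u) ≤ n * l2Norm Ω (weakGrad Ω w) := by
    rw [l2Norm_congr h3]; exact hHn
  refine ⟨⟨Lp.memLp u, H, hH', hH2⟩, h4, ?_⟩
  have h5 := l2Norm_proj_comp_le hΩf hab ha hb w
  rw [← l2Norm_congr hu] at h5
  linarith [h1Norm_le_add (U := Ω) (u := u)]

/-! ### A piecewise constant approximation of the optimal control -/

/-- The piecewise constant control `P_{[a,b]}(P_T w)`. -/
def cellControl (hT : IsMesh Ω T) (hΩf : volume Ω ≠ ⊤) (a b : EReal) (w : L2 Ω) : L2 Ω :=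
  cellL2 hT hΩf fun K => proj a b (⨍ x in K, w x)

lemma cellControl_mem (hT : IsMesh Ω T) (hΩf : volume Ω ≠ ⊤) (hab : a ≤ b) (ha : a ≠ ⊤)
    (hb : b ≠ ⊥) (w : L2 Ω) : cellControl hT hΩf a b w ∈ Uad Ω a b ∩ Uh Ω T := by
  refine ⟨hT.ae_of_cells fun K hK => ?_, cellL2_mem_Uh hT hΩf _⟩
  filter_upwards [cellL2_ae hT hΩf (fun K => proj a b (⨍ x in K, w x)) hK] with x hx
  rw [cellControl, hx]
  exact ⟨le_proj hab ha hb _, proj_le ha hb _⟩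

/-- The discrete variational inequality that characterises `P_{[a,b]}(P_T w)`. -/
lemma inner_cellControl_sub_nonneg (hT : IsMesh Ω T) (hΩf : volume Ω ≠ ⊤) (ha : a ≠ ⊤)
    (hb : b ≠ ⊥) (w : L2 Ω) {v : L2 Ω} (hv : v ∈ Uad Ω a b ∩ Uh Ω T) :
    0 ≤ inner ℝ (cellControl hT hΩf a b w - w) (v - cellControl hT hΩf a b w) := by
  obtain ⟨k, rfl⟩ := exists_eq_cellL2 hT hΩf hv.2
  set k' : Set (Rn n) → ℝ := fun K => proj a b (⨍ x in K, w x) with hk'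
  rw [cellControl, ← hk', real_inner_comm, inner_sub_left, inner_cellL2, inner_cellL2,
    ← Finset.sum_sub_distrib]
  refine Finset.sum_nonneg fun K hK => ?_
  have := hT.neZero_restrict hK
  have h1 : ∫ x in K, (cellL2 hT hΩf k' - w : L2 Ω) x =
      volume.real K * (k' K - ⨍ x in K, w x) := by
    rw [integral_congr_ae (ae_mono (hT.restrict_le hK) (Lp.coeFn_sub (cellL2 hT hΩf k') w))]
    simp only [Pi.sub_apply]
    rw [integral_sub (integrableOn_cell hT hΩf _ hK) (integrableOn_cell hT hΩf w hK),
      integral_cellL2 hT hΩf k' hK, integral_cell_eq hT hΩf w hK, mul_sub]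
  have hvK : ∀ᵐ x ∂(volume.restrict K), a ≤ ((cellL2 hT hΩf k x : ℝ) : EReal) ∧
      ((cellL2 hT hΩf k x : ℝ) : EReal) ≤ b := ae_mono (hT.restrict_le hK) hv.1
  obtain ⟨x, hx1, hx2⟩ := (hvK.and (cellL2_ae hT hΩf k hK)).exists
  rw [hx2] at hx1
  have h2 : ((⨍ x in K, w x) - k' K) * (k K - k' K) ≤ 0 :=
    mul_proj_nonpos ha hb (⨍ x in K, w x) hx1.1 hx1.2
  rw [h1, ← sub_mul]
  have h3 : 0 ≤ volume.real K := measureReal_nonneg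
  have h4 : (k K - k' K) * (volume.real K * (k' K - ⨍ x in K, w x)) =
      volume.real K * -(((⨍ x in K, w x) - k' K) * (k K - k' K)) := by ring
  rw [h4]
  exact mul_nonneg h3 (by linarith)

/-- Outside of the mixed cells, the approximate control is the average of the optimal control. -/
lemma average_eq_of_not_mixed (hT : IsMesh Ω T) (hΩf : volume Ω ≠ ⊤) (hab : a ≤ b) (ha : a ≠ ⊤)
    (hb : b ≠ ⊥) (hu : u =ᵐ[volume.restrict Ω] fun x => proj a b (w x)) {K : Set (Rn n)}
    (hK : K ∈ T) (hmix : K ∉ mixedCells T a b u) :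
    ⨍ x in K, u x = proj a b (⨍ x in K, w x) := by
  have := hT.neZero_restrict hK
  have := hT.isFiniteMeasure_restrict hΩf hK
  have huK : ∀ᵐ x ∂(volume.restrict K), u x = proj a b (w x) := ae_mono (hT.restrict_le hK) hu
  have hwi : Integrable w (volume.restrict K) := integrableOn_cell hT hΩf w hK
  have hconst : ∀ m : ℝ, (∀ᵐ x ∂(volume.restrict K), u x = m) →
      ⨍ x in K, u x = proj a b (⨍ x in K, w x) := by
    intro m hm
    have h1 : ∀ᵐ x ∂(volume.restrict K), proj a b (w x) = m := by
      filter_upwards [huK, hm] with x h1 h2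
      rw [← h1, h2]
    rw [average_congr hm, average_const]
    exact le_antisymm (le_proj_average hab ha hb hwi (h1.mono fun x hx => hx.ge))
      (proj_average_le hab ha hb hwi (h1.mono fun x hx => hx.le))
  have hcase : (∀ᵐ x ∂(volume.restrict K), ((u x : ℝ) : EReal) = a) ∨
    (∀ᵐ x ∂(volume.restrict K), ((u x : ℝ) : EReal) = b) ∨
    (∀ᵐ x ∂(volume.restrict K), a < ((u x : ℝ) : EReal) ∧ ((u x : ℝ) : EReal) < b) := by
    by_contra h
    exact hmix ⟨hK, h⟩
  rcases hcase with h | h | h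
  · exact hconst a.toReal (h.mono fun x hx => by rw [← hx, EReal.toReal_coe])
  · exact hconst b.toReal (h.mono fun x hx => by rw [← hx, EReal.toReal_coe])
  · have h1 : ∀ᵐ x ∂(volume.restrict K), u x = w x := by
      filter_upwards [h, huK] with x hx hxu
      rw [hxu] at hx ⊢
      exact le_antisymm (proj_le_of_lt_proj ha hb hx.1) (le_proj_of_proj_lt ha hb hx.2)
    rw [average_congr h1]
    refine (proj_of_mem ?_ ?_).symm
    · induction a with
      | bot => exact bot_le
      | top => exact absurd rfl ha
      | coe a =>
        rw [EReal.coe_le_coe_iff]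
        refine le_average_of_ae_le hwi ?_
        filter_upwards [h, h1] with x hx hx1
        rw [← hx1]
        exact (EReal.coe_lt_coe_iff.1 hx.1).le
    · induction b with
      | bot => exact absurd rfl hb
      | top => exact le_top
      | coe b =>
        rw [EReal.coe_le_coe_iff]
        refine average_le_of_ae_le hwi ?_
        filter_upwards [h, h1] with x hx hx1
        rw [← hx1]
        exact (EReal.coe_lt_coe_iff.1 hx.2).le

lemma brokenW1infNorm_nonneg (S : Set (Set (Rn n))) (v : Rn n → ℝ) : 0 ≤ brokenW1infNorm S v :=
  ENNReal.toReal_nonneg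

lemma ae_norm_weakGrad_le_brokenW1infNorm {S : Set (Set (Rn n))} (hS : S.Finite)
    (hSo : ∀ K ∈ S, IsOpen K) {v : Rn n → ℝ} (hv : MemBrokenW1inf S v) {K : Set (Rn n)}
    (hK : K ∈ S) :
    HasWeakGrad K v (weakGrad K v) ∧
      ∀ᵐ x ∂(volume.restrict K), ‖weakGrad K v x‖ ≤ brokenW1infNorm S v := by
  set g : Set (Rn n) → ℝ≥0∞ := fun K => eLpNorm v ⊤ (volume.restrict K) +
    eLpNorm (weakGrad K v) ⊤ (volume.restrict K) with hg
  have hfin : ∀ K ∈ S, g K ≠ ⊤ := by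
    intro K hK
    obtain ⟨h1, G, hG, hG2⟩ := hv K hK
    rw [hg]
    simp only
    rw [eLpNorm_congr_ae (hG.weakGrad_ae_eq (hSo K hK))]
    exact ENNReal.add_ne_top.2 ⟨h1.2.ne, hG2.2.ne⟩
  have hsup : ⨆ K ∈ S, g K ≠ ⊤ := by
    have hsum : ∑ K ∈ hS.toFinset, g K ≠ ⊤ :=
      ENNReal.sum_ne_top.2 fun K hK => hfin K (hS.mem_toFinset.1 hK)
    refine ne_top_of_le_ne_top hsum ?_
    exact iSup₂_le fun K hK =>
      Finset.single_le_sum (f := g) (fun _ _ => zero_le) (hS.mem_toFinset.2 hK)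
  obtain ⟨h1, G, hG, hG2⟩ := hv K hK
  refine ⟨weakGrad_spec ⟨G, hG⟩, ?_⟩
  have h2 : eLpNorm (weakGrad K v) ⊤ (volume.restrict K) ≤
      ENNReal.ofReal (brokenW1infNorm S v) := by
    rw [brokenW1infNorm, ENNReal.ofReal_toReal hsup]
    exact le_add_self.trans (le_iSup₂_of_le (f := fun K _ => g K) K hK le_rfl)
  rw [eLpNorm_exponent_top] at h2
  filter_upwards [ae_le_eLpNormEssSup (f := weakGrad K v) (μ := volume.restrict K)] with x hx
  have h3 := hx.trans h2
  rw [← ofReal_norm] at h3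
  exact (ENNReal.ofReal_le_ofReal_iff (brokenW1infNorm_nonneg S v)).1 h3

/-- On the mixed cells, the difference between the approximate control and the average of the
optimal control is at most twice the oscillation of the latter, hence of order `h`. -/
lemma abs_average_sub_le_of_mixed (hT : IsMesh Ω T) (hΩ : Bornology.IsBounded Ω)
    (hΩf : volume Ω ≠ ⊤) (hab : a ≤ b) (ha : a ≠ ⊤)
    (hb : b ≠ ⊥) (hu : u =ᵐ[volume.restrict Ω] fun x => proj a b (w x))
    (hreg : MemBrokenW1inf (mixedCells T a b u) u) {K : Set (Rn n)}
    (hK : K ∈ mixedCells T a b u) :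
    |(⨍ x in K, u x) - proj a b (⨍ x in K, w x)| ≤
      4 * meshSize T * brokenW1infNorm (mixedCells T a b u) u := by
  have hKT : K ∈ T := hK.1
  have hfin : (mixedCells T a b u).Finite := T.finite_toSet.subset fun K hK => hK.1
  have := hT.neZero_restrict hKT
  have := hT.isFiniteMeasure_restrict hΩf hKT
  obtain ⟨hG, hL⟩ := ae_norm_weakGrad_le_brokenW1infNorm hfin (fun K hK => hT.isOpen hK.1) hreg hK
  set L := brokenW1infNorm (mixedCells T a b u) u
  obtain ⟨S, hS, hosc⟩ := ae_dist_le_of_weakGrad_bounded (hT.isOpen hKT) (hT.starShaped K hKT)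
    (integrableOn_cell hT hΩf u hKT) hG (brokenW1infNorm_nonneg _ _) hL
    (fun x hx => norm_sub_le_meshSize hT hΩ hKT (hT.centroid_mem hKT) hx)
  obtain ⟨y, hy⟩ := hS.exists
  have huK : ∀ᵐ x ∂(volume.restrict K), u x = proj a b (w x) := ae_mono (hT.restrict_le hKT) hu
  have hui := integrableOn_cell hT hΩf u hKT
  have hwi := integrableOn_cell hT hΩf w hKT
  have h1 : ∀ᵐ x ∂(volume.restrict K), u x ≤ u y + 2 * meshSize T * L :=
    hS.mono fun x hx => by linarith [(abs_le.1 (hosc x hx y hy)).2]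
  have h2 : ∀ᵐ x ∂(volume.restrict K), u y - 2 * meshSize T * L ≤ u x :=
    hS.mono fun x hx => by linarith [(abs_le.1 (hosc x hx y hy)).1]
  have h3 := average_le_of_ae_le hui h1
  have h4 := le_average_of_ae_le hui h2
  have h5 := proj_average_le hab ha hb hwi
    ((h1.and huK).mono fun x hx => by rw [← hx.2]; exact hx.1)
  have h6 := le_proj_average hab ha hb hwi
    ((h2.and huK).mono fun x hx => by rw [← hx.2]; exact hx.1)
  rw [abs_le]
  constructor <;> linarith

end Control

/-! ### Testing the control error against reconstructed functions -/

section ControlError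

variable {n : ℕ} {Ω : Set (Rn n)} {T : Finset (Set (Rn n))} {a b : EReal} {u w : L2 Ω}

open Classical in
/-- The cells that are neither fully active nor fully inactive, as a finite set. -/
def mixedFinset (T : Finset (Set (Rn n))) (a b : EReal) (u : Rn n → ℝ) : Finset (Set (Rn n)) :=
  T.filter fun K => K ∈ mixedCells T a b u

lemma mem_mixedFinset {u : Rn n → ℝ} {K : Set (Rn n)} :
    K ∈ mixedFinset T a b u ↔ K ∈ mixedCells T a b u := by
  classical
  rw [mixedFinset, Finset.mem_filter]
  exact ⟨fun h => h.2, fun h => ⟨h.1, h⟩⟩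

lemma abs_inner_cellAverage_sub_le (hT : IsMesh Ω T) (hΩ : Bornology.IsBounded Ω)
    (hΩf : volume Ω ≠ ⊤) (hab : a ≤ b) (ha : a ≠ ⊤)
    (hb : b ≠ ⊥) (hu : u =ᵐ[volume.restrict Ω] fun x => proj a b (w x))
    (hreg : MemBrokenW1inf (mixedCells T a b u) u) (z : L2 Ω) :
    |inner ℝ (cellAverage hT hΩf u - cellControl hT hΩf a b w) z| ≤
      4 * meshSize T * brokenW1infNorm (mixedCells T a b u) u *
        ∫ x in ⋃ K ∈ mixedFinset T a b u, K, |z x| := by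
  set B := 4 * meshSize T * brokenW1infNorm (mixedCells T a b u) u with hB
  set S := mixedFinset T a b u with hS
  have hST : S ⊆ T := fun K hK => (mem_mixedFinset.1 hK).1
  have hdisj : (S : Set (Set (Rn n))).Pairwise (Function.onFun Disjoint fun K => K) :=
    hT.disjoint.subset (Finset.coe_subset.2 hST)
  rw [integral_biUnion_finset S (fun K hK => hT.measurableSet (hST hK)) hdisj
      fun K hK => (integrableOn_cell hT hΩf z (hST hK)).abs,
    cellAverage, cellControl, inner_sub_left, inner_cellL2, inner_cellL2, ← Finset.sum_sub_distrib,
    ← Finset.sum_subset hST, Finset.mul_sum]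
  · refine (Finset.abs_sum_le_sum_abs _ _).trans (Finset.sum_le_sum fun K hK => ?_)
    rw [← sub_mul, abs_mul]
    exact mul_le_mul (abs_average_sub_le_of_mixed hT hΩ hΩf hab ha hb hu hreg
      (mem_mixedFinset.1 hK)) (abs_integral_le_integral_abs) (abs_nonneg _)
      (mul_nonneg (mul_nonneg (by norm_num) (meshSize_nonneg T)) (brokenW1infNorm_nonneg _ _))
  · intro K hK hKS
    rw [average_eq_of_not_mixed hT hΩf hab ha hb hu hK fun h => hKS (mem_mixedFinset.2 h), sub_self]

/-- The mixed cells are contained in `Ω_{1,T}`, as they are open. -/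
lemma iUnion_mixedFinset_subset (hT : IsMesh Ω T) {u : Rn n → ℝ} :
    (⋃ K ∈ mixedFinset T a b u, K) ⊆ mixedRegion T a b u := by
  refine iUnion₂_subset fun K hK => ?_
  have hK' := mem_mixedFinset.1 hK
  exact interior_maximal (subset_closure.trans
    (subset_biUnion_of_mem (u := fun K => closure K) hK')) (hT.isOpen hK'.1)

lemma IsSobolevExponent.two_le {s : ℝ} (hn : n = 2 ∨ n = 3) (h : IsSobolevExponent n s) :
    2 ≤ s := by
  rcases h with h | ⟨h3, hs⟩
  · exact h.2
  · obtain rfl : n = 3 := by omega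
    norm_num at hs
    linarith

variable {X : Type*} [AddCommGroup X] [Module ℝ X] {D : GradientDiscretisation Ω X}

/-- Hölder's inequality on the mixed cells, whose total measure is of order `h`. -/
lemma integral_mixed_le (hT : IsMesh Ω T) {s c : ℝ} (hs : 2 ≤ s)
    (hsob : SobolevAssumption D s c) {u : Rn n → ℝ}
    (hmeas : volume (mixedRegion T a b u) ≤ ENNReal.ofReal (c * meshSize T)) (v : X) :
    ∫ x in ⋃ K ∈ mixedFinset T a b u, K, |D.recon v x| ≤
      |c| * ‖D.grad v‖ * (max 1 |c| * meshSize T ^ (1 - 1 / s)) := by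
  set V := ⋃ K ∈ mixedFinset T a b u, K with hV
  set h := meshSize T with hh
  have hh0 : 0 ≤ h := meshSize_nonneg T
  have hVΩ : V ⊆ Ω := iUnion₂_subset fun K hK => hT.subset K (mem_mixedFinset.1 hK).1
  have hVm : volume.restrict V ≤ volume.restrict Ω := Measure.restrict_mono hVΩ le_rfl
  have hs0 : 0 < s := by linarith
  have he0 : 0 ≤ 1 - 1 / s := by
    rw [sub_nonneg, div_le_one hs0]; linarith
  have he1 : 1 - 1 / s ≤ 1 := by
    have : 0 ≤ 1 / s := by positivity
    linarith
  have hm : AEStronglyMeasurable (D.recon v) (volume.restrict V) :=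
    (Lp.aestronglyMeasurable (D.recon v)).mono_measure hVm
  have h1 : eLpNorm (D.recon v) 1 (volume.restrict V) ≤
      ENNReal.ofReal (|c| * ‖D.grad v‖ * (|c| * h) ^ (1 - 1 / s)) := by
    calc eLpNorm (D.recon v) 1 (volume.restrict V)
        ≤ eLpNorm (D.recon v) (ENNReal.ofReal s) (volume.restrict V) *
            (volume.restrict V) univ ^
              (1 / (1 : ℝ≥0∞).toReal - 1 / (ENNReal.ofReal s).toReal) :=
          eLpNorm_le_eLpNorm_mul_rpow_measure_univ
            (by rw [← ENNReal.ofReal_one]; exact ENNReal.ofReal_le_ofReal (by linarith)) hm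
      _ ≤ ENNReal.ofReal (|c| * ‖D.grad v‖) * ENNReal.ofReal (|c| * h) ^ (1 - 1 / s) := by
          rw [Measure.restrict_apply_univ, ENNReal.toReal_ofReal hs0.le, ENNReal.toReal_one,
            div_one]
          refine mul_le_mul' ?_ (ENNReal.rpow_le_rpow ?_ he0)
          · refine (eLpNorm_mono_measure _ hVm).trans ((hsob v).trans
              (ENNReal.ofReal_le_ofReal ?_))
            gcongr; exact le_abs_self c
          · refine (measure_mono (iUnion_mixedFinset_subset hT)).trans (hmeas.trans
              (ENNReal.ofReal_le_ofReal ?_))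
            gcongr; exact le_abs_self c
      _ = _ := by
          rw [ENNReal.ofReal_rpow_of_nonneg (by positivity) he0, ← ENNReal.ofReal_mul
            (by positivity)]
  have h2 : ∫ x in V, |D.recon v x| ≤ |c| * ‖D.grad v‖ * (|c| * h) ^ (1 - 1 / s) := by
    have e : ∫ x in V, |D.recon v x| = (eLpNorm (D.recon v) 1 (volume.restrict V)).toReal := by
      rw [eLpNorm_one_eq_lintegral_enorm]
      exact integral_norm_eq_lintegral_enorm hm
    rw [e]
    exact ENNReal.toReal_le_of_le_ofReal (by positivity) h1
  refine h2.trans ?_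
  rw [Real.mul_rpow (abs_nonneg c) hh0]
  gcongr
  calc |c| ^ (1 - 1 / s) ≤ (max 1 |c|) ^ (1 - 1 / s) := by
        gcongr; exact le_max_right _ _
    _ ≤ (max 1 |c|) ^ (1 : ℝ) := Real.rpow_le_rpow_of_exponent_le (le_max_left _ _) he1
    _ = max 1 |c| := Real.rpow_one _

/-- The consistency error that results from replacing `u` by `P_{[a,b]}(P_T w)` in the
right-hand side of a gradient scheme. -/
lemma abs_inner_sub_cellControl_le (hn : n = 2 ∨ n = 3) (hT : IsMesh Ω T)
    (hΩ : Bornology.IsBounded Ω) (hΩo : IsOpen Ω)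
    (hΩf : volume Ω ≠ ⊤) {η : ℝ} (hη : IsRegularMesh T η) (hab : a ≤ b) (ha : a ≠ ⊤)
    (hb : b ≠ ⊥) (hu : u =ᵐ[volume.restrict Ω] fun x => proj a b (w x)) (huH : MemH1 Ω u)
    {s c : ℝ} (hs : IsSobolevExponent n s) (hsob : SobolevAssumption D s c)
    (hrec : ReconstructionAssumption D T c) (hact : ActiveSetAssumption T a b u c) (v : X) :
    |inner ℝ (u - cellControl hT hΩf a b w) (D.recon v)| ≤
      (Real.sqrt (9 * (4 * max 1 (2 * η)) ^ n) * |c| + 4 * |c| * max 1 |c|) *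
        (meshSize T ^ 2 * l2Norm Ω (weakGrad Ω u) + meshSize T ^ (2 - 1 / s) *
          brokenW1infNorm (mixedCells T a b u) u) * ‖D.grad v‖ := by
  have hs2 := hs.two_le hn
  have hn0 : 0 < n := by omega
  set h := meshSize T with hh
  have hh0 : 0 ≤ h := meshSize_nonneg T
  set z := D.recon v
  set N := ‖D.grad v‖
  have hN0 : 0 ≤ N := norm_nonneg _
  set L := brokenW1infNorm (mixedCells T a b u) u
  have hL0 : 0 ≤ L := brokenW1infNorm_nonneg _ _
  set g := l2Norm Ω (weakGrad Ω u)
  have hg0 : 0 ≤ g := l2Norm_nonneg _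
  set Q := Real.sqrt (9 * (4 * max 1 (2 * η)) ^ n)
  have hQ0 : 0 ≤ Q := Real.sqrt_nonneg _
  set uT := cellAverage hT hΩf u with huT
  set zT := cellAverage hT hΩf z with hzT
  have h1 : inner ℝ (u - cellControl hT hΩf a b w) z =
      inner ℝ (u - uT) (z - zT) + inner ℝ (uT - cellControl hT hΩf a b w) z := by
    have h2 : inner ℝ (u - uT) zT = 0 := by
      rw [real_inner_comm]
      exact inner_cellL2_sub_cellAverage hT hΩf _ u
    rw [inner_sub_right, h2, sub_zero, ← inner_add_left, sub_add_sub_cancel]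
  have h2 : ‖z - zT‖ ≤ |c| * h * N := by
    have h3 : eLpNorm (z - zT : L2 Ω) 2 (volume.restrict Ω) ≤ ENNReal.ofReal (|c| * h * N) := by
      refine le_trans (le_of_eq (eLpNorm_congr_ae ?_)) ((hrec v).trans
        (ENNReal.ofReal_le_ofReal ?_))
      · filter_upwards [Lp.coeFn_sub z zT, coe_cellAverage hT hΩf z] with x hx1 hx2
        rw [hx1, Pi.sub_apply, hx2]
      · gcongr; exact le_abs_self c
    rw [Lp.norm_def]
    exact ENNReal.toReal_le_of_le_ofReal (by positivity) h3
  have h3 : |inner ℝ (u - uT) (z - zT)| ≤ (Q * h * g) * (|c| * h * N) :=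
    (abs_real_inner_le_norm _ _).trans (mul_le_mul
      (norm_sub_cellAverage_le hn0 hT hΩ hΩo hΩf hη huH.hasWeakGrad (huH.memLp_weakGrad hΩo)) h2
      (norm_nonneg _) (by positivity))
  have h4 : |inner ℝ (uT - cellControl hT hΩf a b w) z| ≤
      4 * h * L * (|c| * N * (max 1 |c| * h ^ (1 - 1 / s))) :=
    (abs_inner_cellAverage_sub_le hT hΩ hΩf hab ha hb hu hact.regular z).trans
      (mul_le_mul_of_nonneg_left (integral_mixed_le hT hs2 hsob hact.measure_le v) (by positivity))
  have h5 : h * h ^ (1 - 1 / s) = h ^ (2 - 1 / s) := by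
    have he : 0 < 1 - 1 / s := by
      rw [sub_pos, div_lt_one (by linarith)]; linarith
    rw [show 2 - 1 / s = 1 + (1 - 1 / s) by ring,
      Real.rpow_add_of_nonneg hh0 zero_le_one he.le, Real.rpow_one]
  set H := h ^ (2 - 1 / s)
  have hH0 : 0 ≤ H := Real.rpow_nonneg hh0 _
  rw [h1]
  calc _ ≤ (Q * h * g) * (|c| * h * N) + 4 * h * L * (|c| * N * (max 1 |c| * h ^ (1 - 1 / s))) :=
        (abs_add_le _ _).trans (add_le_add h3 h4)
    _ = (Q * |c| * (h ^ 2 * g) + 4 * |c| * max 1 |c| * ((h * h ^ (1 - 1 / s)) * L)) * N := by ring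
    _ = (Q * |c| * (h ^ 2 * g) + 4 * |c| * max 1 |c| * (H * L)) * N := by rw [h5]
    _ ≤ _ := by
        refine mul_le_mul_of_nonneg_right ?_ hN0
        have e1 : 0 ≤ Q * |c| * (H * L) := by positivity
        have e2 : 0 ≤ 4 * |c| * max 1 |c| * (h ^ 2 * g) := by positivity
        nlinarith

end ControlError

/-! ### Error estimates for the control and the adjoint -/

section Estimate

variable {n : ℕ} {Ω : Set (Rn n)} {A : Rn n → Matrix (Fin n) (Fin n) ℝ} {T : Finset (Set (Rn n))}
  {α : ℝ} {a b : EReal} {f yd ud y p u : L2 Ω}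
  {X : Type*} [AddCommGroup X] [Module ℝ X] {D : GradientDiscretisation Ω X}

/-- Piecewise constant functions do not see the difference between `p` and `p_T`, up to `h²`. -/
lemma abs_inner_sub_interpolation_le {R : L2 Ω → L2 Ω} {c : ℝ} (hT : IsMesh Ω T)
    (hΩf : volume Ω ≠ ⊤) (hR : InterpolationAssumption D A T R c) (hp : MemH2 Ω p)
    {v v' : L2 Ω} (hv : v ∈ Uh Ω T) (hv' : v' ∈ Uh Ω T) :
    |inner ℝ (p - R p) (v - v')| ≤ |c| * meshSize T ^ 2 * h2Norm Ω p * ‖v - v'‖ := by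
  set z := p - R p
  set zT := cellAverage hT hΩf z
  have hh0 := meshSize_nonneg T
  have hp0 : 0 ≤ h2Norm Ω p := h2Norm_nonneg
  have horth : ∀ v ∈ Uh Ω T, inner ℝ v (z - zT) = 0 := by
    intro v hv
    obtain ⟨k, rfl⟩ := exists_eq_cellL2 hT hΩf hv
    exact inner_cellL2_sub_cellAverage hT hΩf k z
  have h1 : inner ℝ z (v - v') = inner ℝ zT (v - v') := by
    have : inner ℝ (v - v') (z - zT) = 0 := by
      rw [inner_sub_left, horth v hv, horth v' hv', sub_zero]
    rw [inner_sub_right, sub_eq_zero] at this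
    rw [real_inner_comm, this, real_inner_comm]
  have h2 : ‖zT‖ ≤ |c| * meshSize T ^ 2 * h2Norm Ω p := by
    rw [Lp.norm_def]
    refine ENNReal.toReal_le_of_le_ofReal (by positivity) ?_
    rw [eLpNorm_congr_ae (coe_cellAverage hT hΩf z)]
    refine (hR.proj p hp).trans (ENNReal.ofReal_le_ofReal ?_)
    gcongr; exact le_abs_self c
  rw [h1]
  exact (abs_real_inner_le_norm _ _).trans (mul_le_mul_of_nonneg_right h2 (norm_nonneg _))

/-- The error on the adjoint state, given a bound `E` of the consistency error that results
from replacing the optimal control `u` by an admissible piecewise constant control `û` that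
satisfies the projected variational inequality. The two solutions `ŷ`, `p̂` of the
gradient schemes with control `û` are compared on the one hand to the continuous solutions, and on
the other hand to the discrete ones; for the latter comparison, the two variational inequalities
are added, and the contribution of `p̂ - p_D` has a sign. -/
lemma norm_interpolation_sub_recon_le [FiniteDimensional ℝ X] {R : L2 Ω → L2 Ω}
    {c lam M E : ℝ} {yD pD : X} {uh û : L2 Ω} (hT : IsMesh Ω T)
    (hΩf : volume Ω ≠ ⊤) (hA : IsDiffusionMatrix Ω A) (hlam0 : 0 < lam)
    (hlam : ∀ᵐ x ∂(volume.restrict Ω), ∀ ξ : Rn n,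
      lam * ‖ξ‖ ^ 2 ≤ ξ.ofLp ⬝ᵥ (A x *ᵥ ξ.ofLp))
    (hM0 : 0 ≤ M) (hM : ∀ v : X, ‖D.recon v‖ ≤ M * ‖D.grad v‖) (hα : 0 < α)
    (hopt : IsOptimal Ω A α a b f yd ud y p u)
    (hdis : IsDiscreteOptimal D A T α a b f yd ud yD pD uh)
    (hR : InterpolationAssumption D A T R c)
    (hfu : MemH1 Ω (f + u : L2 Ω)) (hyyd : MemH1 Ω (y - yd : L2 Ω))
    (hy : MemH2 Ω y) (hp : MemH2 Ω p)
    (hû : û ∈ Uad Ω a b ∩ Uh Ω T) (hvi : 0 ≤ inner ℝ (p + α • (û - ud)) (uh - û))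
    (hE0 : 0 ≤ E) (hE : ∀ v : X, |inner ℝ (u - û) (D.recon v)| ≤ E * ‖D.grad v‖)
    {E₃ : ℝ} (hE₃ : E₃ = M / lam * (M * (M / lam * E +
        |c| * meshSize T ^ 2 * h1Norm Ω (f + u : L2 Ω)) + |c| * meshSize T ^ 2 * h2Norm Ω y * M) +
      |c| * meshSize T ^ 2 * h1Norm Ω (y - yd : L2 Ω)) :
    ‖R p - D.recon pD‖ ≤ E₃ +
      (M / lam * M) ^ 2 * (α⁻¹ * (E₃ + |c| * meshSize T ^ 2 * h2Norm Ω p)) := by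
  have hh0 := meshSize_nonneg T
  set h := meshSize T
  have hy0 : 0 ≤ h2Norm Ω y := h2Norm_nonneg
  have hp0 : 0 ≤ h2Norm Ω p := h2Norm_nonneg
  have hfu0 : 0 ≤ h1Norm Ω (f + u : L2 Ω) := h1Norm_nonneg
  have hyy0 : 0 ≤ h1Norm Ω (y - yd : L2 Ω) := h1Norm_nonneg
  set F1 := |c| * h ^ 2 * h1Norm Ω (f + u : L2 Ω) with hF1
  have hF10 : 0 ≤ F1 := by positivity
  have hcle : ∀ t : ℝ, 0 ≤ t → c * h ^ 2 * t ≤ |c| * h ^ 2 * t := fun t ht => by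
    gcongr; exact le_abs_self c
  -- the auxiliary discrete states
  obtain ⟨ys, hys⟩ := D.exists_isSchemeSolution hA (f + u)
  obtain ⟨yhat, hyhat⟩ := D.exists_isSchemeSolution hA (f + û)
  obtain ⟨ps, hps⟩ := D.exists_isSchemeSolution hA (y - yd)
  obtain ⟨phat, hphat⟩ := D.exists_isSchemeSolution hA (D.recon yhat - yd)
  have hyD : D.IsSchemeSolution A (f + uh) yD := hdis.state_eq
  have hpD : D.IsSchemeSolution A (D.recon yD - yd) pD := fun w => by
    rw [D.bilin_symm hA]; exact hdis.adjoint_eq w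
  -- approximation of the state
  have h1 : ‖D.recon (ys - yhat)‖ ≤ M / lam * E := by
    refine (hys.sub hA hyhat).norm_recon_le hA hlam0 hlam hM0 hE0 hM fun v => ?_
    rw [add_sub_add_left_eq_sub]
    exact hE v
  have h2 : ‖D.recon ys - R y‖ ≤ F1 :=
    (hR.superconv y (f + u) hy hfu ⟨hopt.state_mem, hopt.state_eq⟩ ys hys).trans (hcle _ hfu0)
  set E₂ := M * (M / lam * E + F1) + |c| * h ^ 2 * h2Norm Ω y * M with hE₂
  have hE₂0 : 0 ≤ E₂ := by positivity
  -- approximation of the adjoint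
  have h3 : ‖D.recon (ps - phat)‖ ≤ M / lam * E₂ := by
    refine (hps.sub hA hphat).norm_recon_le hA hlam0 hlam hM0 hE₂0 hM fun v => ?_
    have e : y - yd - (D.recon yhat - yd) =
        (y - R y) - ((D.recon ys - R y) - D.recon (ys - yhat)) := by
      rw [map_sub]; abel
    rw [e, inner_sub_left]
    have h4 := (hR.inner_recon y hy v).trans (mul_le_mul_of_nonneg_right (hcle _ hy0)
      (norm_nonneg _))
    have h5 : |inner ℝ ((D.recon ys - R y) - D.recon (ys - yhat)) (D.recon v)| ≤
        (F1 + M / lam * E) * ‖D.recon v‖ :=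
      (abs_real_inner_le_norm _ _).trans (mul_le_mul_of_nonneg_right
        ((norm_sub_le _ _).trans (add_le_add h2 h1)) (norm_nonneg _))
    have h6 : 0 ≤ |c| * h ^ 2 * h2Norm Ω y + (F1 + M / lam * E) := by positivity
    calc _ ≤ |c| * h ^ 2 * h2Norm Ω y * ‖D.recon v‖ + (F1 + M / lam * E) * ‖D.recon v‖ :=
          (abs_sub _ _).trans (add_le_add h4 h5)
      _ = (|c| * h ^ 2 * h2Norm Ω y + (F1 + M / lam * E)) * ‖D.recon v‖ := by ring
      _ ≤ (|c| * h ^ 2 * h2Norm Ω y + (F1 + M / lam * E)) * (M * ‖D.grad v‖) :=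
          mul_le_mul_of_nonneg_left (hM v) h6
      _ = E₂ * ‖D.grad v‖ := by rw [hE₂]; ring
  have h4 : ‖D.recon ps - R p‖ ≤ |c| * h ^ 2 * h1Norm Ω (y - yd : L2 Ω) := by
    refine (hR.superconv p (y - yd) hp hyyd ⟨hopt.adjoint_mem, fun v hv => ?_⟩ ps hps).trans
      (hcle _ hyy0)
    rw [← hopt.adjoint_eq v hv]
    exact diffusionForm_symm hA _ _
  have h5 : ‖D.recon phat - R p‖ ≤ E₃ := by
    have e : D.recon phat - R p = (D.recon ps - R p) - D.recon (ps - phat) := by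
      rw [map_sub]; abel
    rw [e, hE₃]
    exact (norm_sub_le _ _).trans (by linarith)
  -- stability of the discrete adjoint with respect to the control
  have h6 : ‖D.recon (yhat - yD)‖ ≤ M / lam * M * ‖û - uh‖ := by
    rw [mul_assoc]
    refine (hyhat.sub hA hyD).norm_recon_le hA hlam0 hlam hM0 (by positivity) hM fun v => ?_
    rw [add_sub_add_left_eq_sub]
    calc _ ≤ ‖û - uh‖ * ‖D.recon v‖ := abs_real_inner_le_norm _ _
      _ ≤ ‖û - uh‖ * (M * ‖D.grad v‖) := by gcongr; exact hM v
      _ = _ := by ring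
  have h7 : ‖D.recon (phat - pD)‖ ≤ (M / lam * M) ^ 2 * ‖û - uh‖ := by
    have e : (M / lam * M) ^ 2 * ‖û - uh‖ = M / lam * (M * (M / lam * M * ‖û - uh‖)) := by ring
    rw [e]
    refine (hphat.sub hA hpD).norm_recon_le hA hlam0 hlam hM0 (by positivity) hM fun v => ?_
    rw [sub_sub_sub_cancel_right, ← map_sub]
    calc _ ≤ ‖D.recon (yhat - yD)‖ * ‖D.recon v‖ := abs_real_inner_le_norm _ _
      _ ≤ (M / lam * M * ‖û - uh‖) * (M * ‖D.grad v‖) :=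
          mul_le_mul h6 (hM v) (norm_nonneg _) (by positivity)
      _ = _ := by ring
  -- the contribution of the discrete adjoints has a sign
  have h8 : inner ℝ (D.recon pD - D.recon phat) (û - uh) ≤ 0 := by
    have e1 := (hyhat.sub hA hyD) (pD - phat)
    have e2 := (hpD.sub hA hphat) (yhat - yD)
    rw [add_sub_add_left_eq_sub] at e1
    rw [D.bilin_symm hA, e1, sub_sub_sub_cancel_right] at e2
    rw [← map_sub, real_inner_comm, e2]
    have e3 : D.recon yD - D.recon yhat = -D.recon (yhat - yD) := by rw [map_sub]; abel
    rw [e3, inner_neg_left, real_inner_self_eq_norm_sq]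
    linarith [sq_nonneg ‖D.recon (yhat - yD)‖]
  -- estimate of the control
  have h9 : ‖û - uh‖ ≤ α⁻¹ * (E₃ + |c| * h ^ 2 * h2Norm Ω p) := by
    have e1 := hdis.control_ineq û hû
    have e2 : inner ℝ (D.recon pD + α • (uh - ud)) (û - uh) +
        inner ℝ (p + α • (û - ud)) (uh - û) =
        inner ℝ (D.recon pD - D.recon phat) (û - uh) + inner ℝ (D.recon phat - R p) (û - uh) -
          inner ℝ (p - R p) (û - uh) - α * ‖û - uh‖ ^ 2 := by
      rw [← neg_sub û uh, inner_neg_right, ← sub_eq_add_neg, ← inner_sub_left,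
        ← real_inner_self_eq_norm_sq, ← real_inner_smul_left, ← inner_add_left, ← inner_sub_left,
        ← inner_sub_left]
      congr 1
      module
    have e3 : inner ℝ (D.recon phat - R p) (û - uh) ≤ E₃ * ‖û - uh‖ :=
      (real_inner_le_norm _ _).trans (mul_le_mul_of_nonneg_right h5 (norm_nonneg _))
    have e4 := (abs_le.1 (abs_inner_sub_interpolation_le hT hΩf hR hp hû.2
      hdis.control_mem.2)).1
    have e5 : α * ‖û - uh‖ ^ 2 ≤ (E₃ + |c| * h ^ 2 * h2Norm Ω p) * ‖û - uh‖ := by linarith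
    have hE₃0 : 0 ≤ E₃ := (norm_nonneg _).trans h5
    rcases (norm_nonneg (û - uh)).eq_or_lt with h0 | h0
    · rw [← h0]; positivity
    · rw [le_inv_mul_iff₀ hα]
      refine le_of_mul_le_mul_right ?_ h0
      linarith
  have e : R p - D.recon pD = D.recon (phat - pD) - (D.recon phat - R p) := by
    rw [map_sub]; abel
  rw [e]
  calc _ ≤ ‖D.recon (phat - pD)‖ + ‖D.recon phat - R p‖ := norm_sub_le _ _
    _ ≤ (M / lam * M) ^ 2 * ‖û - uh‖ + E₃ := add_le_add h7 h5
    _ ≤ (M / lam * M) ^ 2 * (α⁻¹ * (E₃ + |c| * h ^ 2 * h2Norm Ω p)) + E₃ := by gcongr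
    _ = _ := add_comm _ _

/-- The post-processing is Lipschitz with respect to the adjoint state. -/
lemma eLpNorm_postProcess_sub_le (hα : 0 < α) (hab : a ≤ b) (ha : a ≠ ⊤) (hb : b ≠ ⊥)
    (q r : L2 Ω) :
    eLpNorm (fun x => postProcess T α a b ud q x - postProcess T α a b ud r x) 2
      (volume.restrict Ω) ≤ ENNReal.ofReal (α⁻¹ * ‖q - r‖) := by
  have h1 : ENNReal.ofReal (α⁻¹ * ‖q - r‖) =
      ENNReal.ofReal α⁻¹ * eLpNorm (q - r : L2 Ω) 2 (volume.restrict Ω) := by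
    rw [ENNReal.ofReal_mul (by positivity), Lp.norm_def, ENNReal.ofReal_toReal (Lp.eLpNorm_ne_top _)]
  rw [h1]
  refine eLpNorm_le_mul_eLpNorm_of_ae_le_mul ?_ 2
  filter_upwards [Lp.coeFn_sub q r] with x hx
  rw [hx, Pi.sub_apply, Real.norm_eq_abs, Real.norm_eq_abs]
  refine (abs_proj_sub_le hab ha hb _ _).trans_eq ?_
  rw [← abs_of_pos (inv_pos.2 hα), ← abs_mul, abs_sub_comm]
  congr 1
  rw [abs_of_pos (inv_pos.2 hα)]; ring

end Estimate

end GDM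

/-! ### Collecting the constants -/

namespace GDM

/-- Every norm that enters the error estimate is bounded by the data. -/
lemma IsOptimal.norms_le {n : ℕ} {Ω : Set (Rn n)} {A : Rn n → Matrix (Fin n) (Fin n) ℝ}
    {α : ℝ} {a b : EReal} {f yd ud y p u : L2 Ω} (hΩ : IsOpen Ω) (hΩf : volume Ω ≠ ⊤)
    (hα : 0 < α) (hab : a ≤ b) (ha : a ≠ ⊤) (hb : b ≠ ⊥)
    (hopt : IsOptimal Ω A α a b f yd ud y p u)
    (hud : MemH2 Ω ud) (hy : MemH2 Ω y) (hp : MemH2 Ω p) (hyd : MemH1 Ω yd) (hf : MemH1 Ω f) :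
    MemH1 Ω u ∧ MemH1 Ω (f + u : L2 Ω) ∧ MemH1 Ω (y - yd : L2 Ω) ∧
      l2Norm Ω (weakGrad Ω u) ≤ n ^ 2 * ((1 + α⁻¹) * dataTerm Ω a b yd ud f y p) ∧
      h1Norm Ω (f + u : L2 Ω) ≤ (2 + 2 * (l2Norm Ω (fun _ => (1 : ℝ)) + 1 + n ^ 2)) *
        ((1 + α⁻¹) * dataTerm Ω a b yd ud f y p) ∧
      h1Norm Ω (y - yd : L2 Ω) ≤ (2 * n + 4) * ((1 + α⁻¹) * dataTerm Ω a b yd ud f y p) := by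
  set V := l2Norm Ω (fun _ => (1 : ℝ))
  have hV0 : 0 ≤ V := l2Norm_nonneg _
  have hi0 : 0 < α⁻¹ := inv_pos.2 hα
  have m0 := minmod_nonneg a b
  have n1 := h1Norm_nonneg (U := Ω) (u := yd)
  have n2 := h2Norm_nonneg (U := Ω) (u := ud)
  have n3 := h1Norm_nonneg (U := Ω) (u := f)
  have n4 := h2Norm_nonneg (U := Ω) (u := y)
  have n5 := h2Norm_nonneg (U := Ω) (u := p)
  set DT := dataTerm Ω a b yd ud f y p with hDT
  have hDTe : DT = minmod a b + h1Norm Ω yd + h2Norm Ω ud + h1Norm Ω f + h2Norm Ω y +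
    h2Norm Ω p := rfl
  have hDT0 : 0 ≤ DT := by rw [hDTe]; positivity
  set Z := (1 + α⁻¹) * DT with hZ
  have hDZ : DT ≤ Z := by rw [hZ]; nlinarith
  have hupZ : h2Norm Ω ud + α⁻¹ * h2Norm Ω p ≤ Z := by
    have : h2Norm Ω p ≤ DT := by linarith
    have := mul_le_mul_of_nonneg_left this hi0.le
    rw [hZ]; linarith
  have hu := hopt.control_eq hΩf hα hab ha hb
  obtain ⟨hw, hwg⟩ := memH1_sub_smul hΩ α⁻¹ hud hp
  obtain ⟨huH, hug, hun⟩ := memH1_of_eq_proj hΩ hΩf hab ha hb hw hu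
  rw [abs_of_pos hi0] at hwg
  have hwn : ‖ud - α⁻¹ • p‖ ≤ Z := by
    have h1 := l2Norm_le_h2Norm (U := Ω) (u := ud)
    have h2 := l2Norm_le_h2Norm (U := Ω) (u := p)
    rw [l2Norm_coe] at h1 h2
    refine (norm_sub_le _ _).trans ?_
    rw [norm_smul, Real.norm_of_nonneg hi0.le]
    have := mul_le_mul_of_nonneg_left h2 hi0.le
    linarith
  have hwg' : n * l2Norm Ω (weakGrad Ω (ud - α⁻¹ • p : L2 Ω)) ≤ n ^ 2 * Z := by
    calc _ ≤ (n : ℝ) * (n * (h2Norm Ω ud + α⁻¹ * h2Norm Ω p)) := by gcongr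
      _ ≤ (n : ℝ) * (n * Z) := by gcongr
      _ = _ := by ring
  have hfu : (fun x => f x + u x) =ᵐ[volume.restrict Ω] (f + u : L2 Ω) :=
    (Lp.coeFn_add f u).symm
  have hyy : (fun x => y x + -1 * yd x) =ᵐ[volume.restrict Ω] (y - yd : L2 Ω) := by
    filter_upwards [Lp.coeFn_sub y yd] with x hx
    rw [hx, Pi.sub_apply]; ring
  have hfuH := hf.add hΩ huH
  have hyyH := (hy.memH1 hΩ).add hΩ (hyd.const_mul hΩ (-1))
  refine ⟨huH, hfuH.congr hΩ hfu, hyyH.congr hΩ hyy, hug.trans hwg', ?_, ?_⟩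
  · rw [← h1Norm_congr hΩ hfuH hfu]
    have h1 := h1Norm_add_le hΩ hf huH
    have h2 : minmod a b * V ≤ Z * V := by gcongr; linarith
    linarith
  · rw [← h1Norm_congr hΩ hyyH hyy]
    have h1 := h1Norm_add_le hΩ (hy.memH1 hΩ) (hyd.const_mul hΩ (-1))
    rw [h1Norm_const_mul hΩ (-1) hyd, abs_neg, abs_one, one_mul] at h1
    have h2 := hy.h1Norm_le hΩ
    have h3 : ((n : ℝ) + 1) * h2Norm Ω y ≤ (n + 1) * Z := by gcongr; linarith
    linarith

/-- The collection of the constants: every term of the error estimate is a multiple of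
`κ Z`, where `Z = h² DT + H L` and `κ = 1 + α⁻¹`; two further factors `κ` come from the
post-processing and from the estimate of the control. -/
lemma scalar_estimate {i h DT H L c C₁ m q M μ k₁ g nf ny np nyy E E₃ r : ℝ} (hi : 0 ≤ i)
    (hDT : 0 ≤ DT) (hHL : 0 ≤ H * L) (hC₁ : 0 ≤ C₁) (hm : 0 ≤ m) (hq : 0 ≤ q)
    (hM : 0 ≤ M) (hk₁ : 0 ≤ k₁) (hg : g ≤ m ^ 2 * ((1 + i) * DT)) (hnf : nf ≤ k₁ * ((1 + i) * DT))
    (hny : ny ≤ DT) (hnp : np ≤ DT) (hnyy : nyy ≤ (2 * m + 4) * ((1 + i) * DT))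
    (hE : E = C₁ * (h ^ 2 * g + H * L))
    (hE₃ : E₃ = q * (M * (q * E + |c| * h ^ 2 * nf) + |c| * h ^ 2 * ny * M) + |c| * h ^ 2 * nyy)
    (hr : r ≤ E₃ + μ ^ 2 * (i * (E₃ + |c| * h ^ 2 * np))) (hr0 : 0 ≤ r) {k₃ : ℝ}
    (hk₃ : k₃ = q * (M * (q * (C₁ * (m ^ 2 + 1)) + |c| * k₁) + |c| * M) + |c| * (2 * m + 4)) :
    i * r ≤ (k₃ + μ ^ 2 * (k₃ + |c|)) *
      ((1 + i) ^ 3 * H * L + (1 + i) ^ 3 * h ^ 2 * DT) := by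
  set κ := 1 + i with hκ
  have hκ1 : 1 ≤ κ := by linarith
  have hκi : i ≤ κ := by linarith
  have hκ0 : 0 ≤ κ := by linarith
  set Z := h ^ 2 * DT + H * L with hZ
  have hZ0 : 0 ≤ Z := by positivity
  have hDκ : DT ≤ κ * DT := le_mul_of_one_le_left hDT hκ1
  have hDZ : h ^ 2 * (κ * DT) ≤ κ * Z := by
    have : 0 ≤ κ * (H * L) := by positivity
    rw [hZ]; linarith
  have hHLZ : H * L ≤ κ * Z := by
    have h1 : 0 ≤ κ * (h ^ 2 * DT) := by positivity
    have h2 : H * L ≤ κ * (H * L) := le_mul_of_one_le_left hHL hκ1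
    rw [hZ]; linarith
  have hscale : ∀ {t k : ℝ}, 0 ≤ k → t ≤ k * (κ * DT) → |c| * h ^ 2 * t ≤ |c| * k * (κ * Z) := by
    intro t k hk ht
    calc |c| * h ^ 2 * t ≤ |c| * h ^ 2 * (k * (κ * DT)) := by gcongr
      _ = |c| * k * (h ^ 2 * (κ * DT)) := by ring
      _ ≤ _ := by gcongr
  have hEZ : E ≤ C₁ * (m ^ 2 + 1) * (κ * Z) := by
    calc E ≤ C₁ * (h ^ 2 * (m ^ 2 * (κ * DT)) + H * L) := by rw [hE]; gcongr
      _ = C₁ * (m ^ 2 * (h ^ 2 * (κ * DT)) + H * L) := by ring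
      _ ≤ C₁ * (m ^ 2 * (κ * Z) + κ * Z) := by gcongr
      _ = _ := by ring
  have hfZ := hscale hk₁ hnf
  have hyZ : |c| * h ^ 2 * ny ≤ |c| * 1 * (κ * Z) := hscale zero_le_one (by linarith)
  have hpZ : |c| * h ^ 2 * np ≤ |c| * 1 * (κ * Z) := hscale zero_le_one (by linarith)
  have hyyZ := hscale (by positivity) hnyy
  have hE₃Z : E₃ ≤ k₃ * (κ * Z) := by
    calc E₃ ≤ q * (M * (q * (C₁ * (m ^ 2 + 1) * (κ * Z)) + |c| * k₁ * (κ * Z)) +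
          |c| * 1 * (κ * Z) * M) + |c| * (2 * m + 4) * (κ * Z) := by
          rw [hE₃]; gcongr
      _ = k₃ * (κ * Z) := by rw [hk₃]; ring
  have hk₃0 : 0 ≤ k₃ := by rw [hk₃]; positivity
  have hsum : E₃ + |c| * h ^ 2 * np ≤ (k₃ + |c|) * (κ * Z) := by linarith
  have hs0 : 0 ≤ (k₃ + |c|) * (κ * Z) := by positivity
  have hr' : r ≤ κ * (k₃ * (κ * Z)) + μ ^ 2 * (κ * ((k₃ + |c|) * (κ * Z))) := by
    refine hr.trans (add_le_add ?_ ?_)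
    · exact hE₃Z.trans (le_mul_of_one_le_left (by positivity) hκ1)
    · refine mul_le_mul_of_nonneg_left ?_ (sq_nonneg μ)
      exact (mul_le_mul_of_nonneg_left hsum hi).trans (mul_le_mul_of_nonneg_right hκi hs0)
  calc i * r ≤ κ * r := mul_le_mul_of_nonneg_right hκi hr0
    _ ≤ κ * (κ * (k₃ * (κ * Z)) + μ ^ 2 * (κ * ((k₃ + |c|) * (κ * Z)))) := by gcongr
    _ = _ := by rw [hZ]; ring

end GDM

end

theorem theorem3p4 :
    ∃ Cα : ℝ → ℝ,
    ∀ (n : ℕ), n = 2 ∨ n = 3 →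
    ∀ (Ω : Set (GDM.Rn n)) (A : GDM.Rn n → Matrix (Fin n) (Fin n) ℝ) (M η c : ℝ),
      IsOpen Ω → IsConnected Ω → Bornology.IsBounded Ω → GDM.IsDiffusionMatrix Ω A →
    ∃ C : ℝ,
    ∀ (X : Type*) [AddCommGroup X] [Module ℝ X] [FiniteDimensional ℝ X]
      (D : GDM.GradientDiscretisation Ω X) (T : Finset (Set (GDM.Rn n)))
      (α : ℝ) (a b : EReal) (f yd ud y p u : GDM.L2 Ω)
      (yD pD : X) (uh : GDM.L2 Ω) (R : GDM.L2 Ω → GDM.L2 Ω) (s : ℝ),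
      0 < α → a ≤ b → a ≠ ⊤ → b ≠ ⊥ →
      D.coercivity ≤ M →
      GDM.IsMesh Ω T → GDM.IsRegularMesh T η →
      GDM.IsOptimal Ω A α a b f yd ud y p u →
      GDM.IsDiscreteOptimal D A T α a b f yd ud yD pD uh →
      GDM.InterpolationAssumption D A T R c →
      GDM.ReconstructionAssumption D T c →
      GDM.IsSobolevExponent n s → GDM.SobolevAssumption D s c →
      GDM.ActiveSetAssumption T a b u c →
      GDM.MemH2 Ω ud → GDM.MemH2 Ω y → GDM.MemH2 Ω p →
      GDM.MemH1 Ω yd → GDM.MemH1 Ω f →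
      eLpNorm (fun x => GDM.postProcess T α a b ud (R p) x -
          GDM.postProcess T α a b ud (D.recon pD) x) 2 (volume.restrict Ω) ≤
        ENNReal.ofReal (C * (Cα α * GDM.meshSize T ^ (2 - 1 / s) *
            GDM.brokenW1infNorm (GDM.mixedCells T a b u) u +
          Cα α * GDM.meshSize T ^ 2 * GDM.dataTerm Ω a b yd ud f y p)) := by
  refine ⟨fun α => (1 + α⁻¹) ^ 3, fun n hn Ω A M η c hΩo _ hΩb hA => ?_⟩
  have hΩf : volume Ω ≠ ⊤ := hΩb.measure_lt_top.ne
  obtain ⟨lam, hlam0, hlam⟩ := hA.elliptic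
  set M' := max M 0 with hM'
  have hM0 : 0 ≤ M' := le_max_right _ _
  set V := GDM.l2Norm Ω (fun _ => (1 : ℝ))
  have hV0 : 0 ≤ V := GDM.l2Norm_nonneg _
  set C₁ := Real.sqrt (9 * (4 * max 1 (2 * η)) ^ n) * |c| + 4 * |c| * max 1 |c| with hC₁
  have hC₁0 : 0 ≤ C₁ := by positivity
  set k₁ : ℝ := 2 + 2 * (V + 1 + n ^ 2) with hk₁
  have hk₁0 : 0 ≤ k₁ := by positivity
  set k₃ : ℝ := M' / lam * (M' * (M' / lam * (C₁ * (n ^ 2 + 1)) + |c| * k₁) + |c| * M') +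
    |c| * (2 * n + 4) with hk₃
  refine ⟨k₃ + (M' / lam * M') ^ 2 * (k₃ + |c|), ?_⟩
  intro X _ _ _ D T α a b f yd ud y p u yD pD uh R s hα hab ha hb hco hT hη hopt hdis hR hrec hs
    hsob hact hud hy hp hyd hf
  obtain ⟨huH, hfuH, hyyH, hug, hfun, hyyn⟩ :=
    hopt.norms_le hΩo hΩf hα hab ha hb hud hy hp hyd hf
  have hu := hopt.control_eq hΩf hα hab ha hb
  have hM : ∀ v : X, ‖D.recon v‖ ≤ M' * ‖D.grad v‖ := fun v =>
    (D.norm_recon_le v).trans (mul_le_mul_of_nonneg_right (hco.trans (le_max_left _ _))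
      (norm_nonneg _))
  set w : GDM.L2 Ω := ud - α⁻¹ • p with hw
  have hû := GDM.cellControl_mem hT hΩf hab ha hb w
  have hE := fun v : X => GDM.abs_inner_sub_cellControl_le hn hT hΩb hΩo hΩf hη hab ha hb hu huH
    hs hsob hrec hact v
  set û := GDM.cellControl hT hΩf a b w
  have hvi : 0 ≤ inner ℝ (p + α • (û - ud)) (uh - û) := by
    have e : p + α • (û - ud) = α • (û - w) := by
      rw [hw, smul_sub, smul_sub, smul_sub, smul_smul, mul_inv_cancel₀ hα.ne', one_smul]
      abel
    rw [e, real_inner_smul_left]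
    exact mul_nonneg hα.le (GDM.inner_cellControl_sub_nonneg hT hΩf ha hb w hdis.control_mem)
  have hh0 : 0 ≤ GDM.meshSize T := GDM.meshSize_nonneg T
  have hL0 := GDM.brokenW1infNorm_nonneg (GDM.mixedCells T a b u) u
  have hH0 : 0 ≤ GDM.meshSize T ^ (2 - 1 / s) := Real.rpow_nonneg hh0 _
  have hg0 : 0 ≤ GDM.l2Norm Ω (GDM.weakGrad Ω u) := GDM.l2Norm_nonneg _
  have m0 := GDM.minmod_nonneg a b
  have n1 := GDM.h1Norm_nonneg (U := Ω) (u := yd)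
  have n2 := GDM.h2Norm_nonneg (U := Ω) (u := ud)
  have n3 := GDM.h1Norm_nonneg (U := Ω) (u := f)
  have n4 := GDM.h2Norm_nonneg (U := Ω) (u := y)
  have n5 := GDM.h2Norm_nonneg (U := Ω) (u := p)
  have hmain := GDM.norm_interpolation_sub_recon_le hT hΩf hA hlam0 hlam hM0 hM hα hopt hdis hR
    hfuH hyyH hy hp hû hvi (by positivity) hE rfl
  refine (GDM.eLpNorm_postProcess_sub_le hα hab ha hb (R p) (D.recon pD)).trans
    (ENNReal.ofReal_le_ofReal ?_)
  exact GDM.scalar_estimate (inv_pos.2 hα).le (by unfold GDM.dataTerm; positivity)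
    (mul_nonneg hH0 hL0) hC₁0 (Nat.cast_nonneg n) (div_nonneg hM0 hlam0.le) hM0 hk₁0 hug hfun
    (by unfold GDM.dataTerm; linarith) (by unfold GDM.dataTerm; linarith) hyyn rfl rfl hmain
    (norm_nonneg _) hk₃
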